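/- Let $\Omega\subset\mathbb{R}^2$ be a bounded domain with Lipschitz boundary, let $p>1$, $q\ge 0$, $a>0$, $\beta>0$, $\tau\in(0,1]$ be real numbers, and let $f\in L^\infty(\Omega)$. For $s\ge 0$ put $$\rho_\tau(s)=(s+\tau)^{\frac{p-2}{2}}+\beta\,(s+\tau)^{-\frac12},$$ and for $\xi\in\mathbb{R}^2$ put $$D_\tau(\xi)=(1+\tau)I+\frac{1}{|\xi|^2+\tau}\Big(\frac{1}{1+q|\xi|}-1\Big)\,\xi\xi^{T},$$ where $I$ is the $2\times2$ identity matrix. Then the system $$-\operatorname{div}\big(D_\tau(\nabla u)\nabla v\big)+\tau v=f-au\quad\text{in }\Omega,$$ $$-\operatorname{div}\big(\rho_\tau(|\nabla u|^2)\nabla u\big)+\tau|u|^{p-2}u=v\quad\text{in }\Omega,$$ with the boundary conditions $$\rho_\tau(|\nabla u|^2)\nabla u\cdot\nu=D_\tau(\nabla u)\nabla v\cdot\nu=0\quad\text{on }\partial\Omega$$ ($\nu$ the unit outward normal) has a weak solution $(v,u)$ with $$v\in W^{1,2}(\Omega)\cap L^\infty(\Omega),\qquad u\in W^{1,p}(\Omega)\cap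 L^\infty(\Omega).$$ That $(v,u)$ is a weak solution means that $$\int_\Omega D_\tau(\nabla u)\nabla v\cdot\nabla\varphi\,dz+\tau\int_\Omega v\varphi\,dz=\int_\Omega(f-au)\varphi\,dz\quad\text{for all }\varphi\in W^{1,2}(\Omega),$$ $$\int_\Omega \rho_\tau(|\nabla u|^2)\nabla u\cdot\nabla\varphi\,dz+\tau\int_\Omega|u|^{p-2}u\,\varphi\,dz=\int_\Omega v\varphi\,dz\quad\text{for all }\varphi\in W^{1,p}(\Omega).$$ -/

import Mathlib

open MeasureTheory
open scoped ContDiff NNReal ENNReal Matrix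

noncomputable section

namespace CrystalSurface

/-- The Euclidean plane. -/
abbrev Plane : Type := EuclideanSpace ℝ (Fin 2)

/-- `Ω` has a Lipschitz boundary: near each boundary point, after a rotation or reflection of the
coordinate axes, `Ω` is the set lying strictly above the graph of a Lipschitz function. -/
def HasLipschitzBoundary (Ω : Set Plane) : Prop :=
  ∀ z ∈ frontier Ω, ∃ r : ℝ, 0 < r ∧ ∃ (e : Plane ≃ₗᵢ[ℝ] Plane) (K : ℝ≥0) (γ : ℝ → ℝ),
    LipschitzWith K γ ∧
      Ω ∩ Metric.ball z r = {x | x ∈ Metric.ball z r ∧ γ ((e x) 0) < (e x) 1}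

/-- A bounded domain (nonempty connected open set) of the plane with Lipschitz boundary. -/
structure IsBoundedLipschitzDomain (Ω : Set Plane) : Prop where
  isOpen : IsOpen Ω
  isConnected : IsConnected Ω
  isBounded : Bornology.IsBounded Ω
  lipschitz : HasLipschitzBoundary Ω

/-- `u ∈ W^{1,p}(Ω)` with weak gradient `G`: both `u` and `G` are in `L^p(Ω)`, and
`∫_Ω u ∂ᵢφ = - ∫_Ω Gᵢ φ` for all `φ ∈ C_c^∞(Ω)`. (For `1 ≤ p`, which is how it is used, all
these integrals converge, and `G` is determined by `u` almost everywhere in the open set `Ω`.) -/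
structure IsW1 (Ω : Set Plane) (p : ℝ≥0∞) (u : Plane → ℝ) (G : Plane → Plane) : Prop where
  memLp : MemLp u p (volume.restrict Ω)
  memLp_grad : MemLp G p (volume.restrict Ω)
  integral_eq : ∀ φ : Plane → ℝ, ContDiff ℝ ∞ φ → HasCompactSupport φ → tsupport φ ⊆ Ω →
    ∀ i : Fin 2, ∫ x in Ω, u x * fderiv ℝ φ x (EuclideanSpace.single i 1) =
      -∫ x in Ω, G x i * φ x

/-- The function `ρ_τ(s) = (s + τ)^{(p-2)/2} + β (s + τ)^{-1/2}`. -/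
def rho (p β τ s : ℝ) : ℝ :=
  (s + τ) ^ ((p - 2) / 2) + β * (s + τ) ^ (-(1 / 2) : ℝ)

/-- The regularized mobility matrix `D_τ(ξ)`, where `ξ` stands for the gradient of `u`. -/
def mobility (q τ : ℝ) (ξ : Plane) : Matrix (Fin 2) (Fin 2) ℝ :=
  !![1 + τ + ξ 0 ^ 2 / (‖ξ‖ ^ 2 + τ) * (1 / (1 + q * ‖ξ‖) - 1),
      ξ 0 * ξ 1 / (‖ξ‖ ^ 2 + τ) * (1 / (1 + q * ‖ξ‖) - 1);
    ξ 0 * ξ 1 / (‖ξ‖ ^ 2 + τ) * (1 / (1 + q * ‖ξ‖) - 1),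
      1 + τ + ξ 1 ^ 2 / (‖ξ‖ ^ 2 + τ) * (1 / (1 + q * ‖ξ‖) - 1)]

/-- `(v, u)` is a weak solution, with `v ∈ W^{1,2}(Ω)` and `u ∈ W^{1,p}(Ω)`, of
`-div(D_τ(∇u)∇v) + τ v = f - a u` and `-div(ρ_τ(|∇u|²)∇u) + τ |u|^{p-2} u = v` in `Ω`
with the boundary conditions `D_τ(∇u)∇v · ν = 0 = ρ_τ(|∇u|²)∇u · ν` on `∂Ω`. The boundary
conditions are encoded by testing with functions that need not vanish at the boundary. The
vector fields `Gu`, `Gv`, `Gφ` are the weak gradients of `u`, `v` and of the test function. -/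
def IsWeakSolution (Ω : Set Plane) (p q a β τ : ℝ) (f v u : Plane → ℝ) : Prop :=
  ∃ Gv Gu : Plane → Plane,
    IsW1 Ω 2 v Gv ∧ IsW1 Ω (ENNReal.ofReal p) u Gu ∧
    (∀ (φ : Plane → ℝ) (Gφ : Plane → Plane), IsW1 Ω 2 φ Gφ →
      (∫ x in Ω, inner ℝ (Matrix.toEuclideanLin (mobility q τ (Gu x)) (Gv x)) (Gφ x)) +
          τ * ∫ x in Ω, v x * φ x =
        ∫ x in Ω, (f x - a * u x) * φ x) ∧
    (∀ (φ : Plane → ℝ) (Gφ : Plane → Plane), IsW1 Ω (ENNReal.ofReal p) φ Gφ →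
      (∫ x in Ω, inner ℝ (rho p β τ (‖Gu x‖ ^ 2) • Gu x) (Gφ x)) +
          τ * ∫ x in Ω, |u x| ^ (p - 2) * u x * φ x =
        ∫ x in Ω, v x * φ x)

end CrystalSurface

end

/-!
The two equations are decoupled and then solved by a fixed point argument, in which the right-hand
side `v` of the second equation is replaced by its truncation to `[-M, M]`.

* For a given bounded right-hand side, the equation for `u` is the Euler–Lagrange equation of a
  strictly convex energy. The convexity has an explicit modulus (`gap`), so that minimizing sequences
  converge strongly (`exists_minimizer`, `exists_isFluxSolution`) and both `u` and `∇u` depend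
  continuously, in `L¹`, on the right-hand side (`exists_integral_norm_sub_le_of_isFluxSolution`).
* For a given field `∇u` the equation for `v` is linear, with a bounded and uniformly elliptic matrix.
  It is solved by the Lax–Milgram lemma (`exists_isMobilitySolution`), and `v` depends continuously on
  the field and on the right-hand side (`tendsto_of_isMobilitySolution`).
* If `v` enters the second equation only through its averages over the squares of a grid, then the
  composition of the two solution maps acts on a finite-dimensional ball, and Brouwer's theorem gives
  a solution (`exists_solution_cellAverage`). Rellich's theorem (`exists_subseq_tendsto_of_bounded`)
  lets the mesh size tend to zero, which solves the system with truncated coupling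
  (`exists_solution_clip`).
* The truncation is harmless because `u` has a bound that does not depend on `M`. In the energy
  estimate for the truncation of `v` the coupling terms have a favourable sign (`energy_clip_le`), which
  bounds it in `W^{1,2}`. Hence its part above a large height is small in `L²`, and Stampacchia's
  method applies to `u` (`exists_ae_le_of_solution_clip`): the singular part of the flux grows linearly
  in `|∇u|` whatever `p` is, and in the plane `W^{1,1}` embeds into `L²`
  (`IsBoundedLipschitzDomain.exists_sobolev`). With `|f| ≤ L` and `|u| ≤ K` the maximum principle bounds
  `|v|` by any number above `(L + a K) / τ`, so that for large `M` the truncation is inactive.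

Brouwer's theorem is proved by the volume argument of Milnor and Rogers. The calculus of weak
gradients rests on the fundamental theorem of calculus along almost every segment
(`HasWeakGrad.ae_sub_eq_integral`): it yields the chain rule (`HasWeakGrad.comp`), hence the rule for
truncations (`HasWeakGrad.posPart`), as well as the Sobolev inequality and the Poincaré inequality on
squares (`lintegral_sub_cellAverage_le`) that carries the compactness theorem.
-/

namespace CrystalSurface

open Filter Topology Set Metric

/-! ### Brouwer's fixed point theorem -/

section Brouwer

variable {E : Type*} [NormedAddCommGroup E] [InnerProductSpace ℝ E] [FiniteDimensional ℝ E]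

lemma surjective_of_det_ne_zero (A : E →L[ℝ] E) (h : A.det ≠ 0) : Function.Surjective A :=
  (LinearMap.equivOfDetNeZero (A : E →ₗ[ℝ] E) h).surjective

/-- `t ↦ det (1 + t A)` is a polynomial of degree at most `dim E`, so that its value at `1` is
obtained from its values at `dim E + 1` nodes by Lagrange interpolation, with coefficients that do
not depend on `A`. -/
lemma det_one_add_eq_sum_lagrange {t : Fin (Module.finrank ℝ E + 1) → ℝ}
    (ht : Function.Injective t) (A : E →L[ℝ] E) :
    (1 + A).det = ∑ j, (Lagrange.basis Finset.univ t j).eval 1 * (1 + t j • A).det := by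
  classical
  set b := Module.finBasis ℝ E
  set M := LinearMap.toMatrix b b (A : E →ₗ[ℝ] E) with hM
  set P : Polynomial ℝ :=
    ((Polynomial.X : Polynomial ℝ) • M.map Polynomial.C +
      (1 : Matrix _ _ ℝ).map Polynomial.C).det with hP
  have heval : ∀ s : ℝ, P.eval s = (1 + s • A).det := by
    intro s
    have h1 : (1 + s • A).det = (1 + s • M).det := by
      rw [ContinuousLinearMap.det, ← LinearMap.det_toMatrix b]
      congr 1
      simp [hM]
    rw [h1, hP, ← Polynomial.coe_evalRingHom, RingHom.map_det]
    congr 1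
    ext i j
    simp [Matrix.one_apply, apply_ite, add_comm]
    ring
  have hdeg : P.degree < (Finset.univ : Finset (Fin (Module.finrank ℝ E + 1))).card := by
    refine lt_of_le_of_lt Polynomial.degree_le_natDegree ?_
    have := Polynomial.natDegree_det_X_add_C_le M 1
    rw [← hP, Fintype.card_fin] at this
    rw [Finset.card_univ, Fintype.card_fin]
    exact_mod_cast Nat.lt_succ_of_le this
  have hint := Lagrange.eq_interpolate (s := Finset.univ) (v := t) ht.injOn hdeg
  have h2 := congrArg (Polynomial.eval 1) hint
  rw [heval, one_smul, Lagrange.interpolate_apply, Polynomial.eval_finsetSum] at h2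
  rw [h2]
  refine Finset.sum_congr rfl fun j _ => ?_
  rw [Polynomial.eval_mul, Polynomial.eval_C, heval, mul_comm]

/-- There is no `C¹` retraction `x ↦ x + g x` of the closed unit ball onto the unit sphere. For small
`t` the map `x ↦ x + t g x` is a bijection of the open ball, so that the integral of its
Jacobian determinant is the volume of the ball; this integral being polynomial in `t`, the same holds
for `t = 1`, where the Jacobian determinant vanishes. -/
theorem not_exists_contDiff_retraction {g : E → E}
    (hg : ∀ x ∈ closedBall (0 : E) 1, ContDiffAt ℝ 1 g x)
    (hg0 : ∀ x, ‖x‖ = 1 → g x = 0) (hr : ∀ x ∈ closedBall (0 : E) 1, ‖x + g x‖ = 1) : False := by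
  let _ : MeasurableSpace E := borel E
  have _ : BorelSpace E := ⟨rfl⟩
  set μ : Measure E := Measure.addHaar
  have hsub : ball (0 : E) 1 ⊆ closedBall 0 1 := ball_subset_closedBall
  have hcomp : IsCompact (closedBall (0 : E) 1) := isCompact_closedBall 0 1
  have hdiff : ∀ x ∈ closedBall (0 : E) 1, DifferentiableAt ℝ g x :=
    fun x hx => (hg x hx).differentiableAt one_ne_zero
  have hcont : ContinuousOn (fderiv ℝ g) (closedBall (0 : E) 1) := fun x hx =>
    ((hg x hx).fderiv_right (m := 0) (by simp)).continuousAt.continuousWithinAt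
  obtain ⟨C, hC⟩ := hcomp.exists_bound_of_continuousOn hcont
  set K : ℝ≥0 := C.toNNReal + 1
  have hK : ∀ x ∈ closedBall (0 : E) 1, ‖fderiv ℝ g x‖ ≤ K := fun x hx => by
    have h1 := hC x hx
    have h2 := Real.le_coe_toNNReal C
    have : (K : ℝ) = C.toNNReal + 1 := by simp [K]
    linarith
  have hK1 : (1 : ℝ) ≤ K := by simp [K]
  have hlip : LipschitzOnWith K g (closedBall (0 : E) 1) :=
    (convex_closedBall 0 1).lipschitzOnWith_of_nnnorm_fderiv_le hdiff hK
  have hdetc : Continuous fun B : E →L[ℝ] E => (1 + B).det :=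
    ContinuousLinearMap.continuous_det.comp (continuous_const.add continuous_id)
  obtain ⟨ε, hε, hεpos⟩ : ∃ ε > 0, ∀ B : E →L[ℝ] E, ‖B‖ < ε → 0 < (1 + B).det := by
    have h0 : ∀ᶠ B in 𝓝 (0 : E →L[ℝ] E), 0 < (1 + B).det := by
      refine hdetc.continuousAt.eventually_const_lt ?_
      simp [ContinuousLinearMap.det]
    obtain ⟨ε, hε, h⟩ := Metric.eventually_nhds_iff.1 h0
    exact ⟨ε, hε, fun B hB => h (by simpa using hB)⟩
  set δ : ℝ := min (ε / (2 * K)) (1 / (2 * K))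
  have hδ : 0 < δ := by positivity
  -- the volume identity for small `t`
  have key : ∀ t : ℝ, 0 ≤ t → t ≤ δ →
      ∫ x in ball (0 : E) 1, (1 + t • fderiv ℝ g x).det ∂μ = μ.real (ball (0 : E) 1) := by
    intro t ht0 htδ
    have htK : t * K ≤ 1 / 2 := by
      have : t ≤ 1 / (2 * K) := htδ.trans (min_le_right _ _)
      calc t * K ≤ 1 / (2 * K) * K := by gcongr
        _ = 1 / 2 := by field_simp
    have htε : t * K < ε := by
      have : t ≤ ε / (2 * K) := htδ.trans (min_le_left _ _)
      calc t * K ≤ ε / (2 * K) * K := by gcongr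
        _ = ε / 2 := by field_simp
        _ < ε := by linarith
    have ht1 : t < 1 := by nlinarith
    set φ : E → E := fun x => x + t • g x with hφ
    have hpos : ∀ x ∈ closedBall (0 : E) 1, 0 < (1 + t • fderiv ℝ g x).det := by
      intro x hx
      refine hεpos _ ?_
      rw [norm_smul, Real.norm_of_nonneg ht0]
      exact lt_of_le_of_lt (mul_le_mul_of_nonneg_left (hK x hx) ht0) htε
    have hinj : InjOn φ (closedBall (0 : E) 1) := by
      intro x hx y hy hxy
      have h1 : x - y = t • (g y - g x) := by
        simp only [hφ] at hxy
        rw [smul_sub, sub_eq_sub_iff_add_eq_add, hxy, add_comm]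
      have h2 : ‖x - y‖ ≤ 1 / 2 * ‖x - y‖ := by
        calc ‖x - y‖ = t * ‖g y - g x‖ := by rw [h1, norm_smul, Real.norm_of_nonneg ht0]
          _ ≤ t * (K * ‖y - x‖) := by
            gcongr
            exact hlip.norm_sub_le hy hx
          _ = t * K * ‖x - y‖ := by rw [norm_sub_rev y x]; ring
          _ ≤ 1 / 2 * ‖x - y‖ := by gcongr
      have h3 : ‖x - y‖ = 0 := le_antisymm (by linarith [norm_nonneg (x - y)]) (norm_nonneg _)
      exact sub_eq_zero.1 (norm_eq_zero.1 h3)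
    have hderiv : ∀ x ∈ closedBall (0 : E) 1,
        HasStrictFDerivAt φ (1 + t • fderiv ℝ g x) x := fun x hx =>
      (hasStrictFDerivAt_id x).add (((hg x hx).hasStrictFDerivAt one_ne_zero).const_smul t)
    have hmaps : ∀ x ∈ ball (0 : E) 1, φ x ∈ ball (0 : E) 1 := by
      intro x hx
      have h1 : φ x = (1 - t) • x + t • (x + g x) := by
        simp only [hφ, sub_smul, smul_add, one_smul]; abel
      rw [mem_ball_zero_iff] at hx ⊢
      calc ‖φ x‖ ≤ ‖(1 - t) • x‖ + ‖t • (x + g x)‖ := by rw [h1]; exact norm_add_le _ _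
        _ = (1 - t) * ‖x‖ + t * 1 := by
          rw [norm_smul, norm_smul, hr x (hsub (mem_ball_zero_iff.2 hx)),
            Real.norm_of_nonneg ht0, Real.norm_of_nonneg (by linarith)]
        _ < 1 := by nlinarith
    have himage : φ '' ball (0 : E) 1 = ball 0 1 := by
      refine Subset.antisymm (image_subset_iff.2 hmaps) ?_
      refine (convex_ball (0 : E) 1).isPreconnected.subset_of_closure_inter_subset ?_ ?_ ?_
      · rw [isOpen_iff_mem_nhds]
        rintro _ ⟨x, hx, rfl⟩
        have hsurj := surjective_of_det_ne_zero _ (hpos x (hsub hx)).ne'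
        rw [← (hderiv x (hsub hx)).map_nhds_eq_of_surj (LinearMap.range_eq_top.2 hsurj)]
        exact image_mem_map (isOpen_ball.mem_nhds hx)
      · exact ⟨φ 0, hmaps 0 (by simp), mem_image_of_mem _ (by simp)⟩
      · rintro y ⟨hy, hy1⟩
        have hcl : IsClosed (φ '' closedBall (0 : E) 1) :=
          (hcomp.image_of_continuousOn
            fun x hx => (hderiv x hx).continuousAt.continuousWithinAt).isClosed
        obtain ⟨x, hx, rfl⟩ := closure_minimal (image_mono hsub) hcl hy
        refine ⟨x, ?_, rfl⟩
        by_contra hx1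
        have hx2 : ‖x‖ = 1 := le_antisymm (mem_closedBall_zero_iff.1 hx)
          (not_lt.1 fun h => hx1 (mem_ball_zero_iff.2 h))
        have : φ x = x := by simp [hφ, hg0 x hx2]
        rw [this] at hy1
        exact hx1 hy1
    have hcv := integral_image_eq_integral_abs_det_fderiv_smul μ
      (measurableSet_ball (x := (0 : E)) (ε := 1))
      (fun x hx => (hderiv x (hsub hx)).hasFDerivAt.hasFDerivWithinAt) (hinj.mono hsub)
      (fun _ => (1 : ℝ))
    rw [himage] at hcv
    rw [setIntegral_const, smul_eq_mul, mul_one] at hcv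
    simp_rw [smul_eq_mul, mul_one] at hcv
    rw [hcv]
    refine setIntegral_congr_fun measurableSet_ball fun x hx => ?_
    exact (abs_of_pos (hpos x (hsub hx))).symm
  -- extrapolation to `t = 1`
  set n := Module.finrank ℝ E
  set t : Fin (n + 1) → ℝ := fun j => δ * (j : ℝ) / (n + 1) with ht
  have htinj : Function.Injective t := by
    intro i j hij
    have h1 : (n + 1 : ℝ) ≠ 0 := by positivity
    have h2 : (i : ℝ) = j := mul_left_cancel₀ hδ.ne' ((div_left_inj' h1).1 hij)
    exact Fin.ext (by exact_mod_cast h2)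
  have ht0 : ∀ j, 0 ≤ t j := fun j => by simp only [ht]; positivity
  have htδ : ∀ j, t j ≤ δ := fun j => by
    simp only [ht]
    rw [div_le_iff₀ (by positivity)]
    have : (j : ℝ) ≤ n + 1 := by exact_mod_cast j.2.le
    gcongr
  have hintg : ∀ s : ℝ,
      IntegrableOn (fun x => (1 + s • fderiv ℝ g x).det) (ball (0 : E) 1) μ := fun s =>
    ((hdetc.comp_continuousOn (hcont.const_smul s)).integrableOn_compact hcomp).mono_set hsub
  have hone : ∫ x in ball (0 : E) 1, (1 + fderiv ℝ g x).det ∂μ = μ.real (ball (0 : E) 1) := by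
    rw [integral_congr_ae
      (ae_of_all _ fun x => det_one_add_eq_sum_lagrange htinj (fderiv ℝ g x))]
    rw [integral_finsetSum _ fun j _ => (hintg (t j)).const_mul _]
    simp_rw [integral_const_mul, key _ (ht0 _) (htδ _)]
    rw [← Finset.sum_mul, ← Polynomial.eval_finsetSum,
      Lagrange.sum_basis htinj.injOn Finset.univ_nonempty]
    simp
  have hzero : ∀ x ∈ ball (0 : E) 1, (1 + fderiv ℝ g x).det = 0 := by
    intro x hx
    by_contra hne
    have hsurj := surjective_of_det_ne_zero _ hne
    have hd : HasFDerivAt (fun y => y + g y) (1 + fderiv ℝ g x) x :=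
      (hasFDerivAt_id x).add (hdiff x (hsub hx)).hasFDerivAt
    have h1 := hd.norm_sq
    have h2 : HasFDerivAt (fun y => ‖y + g y‖ ^ 2) (0 : E →L[ℝ] ℝ) x := by
      refine (hasFDerivAt_const (1 : ℝ) x).congr_of_eventuallyEq ?_
      filter_upwards [isOpen_ball.mem_nhds hx] with y hy
      simp [hr y (hsub hy)]
    obtain ⟨y, hy⟩ := hsurj (x + g x)
    have h3 := congrArg (fun L : E →L[ℝ] ℝ => L y) (h1.unique h2)
    simp only [smul_apply, ContinuousLinearMap.comp_apply, hy,
      innerSL_apply_apply, real_inner_self_eq_norm_sq, hr x (hsub hx),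
      zero_apply] at h3
    norm_num at h3
  rw [setIntegral_congr_fun measurableSet_ball hzero, integral_zero] at hone
  exact (ENNReal.toReal_pos (measure_ball_pos μ (0 : E) one_pos).ne' measure_ball_lt_top.ne).ne hone

/-- If `F` had no fixed point, sending `x` to the point where the ray from `F x` through `x` leaves
the ball would be a retraction onto the sphere. -/
lemma exists_fixedPoint_of_contDiff {F : E → E} (hF : ContDiff ℝ 1 F) (hF1 : ∀ x, ‖F x‖ ≤ 1) :
    ∃ x, F x = x := by
  by_contra! hne
  set w : E → E := fun x => x - F x with hw
  set D : E → ℝ := fun x => inner ℝ x (w x) ^ 2 + ‖w x‖ ^ 2 * (1 - ‖x‖ ^ 2) with hD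
  have hw0 : ∀ x, 0 < ‖w x‖ ^ 2 := fun x => by
    have : w x ≠ 0 := sub_ne_zero.2 (hne x).symm
    positivity
  have hinner : ∀ x, ‖x‖ = 1 → 0 < inner ℝ x (w x) := by
    intro x hx
    have h1 : ‖w x‖ ^ 2 = ‖x‖ ^ 2 - 2 * inner ℝ x (F x) + ‖F x‖ ^ 2 := norm_sub_sq_real x (F x)
    have h2 : inner ℝ x (w x) = 1 - inner ℝ x (F x) := by
      simp [hw, inner_sub_right, hx]
    have h3 := hw0 x
    have h4 : ‖F x‖ ^ 2 ≤ 1 := pow_le_one₀ (norm_nonneg _) (hF1 x)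
    rw [hx] at h1
    linarith
  have hDpos : ∀ x ∈ closedBall (0 : E) 1, 0 < D x := by
    intro x hx
    rw [mem_closedBall_zero_iff] at hx
    rcases hx.lt_or_eq with h | h
    · have h1 : 0 < 1 - ‖x‖ ^ 2 := by nlinarith [norm_nonneg x]
      have := mul_pos (hw0 x) h1
      simp only [hD]; positivity
    · have := hinner x h
      simp only [hD, h]; norm_num; positivity
  have hwc : ContDiff ℝ 1 w := contDiff_id.sub hF
  have hic : ContDiff ℝ 1 fun x => inner ℝ x (w x) := contDiff_id.inner ℝ hwc
  have hDc : ContDiff ℝ 1 D :=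
    (hic.pow 2).add (hwc.norm_sq ℝ |>.mul (contDiff_const.sub (contDiff_norm_sq ℝ)))
  set l : E → ℝ := fun x => (-inner ℝ x (w x) + √(D x)) / ‖w x‖ ^ 2 with hl
  refine not_exists_contDiff_retraction (g := fun x => l x • w x) (fun x hx => ?_) (fun x hx => ?_)
    (fun x hx => ?_)
  · refine ContDiffAt.smul ?_ hwc.contDiffAt
    exact ((hic.contDiffAt.neg).add (hDc.contDiffAt.sqrt (hDpos x hx).ne')).div
      (hwc.norm_sq ℝ).contDiffAt (hw0 x).ne'
  · have h1 : D x = inner ℝ x (w x) ^ 2 := by simp [hD, hx]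
    simp [hl, h1, Real.sqrt_sq (hinner x hx).le]
  · have h1 : ‖x + l x • w x‖ ^ 2 = 1 := by
      rw [norm_add_sq_real, inner_smul_right, norm_smul, mul_pow, Real.norm_eq_abs, sq_abs]
      have h2 : l x * ‖w x‖ ^ 2 = -inner ℝ x (w x) + √(D x) := by
        exact div_mul_cancel₀ _ (hw0 x).ne'
      have h3 : √(D x) ^ 2 = D x := Real.sq_sqrt (hDpos x hx).le
      refine mul_right_cancel₀ (hw0 x).ne' ?_
      have h4 : (‖x‖ ^ 2 + 2 * (l x * inner ℝ x (w x)) + l x ^ 2 * ‖w x‖ ^ 2) * ‖w x‖ ^ 2 =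
        ‖x‖ ^ 2 * ‖w x‖ ^ 2 + 2 * (l x * ‖w x‖ ^ 2) * inner ℝ x (w x) +
          (l x * ‖w x‖ ^ 2) ^ 2 := by ring
      rw [h4, h2]
      have h5 : D x = inner ℝ x (w x) ^ 2 + ‖w x‖ ^ 2 * (1 - ‖x‖ ^ 2) := rfl
      linear_combination h3 + h5
    exact (pow_eq_one_iff_of_nonneg (norm_nonneg _) two_ne_zero).1 h1

/-- **Brouwer's fixed point theorem**, for a continuous map of the whole space into the closed unit
ball. -/
theorem exists_fixedPoint_of_continuous {F : E → E} (hF : Continuous F) (hF1 : ∀ x, ‖F x‖ ≤ 1) :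
    ∃ x, F x = x := by
  let _ : MeasurableSpace E := borel E
  have _ : BorelSpace E := ⟨rfl⟩
  set μ : Measure E := Measure.addHaar
  have hcomp : IsCompact (closedBall (0 : E) 1) := isCompact_closedBall 0 1
  by_contra! hne
  obtain ⟨c, hc, hcF⟩ : ∃ c > 0, ∀ x ∈ closedBall (0 : E) 1, c ≤ ‖F x - x‖ := by
    obtain ⟨x, -, hx⟩ := hcomp.exists_isMinOn (f := fun x => ‖F x - x‖) ⟨0, by simp⟩
      (by fun_prop)
    exact ⟨‖F x - x‖, norm_pos_iff.2 (sub_ne_zero.2 (hne x)), fun y hy => hx hy⟩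
  have huc : UniformContinuousOn F (closedBall (0 : E) 2) :=
    (isCompact_closedBall (0 : E) 2).uniformContinuousOn_of_continuous hF.continuousOn
  obtain ⟨d, hd, hdF⟩ := Metric.uniformContinuousOn_iff.1 huc (c / 2) (half_pos hc)
  set r := min d 1
  have hr : 0 < r := lt_min hd one_pos
  let φ : ContDiffBump (0 : E) := ⟨r / 2, r, half_pos hr, half_lt_self hr⟩
  set G : E → E := convolution (φ.normed μ) F (ContinuousLinearMap.lsmul ℝ ℝ) μ with hG
  have hGc : ContDiff ℝ 1 G :=
    φ.hasCompactSupport_normed.contDiff_convolution_left (n := 1) _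
      (φ.contDiff_normed) (hF.locallyIntegrable)
  have hG1 : ∀ x, ‖G x‖ ≤ 1 := fun x => by
    have := dist_convolution_le (f := φ.normed μ) (μ := μ) (g := F) (x₀ := x) (z₀ := 0) (R := r)
      zero_le_one φ.support_normed_eq.subset (fun x => φ.nonneg_normed x) φ.integral_normed
      hF.aestronglyMeasurable (fun y _ => by simpa using hF1 y)
    simpa [dist_eq_norm] using this
  obtain ⟨x, hx⟩ := exists_fixedPoint_of_contDiff hGc hG1
  have hx1 : ‖x‖ ≤ 1 := hx ▸ hG1 x
  have h1 : dist (G x) (F x) ≤ c / 2 := by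
    refine ContDiffBump.dist_normed_convolution_le hF.aestronglyMeasurable (fun y hy => ?_)
    have hyr : dist y x < r := hy
    refine (hdF y ?_ x ?_ (hyr.trans_le (min_le_left _ _))).le
    · rw [mem_closedBall_zero_iff]
      have h2 : ‖y‖ ≤ ‖y - x‖ + ‖x‖ := by simpa using norm_add_le (y - x) x
      rw [← dist_eq_norm] at h2
      linarith [min_le_right d 1]
    · rw [mem_closedBall_zero_iff]; linarith
  have h2 := hcF x (mem_closedBall_zero_iff.2 hx1)
  rw [hx, dist_eq_norm, norm_sub_rev] at h1
  linarith

end Brouwer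

/-! ### Weak gradients and integration along segments -/

section WeakGradient

/-- `G` is a weak gradient of `u` in `U`, without any integrability requirement. -/
def HasWeakGrad (U : Set Plane) (u : Plane → ℝ) (G : Plane → Plane) : Prop :=
  ∀ φ : Plane → ℝ, ContDiff ℝ ∞ φ → HasCompactSupport φ → tsupport φ ⊆ U →
    ∀ i : Fin 2, ∫ x in U, u x * fderiv ℝ φ x (EuclideanSpace.single i 1) =
      -∫ x in U, G x i * φ x

variable {U V W : Set Plane} {u w : Plane → ℝ} {G H : Plane → Plane}

lemma integrable_mul_of_hasCompactSupport {μ : Measure Plane} {φ : Plane → ℝ}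
    (hu : Integrable u μ) (hφ : Continuous φ) (hφc : HasCompactSupport φ) :
    Integrable (fun x => u x * φ x) μ := by
  obtain ⟨C, hC⟩ := hφ.bounded_above_of_compact_support hφc
  exact hu.mul_bdd hφ.aestronglyMeasurable (ae_of_all _ hC)

lemma integrable_mul_fderiv {μ : Measure Plane} {φ : Plane → ℝ} (hu : Integrable u μ)
    (hφ : ContDiff ℝ ∞ φ) (hφc : HasCompactSupport φ) (d : Plane) :
    Integrable (fun x => u x * fderiv ℝ φ x d) μ :=
  integrable_mul_of_hasCompactSupport hu
    ((hφ.continuous_fderiv (by simp)).clm_apply continuous_const) (hφc.fderiv_apply ℝ d)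

lemma integrable_coord {μ : Measure Plane} (hG : Integrable G μ) (i : Fin 2) :
    Integrable (fun x => G x i) μ := by
  refine hG.mono ?_ (ae_of_all _ fun x => PiLp.norm_apply_le (G x) i)
  exact (show Continuous fun x : Plane => x i by fun_prop).comp_aestronglyMeasurable
    hG.aestronglyMeasurable

lemma HasWeakGrad.add (h₁ : HasWeakGrad U u G) (h₂ : HasWeakGrad U w H)
    (hu : IntegrableOn u U) (hG : IntegrableOn G U) (hw : IntegrableOn w U)
    (hH : IntegrableOn H U) : HasWeakGrad U (fun x => u x + w x) (fun x => G x + H x) := by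
  intro φ hφ hφc hφU i
  simp only [PiLp.add_apply, add_mul]
  rw [integral_add (integrable_mul_fderiv hu hφ hφc _) (integrable_mul_fderiv hw hφ hφc _),
    integral_add (integrable_mul_of_hasCompactSupport (integrable_coord hG i) hφ.continuous hφc)
      (integrable_mul_of_hasCompactSupport (integrable_coord hH i) hφ.continuous hφc),
    h₁ φ hφ hφc hφU i, h₂ φ hφ hφc hφU i, neg_add]

lemma HasWeakGrad.const_mul (h : HasWeakGrad U u G) (c : ℝ) :
    HasWeakGrad U (fun x => c * u x) (fun x => c • G x) := by
  intro φ hφ hφc hφU i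
  simp only [PiLp.smul_apply, smul_eq_mul, mul_assoc, integral_const_mul, h φ hφ hφc hφU i,
    mul_neg]

lemma HasWeakGrad.congr_ae (h : HasWeakGrad U u G) (hu : u =ᵐ[volume.restrict U] w)
    (hG : G =ᵐ[volume.restrict U] H) : HasWeakGrad U w H := by
  intro φ hφ hφc hφU i
  have h1 : ∫ x in U, w x * fderiv ℝ φ x (EuclideanSpace.single i 1) =
      ∫ x in U, u x * fderiv ℝ φ x (EuclideanSpace.single i 1) :=
    integral_congr_ae (hu.mono fun x hx => by simp only [hx])
  have h2 : ∫ x in U, H x i * φ x = ∫ x in U, G x i * φ x :=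
    integral_congr_ae (hG.mono fun x hx => by simp only [hx])
  rw [h1, h2, h φ hφ hφc hφU i]

lemma plane_eq_sum (d : Plane) : d = ∑ i, d i • EuclideanSpace.single i (1 : ℝ) := by
  ext j
  fin_cases j <;> simp

lemma HasWeakGrad.integral_fderiv (h : HasWeakGrad U u G) (hu : IntegrableOn u U)
    (hG : IntegrableOn G U) {φ : Plane → ℝ} (hφ : ContDiff ℝ ∞ φ) (hφc : HasCompactSupport φ)
    (hφU : tsupport φ ⊆ U) (d : Plane) :
    ∫ x in U, u x * fderiv ℝ φ x d = -∫ x in U, inner ℝ (G x) d * φ x := by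
  have h1 : ∀ x, u x * fderiv ℝ φ x d =
      d 0 * (u x * fderiv ℝ φ x (EuclideanSpace.single 0 1)) +
        d 1 * (u x * fderiv ℝ φ x (EuclideanSpace.single 1 1)) := fun x => by
    conv_lhs => rw [plane_eq_sum d, Fin.sum_univ_two, map_add, map_smul, map_smul]
    simp only [smul_eq_mul]; ring
  have h2 : ∀ x, inner ℝ (G x) d * φ x = d 0 * (G x 0 * φ x) + d 1 * (G x 1 * φ x) := fun x => by
    simp only [PiLp.inner_apply, Fin.sum_univ_two, RCLike.inner_apply, conj_trivial]; ring
  simp_rw [h1, h2]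
  rw [integral_add ((integrable_mul_fderiv hu hφ hφc _).const_mul _)
      ((integrable_mul_fderiv hu hφ hφc _).const_mul _),
    integral_add
      ((integrable_mul_of_hasCompactSupport (integrable_coord hG 0) hφ.continuous hφc).const_mul _)
      ((integrable_mul_of_hasCompactSupport (integrable_coord hG 1) hφ.continuous hφc).const_mul _)]
  simp only [integral_const_mul, h φ hφ hφc hφU]
  ring

/-- Weak gradients are stable under `L¹` convergence. -/
lemma HasWeakGrad.of_tendsto {un : ℕ → Plane → ℝ} {Gn : ℕ → Plane → Plane}
    (h : ∀ n, HasWeakGrad U (un n) (Gn n)) (hun : ∀ n, IntegrableOn (un n) U)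
    (hGn : ∀ n, IntegrableOn (Gn n) U) (hu : IntegrableOn u U) (hG : IntegrableOn G U)
    (hul : Tendsto (fun n => ∫ x in U, ‖un n x - u x‖) atTop (𝓝 0))
    (hGl : Tendsto (fun n => ∫ x in U, ‖Gn n x - G x‖) atTop (𝓝 0)) : HasWeakGrad U u G := by
  have aux : ∀ {f : ℕ → Plane → ℝ} {f' ψ : Plane → ℝ}, (∀ n, IntegrableOn (f n) U) →
      IntegrableOn f' U → Tendsto (fun n => ∫ x in U, ‖f n x - f' x‖) atTop (𝓝 0) →
      Continuous ψ → HasCompactSupport ψ →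
      Tendsto (fun n => ∫ x in U, f n x * ψ x) atTop (𝓝 (∫ x in U, f' x * ψ x)) := by
    intro f f' ψ hf hf' hl hψ hψc
    obtain ⟨C, hC⟩ := hψ.bounded_above_of_compact_support hψc
    rw [tendsto_iff_norm_sub_tendsto_zero]
    refine squeeze_zero (fun _ => norm_nonneg _) (fun n => ?_)
      (by simpa using hl.const_mul C)
    rw [← integral_sub (integrable_mul_of_hasCompactSupport (hf n) hψ hψc)
      (integrable_mul_of_hasCompactSupport hf' hψ hψc), ← integral_const_mul]
    refine norm_integral_le_of_norm_le (((hf n).sub hf').norm.const_mul C)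
      (ae_of_all _ fun x => ?_)
    rw [← sub_mul, norm_mul, mul_comm]
    exact mul_le_mul_of_nonneg_right (hC x) (norm_nonneg _)
  intro φ hφ hφc hφU i
  have h1 := aux hun hu hul
    ((hφ.continuous_fderiv (by simp)).clm_apply (continuous_const (y := EuclideanSpace.single i 1)))
    (hφc.fderiv_apply ℝ _)
  have h2 := aux (f := fun n x => Gn n x i) (f' := fun x => G x i)
    (fun n => integrable_coord (hGn n) i) (integrable_coord hG i)
    (squeeze_zero (fun n => integral_nonneg fun _ => norm_nonneg _) (fun n =>
      integral_mono (((integrable_coord (hGn n) i).sub (integrable_coord hG i)).norm)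
        (((hGn n).sub hG).norm) fun x => by
          simpa using PiLp.norm_apply_le (Gn n x - G x) i) hGl) hφ.continuous hφc
  refine tendsto_nhds_unique h1 ?_
  simp_rw [h _ φ hφ hφc hφU i]
  exact h2.neg

lemma integrable_comp_shear {F : Type*} [NormedAddCommGroup F] {f : Plane → F}
    (hf : Integrable f) (hfm : StronglyMeasurable f) (ν : Measure ℝ) [IsFiniteMeasure ν]
    (h : Plane) : Integrable (fun z : ℝ × Plane => f (z.2 + z.1 • h)) (ν.prod volume) := by
  have hm : Measurable fun z : ℝ × Plane => z.2 + z.1 • h := by fun_prop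
  refine (integrable_prod_iff (hfm.comp_measurable hm).aestronglyMeasurable).2
    ⟨ae_of_all _ fun s => hf.comp_add_right (s • h), ?_⟩
  have : ∀ s : ℝ, ∫ x, ‖f (x + s • h)‖ = ∫ x, ‖f x‖ := fun s =>
    integral_add_right_eq_self (fun x => ‖f x‖) (s • h)
  simp [this]

/-- Averaging a test function along a segment. -/
lemma contDiff_integral_line {φ : Plane → ℝ} (hφ : ContDiff ℝ ∞ φ) (hφc : HasCompactSupport φ)
    (h : Plane) : ContDiff ℝ ∞ fun x => ∫ s in (0 : ℝ)..1, φ (x - s • h) := by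
  set ν : Measure Plane := (volume.restrict (Ioc (0 : ℝ) 1)).map fun s => s • h
  have hm : Measurable fun s : ℝ => s • h := by fun_prop
  have := hφc.contDiff_convolution_right (n := ⊤) (ContinuousLinearMap.lsmul ℝ ℝ) (μ := ν)
    (f := fun _ => (1 : ℝ)) (locallyIntegrable_const 1) hφ
  convert this using 2 with x
  have hc := hφ.continuous
  rw [convolution_def, integral_map hm.aemeasurable
    (Continuous.aestronglyMeasurable (by simp only [ContinuousLinearMap.lsmul_apply]; fun_prop)),
    intervalIntegral.integral_of_le zero_le_one]
  simp

lemma fderiv_integral_line {φ : Plane → ℝ} (hφ : ContDiff ℝ ∞ φ) (hφc : HasCompactSupport φ)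
    (h x : Plane) :
    fderiv ℝ (fun x => ∫ s in (0 : ℝ)..1, φ (x - s • h)) x h = φ x - φ (x - h) := by
  have hψ := (contDiff_integral_line hφ hφc h).differentiable (by simp) x
  have h1 : HasDerivAt (fun t : ℝ => ∫ s in (0 : ℝ)..1, φ (x + t • h - s • h))
      (fderiv ℝ (fun x => ∫ s in (0 : ℝ)..1, φ (x - s • h)) x h) 0 := by
    have h2 : HasDerivAt (fun t : ℝ => x + t • h) h 0 := by
      simpa using ((hasDerivAt_id (0 : ℝ)).smul_const h).const_add x
    have h3 := hψ.hasFDerivAt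
    rw [show x = x + (0 : ℝ) • h by simp] at h3
    have h4 := h3.comp_hasDerivAt (0 : ℝ) h2
    simp only [zero_smul, add_zero] at h4
    exact h4
  have hc : Continuous fun s : ℝ => φ (x - s • h) := by
    have := hφ.continuous; fun_prop
  set F : ℝ → ℝ := fun r => ∫ s in (0 : ℝ)..r, φ (x - s • h)
  have hF : ∀ r, HasDerivAt F (φ (x - r • h)) r := fun r =>
    intervalIntegral.integral_hasDerivAt_right (hc.intervalIntegrable _ _)
      hc.aestronglyMeasurable.stronglyMeasurableAtFilter hc.continuousAt
  have h2 : (fun t : ℝ => ∫ s in (0 : ℝ)..1, φ (x + t • h - s • h)) =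
      fun t => F (1 - t) - F (0 - t) := by
    ext t
    have : ∀ s : ℝ, φ (x + t • h - s • h) = φ (x - (s - t) • h) := fun s => by
      congr 1; rw [sub_smul]; abel
    simp_rw [this]
    rw [intervalIntegral.integral_comp_sub_right (fun s => φ (x - s • h)),
      intervalIntegral.integral_interval_sub_left (hc.intervalIntegrable _ _)
        (hc.intervalIntegrable _ _)]
  rw [h2] at h1
  have h3 : HasDerivAt (fun t : ℝ => F (1 - t) - F (0 - t))
      (φ (x - (1 - (0 : ℝ)) • h) * -1 - φ (x - (0 - (0 : ℝ)) • h) * -1) 0 :=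
    ((hF _).comp 0 ((hasDerivAt_id 0).const_sub 1)).sub
      ((hF _).comp 0 ((hasDerivAt_id 0).const_sub 0))
  rw [h1.unique h3]
  simp
  ring

lemma tsupport_integral_line_subset {φ : Plane → ℝ} (hφc : HasCompactSupport φ) (h : Plane)
    {ψ : Plane → ℝ} (hψ : ψ = fun x => ∫ s in (0 : ℝ)..1, φ (x - s • h)) :
    HasCompactSupport ψ ∧
      tsupport ψ ⊆ (fun z : ℝ × Plane => z.2 + z.1 • h) '' (Icc (0 : ℝ) 1 ×ˢ tsupport φ) := by
  set K := (fun z : ℝ × Plane => z.2 + z.1 • h) '' (Icc (0 : ℝ) 1 ×ˢ tsupport φ)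
  have hK : IsCompact K := (isCompact_Icc.prod hφc).image (by fun_prop)
  have h0 : ∀ x, x ∉ K → ψ x = 0 := by
    intro x hx
    rw [hψ]
    refine (intervalIntegral.integral_congr (g := fun _ => (0 : ℝ)) fun s hs => ?_).trans (by simp)
    rw [uIcc_of_le zero_le_one] at hs
    by_contra hne
    exact hx ⟨(s, x - s • h), ⟨hs, subset_tsupport _ hne⟩, by simp⟩
  have hsub : tsupport ψ ⊆ K := closure_minimal (fun x hx => by
    by_contra hxK; exact hx (h0 x hxK)) hK.isClosed
  exact ⟨hK.of_isClosed_subset (isClosed_tsupport _) hsub, hsub⟩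

/-- The fundamental theorem of calculus along segments, for almost every translate of the segment
`[0, h]`. It is obtained by testing with averages of test functions along the segment. -/
theorem HasWeakGrad.ae_sub_eq_integral (hw : HasWeakGrad V u G)
    (hu : Integrable u)
    (hG : Integrable G) (hGm : StronglyMeasurable G) (hW : IsOpen W) {h : Plane}
    (hWV : ∀ x ∈ W, ∀ s ∈ Icc (0 : ℝ) 1, x + s • h ∈ V) :
    ∀ᵐ x, x ∈ W → u (x + h) - u x = ∫ s in (0 : ℝ)..1, inner ℝ (G (x + s • h)) h := by
  set ν : Measure ℝ := volume.restrict (Ioc 0 1)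
  have hGi : Integrable fun x => inner ℝ (G x) h := hG.inner_const h
  have hshear : Integrable (fun z : ℝ × Plane => inner ℝ (G (z.2 + z.1 • h)) h)
      (ν.prod volume) := (integrable_comp_shear hG hGm ν h).inner_const h
  have hint : Integrable fun x => ∫ s in (0 : ℝ)..1, inner ℝ (G (x + s • h)) h := by
    simp_rw [intervalIntegral.integral_of_le zero_le_one]
    exact hshear.integral_prod_right
  set f : Plane → ℝ := fun x => u (x + h) - u x - ∫ s in (0 : ℝ)..1, inner ℝ (G (x + s • h)) h
  have hf : Integrable f := ((hu.comp_add_right h).sub hu).sub hint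
  suffices hae : ∀ᵐ x, x ∈ W → f x = 0 from
    hae.mono fun x hx hxW => sub_eq_zero.1 (hx hxW)
  refine hW.ae_eq_zero_of_integral_contDiff_smul_eq_zero (hf.locallyIntegrable.locallyIntegrableOn W)
    fun φ hφ hφc hφW => ?_
  set ψ : Plane → ℝ := fun x => ∫ s in (0 : ℝ)..1, φ (x - s • h) with hψ
  obtain ⟨hψc, hψK⟩ := tsupport_integral_line_subset hφc h hψ
  have hψV : tsupport ψ ⊆ V := by
    refine hψK.trans ?_
    rintro _ ⟨⟨s, x⟩, ⟨hs, hx⟩, rfl⟩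
    exact hWV x (hφW hx) s hs
  have hψs := contDiff_integral_line hφ hφc h
  have htest := hw.integral_fderiv hu.integrableOn hG.integrableOn (φ := ψ) hψs hψc hψV h
  have hsup : ∀ x, x ∉ V → ψ x = 0 := fun x hx => image_eq_zero_of_notMem_tsupport fun h => hx (hψV h)
  have hsup' : ∀ x, x ∉ V → fderiv ℝ ψ x h = 0 := fun x hx => by
    rw [image_eq_zero_of_notMem_tsupport (f := fderiv ℝ ψ)
      fun h => hx (hψV (tsupport_fderiv_subset ℝ h))]; rfl
  rw [setIntegral_eq_integral_of_forall_compl_eq_zero fun x hx => by rw [hsup' x hx, mul_zero],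
    setIntegral_eq_integral_of_forall_compl_eq_zero fun x hx => by rw [hsup x hx, mul_zero]]
    at htest
  have hφi : Integrable fun x => u x * φ x :=
    integrable_mul_of_hasCompactSupport hu hφ.continuous hφc
  have hφi' : Integrable fun x => u (x + h) * φ x :=
    integrable_mul_of_hasCompactSupport (hu.comp_add_right h) hφ.continuous hφc
  have hL : ∫ x, u x * fderiv ℝ ψ x h = (∫ x, u x * φ x) - ∫ x, u (x + h) * φ x := by
    have h1 : Integrable fun x => u x * φ (x - h) := by
      simpa using hφi'.comp_sub_right h
    have h2 : ∫ x, u (x + h) * φ x = ∫ x, u x * φ (x - h) := by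
      rw [← integral_add_right_eq_self (fun x => u x * φ (x - h)) h]; simp
    rw [h2, ← integral_sub hφi h1]
    refine integral_congr_ae (ae_of_all _ fun x => ?_)
    simp only [hψ, fderiv_integral_line hφ hφc h x, mul_sub]
  obtain ⟨C, hC⟩ := hφ.continuous.bounded_above_of_compact_support hφc
  have hprod : Integrable (fun z : ℝ × Plane => inner ℝ (G (z.2 + z.1 • h)) h * φ z.2)
      (ν.prod volume) :=
    hshear.mul_bdd (hφ.continuous.comp continuous_snd).aestronglyMeasurable
      (ae_of_all _ fun z => hC z.2)
  have hprod' : Integrable (fun z : ℝ × Plane => inner ℝ (G z.2) h * φ (z.2 - z.1 • h))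
      (ν.prod volume) := by
    refine (hGi.comp_snd ν).mul_bdd ?_ (ae_of_all _ fun z => hC _)
    have := hφ.continuous
    exact Continuous.aestronglyMeasurable (by fun_prop)
  have hR : ∫ x, inner ℝ (G x) h * ψ x =
      ∫ x, φ x * ∫ s in (0 : ℝ)..1, inner ℝ (G (x + s • h)) h := by
    calc ∫ x, inner ℝ (G x) h * ψ x = ∫ x, (∫ s, inner ℝ (G x) h * φ (x - s • h) ∂ν) := by
          simp only [hψ, intervalIntegral.integral_of_le zero_le_one, ν, integral_const_mul]
      _ = ∫ s, (∫ x, inner ℝ (G x) h * φ (x - s • h)) ∂ν := (integral_integral_swap hprod').symm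
      _ = ∫ s, (∫ x, inner ℝ (G (x + s • h)) h * φ x) ∂ν := by
          refine integral_congr_ae (ae_of_all _ fun s => ?_)
          simp only
          rw [← integral_add_right_eq_self (fun x => inner ℝ (G x) h * φ (x - s • h)) (s • h)]
          simp
      _ = ∫ x, (∫ s, inner ℝ (G (x + s • h)) h * φ x ∂ν) := integral_integral_swap hprod
      _ = _ := by
          simp only [intervalIntegral.integral_of_le zero_le_one, ν, integral_mul_const]
          simp only [mul_comm]
  rw [hL, hR] at htest
  have h3 : Integrable fun x => φ x * ∫ s in (0 : ℝ)..1, inner ℝ (G (x + s • h)) h := by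
    simpa only [mul_comm] using integrable_mul_of_hasCompactSupport hint hφ.continuous hφc
  have h4 : ∀ x, φ x • f x = u (x + h) * φ x - u x * φ x -
      φ x * ∫ s in (0 : ℝ)..1, inner ℝ (G (x + s • h)) h := fun x => by
    simp only [f, smul_eq_mul]; ring
  simp_rw [h4]
  rw [integral_sub (f := fun x => u (x + h) * φ x - u x * φ x) (hφi'.sub hφi) h3,
    integral_sub hφi' hφi]
  linarith

end WeakGradient

/-! ### The chain rule for weak gradients -/

section ChainRule

lemma exists_subseq_ae_tendsto {α F : Type*} [MeasurableSpace α] {μ : Measure α}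
    [NormedAddCommGroup F] {f : ℕ → α → F} {g : α → F} (hf : ∀ n, Integrable (f n) μ)
    (hg : Integrable g μ) (h : Tendsto (fun n => ∫ x, ‖f n x - g x‖ ∂μ) atTop (𝓝 0)) :
    ∃ ns : ℕ → ℕ, StrictMono ns ∧ ∀ᵐ x ∂μ, Tendsto (fun n => f (ns n) x) atTop (𝓝 (g x)) := by
  refine (tendstoInMeasure_of_tendsto_eLpNorm one_ne_zero (fun n => (hf n).aestronglyMeasurable)
    hg.aestronglyMeasurable ?_).exists_seq_tendsto_ae
  have h1 : ∀ n, eLpNorm (f n - g) 1 μ = ENNReal.ofReal (∫ x, ‖f n x - g x‖ ∂μ) := fun n => by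
    rw [eLpNorm_one_eq_lintegral_enorm]
    exact (ofReal_integral_norm_eq_lintegral_enorm ((hf n).sub hg)).symm
  simp_rw [h1]
  simpa using ENNReal.tendsto_ofReal h

/-- Translations act continuously on `L¹`. -/
lemma tendsto_integral_norm_translate_sub {F : Type*} [NormedAddCommGroup F] [NormedSpace ℝ F]
    {f : Plane → F} (hf : Integrable f) :
    Tendsto (fun h : Plane => ∫ x, ‖f (x + h) - f x‖) (𝓝 0) (𝓝 0) := by
  have hcs : ∀ g : Plane → F, Continuous g → HasCompactSupport g →
      Tendsto (fun h : Plane => ∫ x, ‖g (x + h) - g x‖) (𝓝 0) (𝓝 0) := by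
    intro g hg hgc
    obtain ⟨C, hC⟩ := hg.bounded_above_of_compact_support hgc
    have hK : IsCompact (cthickening 1 (tsupport g)) := IsCompact.cthickening hgc
    have h0 : (0 : ℝ) = ∫ x : Plane, ‖g (x + 0) - g x‖ := by simp
    conv_rhs => rw [h0]
    refine tendsto_integral_filter_of_dominated_convergence
      ((cthickening 1 (tsupport g)).indicator fun _ => 2 * C) ?_ ?_ ?_ ?_
    · exact Eventually.of_forall fun h => Continuous.aestronglyMeasurable (by fun_prop)
    · filter_upwards [closedBall_mem_nhds (0 : Plane) one_pos] with h hh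
      refine ae_of_all _ fun x => ?_
      rw [mem_closedBall_zero_iff] at hh
      rw [norm_norm]
      by_cases hx : x ∈ cthickening 1 (tsupport g)
      · rw [indicator_of_mem hx]
        exact (norm_sub_le _ _).trans (by linarith [hC (x + h), hC x])
      · have h1 : g x = 0 := image_eq_zero_of_notMem_tsupport fun h =>
          hx (self_subset_cthickening _ h)
        have h2 : g (x + h) = 0 := image_eq_zero_of_notMem_tsupport fun h' =>
          hx (mem_cthickening_of_dist_le x (x + h) 1 _ h' (by simpa using hh))
        rw [h1, h2, indicator_of_notMem hx]; simp
    · exact (integrable_indicator_iff hK.measurableSet).2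
        (integrableOn_const hK.measure_lt_top.ne)
    · refine ae_of_all _ fun x => ?_
      exact Continuous.tendsto (f := fun h => ‖g (x + h) - g x‖) (by fun_prop) 0
  rw [Metric.tendsto_nhds]
  intro ε hε
  obtain ⟨g, hgc, hfg, hg, hgi⟩ :=
    hf.exists_hasCompactSupport_integral_sub_le (show 0 < ε / 4 by positivity)
  have h1 := (Metric.tendsto_nhds.1 (hcs g hg hgc)) (ε / 4) (by positivity)
  filter_upwards [h1] with h hh
  rw [Real.dist_eq, sub_zero, abs_of_nonneg (integral_nonneg fun _ => norm_nonneg _)] at hh ⊢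
  have hfg' : Integrable fun x => ‖f x - g x‖ := (hf.sub hgi).norm
  have hfgt : Integrable fun x => ‖f (x + h) - g (x + h)‖ := hfg'.comp_add_right h
  have hgt : Integrable fun x => ‖g (x + h) - g x‖ := ((hgi.comp_add_right h).sub hgi).norm
  have h2 : ∫ x, ‖f (x + h) - g (x + h)‖ = ∫ x, ‖f x - g x‖ :=
    integral_add_right_eq_self (fun x => ‖f x - g x‖) h
  calc ∫ x, ‖f (x + h) - f x‖
      ≤ ∫ x, (‖f (x + h) - g (x + h)‖ + ‖g (x + h) - g x‖ + ‖f x - g x‖) := by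
        refine integral_mono ((hf.comp_add_right h).sub hf).norm ((hfgt.add hgt).add hfg')
          fun x => ?_
        have : f (x + h) - f x = (f (x + h) - g (x + h)) + (g (x + h) - g x) - (f x - g x) := by
          abel
        simp only [this]
        exact (norm_sub_le _ _).trans (add_le_add_left (norm_add_le _ _) _)
    _ = (∫ x, ‖f x - g x‖) + (∫ x, ‖g (x + h) - g x‖) + ∫ x, ‖f x - g x‖ := by
        rw [integral_add (f := fun x => ‖f (x + h) - g (x + h)‖ + ‖g (x + h) - g x‖)
          (hfgt.add hgt) hfg', integral_add hfgt hgt, h2]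
    _ < ε := by linarith

/-- The averages of an integrable function over short segments converge to the function in `L¹`. -/
lemma tendsto_integral_norm_line_average_sub {f : Plane → ℝ} (hf : Integrable f)
    (hfm : StronglyMeasurable f) (h : Plane) {t : ℕ → ℝ} (ht : Tendsto t atTop (𝓝 0)) :
    Tendsto (fun n => ∫ x, ‖(∫ s in (0 : ℝ)..1, f (x + s • t n • h)) - f x‖) atTop (𝓝 0) := by
  have h1 : Tendsto (fun n => t n • h) atTop (𝓝 0) := by simpa using ht.smul_const h
  rw [Metric.tendsto_nhds]
  intro ε hε
  obtain ⟨δ, hδ, hδf⟩ := Metric.tendsto_nhds_nhds.1 (tendsto_integral_norm_translate_sub hf)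
    (ε / 2) (half_pos hε)
  filter_upwards [(Metric.tendsto_nhds.1 h1) δ hδ] with n hn
  rw [dist_zero_right] at hn
  rw [Real.dist_eq, sub_zero, abs_of_nonneg (integral_nonneg fun _ => norm_nonneg _)]
  set ν : Measure ℝ := volume.restrict (Ioc 0 1)
  set k := t n • h
  have hsh : Integrable (fun z : ℝ × Plane => f (z.2 + z.1 • k) - f z.2) (ν.prod volume) :=
    (integrable_comp_shear hf hfm ν k).sub (hf.comp_snd ν)
  refine lt_of_le_of_lt ?_ (half_lt_self hε)
  calc ∫ x, ‖(∫ s in (0 : ℝ)..1, f (x + s • k)) - f x‖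
      ≤ ∫ x, (∫ s, ‖f (x + s • k) - f x‖ ∂ν) := by
        refine integral_mono_of_nonneg (ae_of_all _ fun _ => norm_nonneg _)
          hsh.norm.integral_prod_right ?_
        filter_upwards [(integrable_comp_shear hf hfm ν k).prod_left_ae] with x hx
        have h2 : (∫ s in (0 : ℝ)..1, f (x + s • k)) - f x =
            ∫ s, (f (x + s • k) - f x) ∂ν := by
          rw [integral_sub hx (integrable_const _), intervalIntegral.integral_of_le zero_le_one]
          simp [ν]
        rw [h2]
        exact norm_integral_le_integral_norm _
    _ = ∫ s, (∫ x, ‖f (x + s • k) - f x‖) ∂ν := (integral_integral_swap hsh.norm).symm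
    _ ≤ ∫ s, (ε / 2) ∂ν := by
        refine integral_mono_of_nonneg (ae_of_all _ fun s => integral_nonneg fun _ => norm_nonneg _)
          (integrable_const _) ?_
        filter_upwards [ae_restrict_mem measurableSet_Ioc] with s hs
        have h3 : dist (s • k) 0 < δ := by
          rw [dist_zero_right, norm_smul, Real.norm_of_nonneg hs.1.le]
          nlinarith [hs.2, norm_nonneg k]
        have h4 := hδf h3
        rw [Real.dist_eq, sub_zero] at h4
        exact (le_abs_self _).trans h4.le
    _ = ε / 2 := by simp [ν]

/-- A strongly measurable representative, extended by zero to the whole plane. -/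
lemma exists_stronglyMeasurable_extension {F : Type*} [NormedAddCommGroup F] {U : Set Plane}
    (hU : MeasurableSet U) {f : Plane → F} (hf : IntegrableOn f U) :
    ∃ g : Plane → F, StronglyMeasurable g ∧ Integrable g ∧ f =ᵐ[volume.restrict U] g ∧
      ∀ x, x ∉ U → g x = 0 := by
  have h1 := hf.aestronglyMeasurable
  have h2 : f =ᵐ[volume.restrict U] U.indicator (h1.mk f) := by
    filter_upwards [h1.ae_eq_mk, ae_restrict_mem hU] with x hx hxU
    rw [indicator_of_mem hxU, hx]
  refine ⟨U.indicator (h1.mk f), h1.stronglyMeasurable_mk.indicator hU, ?_, h2,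
    fun x hx => indicator_of_notMem hx _⟩
  exact (integrable_indicator_iff hU).2 (hf.congr h1.ae_eq_mk)

variable {U : Set Plane} {u : Plane → ℝ} {G : Plane → Plane}

/-- The chain rule `∇ (F ∘ u) = F' (u) ∇ u`, for a differentiable Lipschitz function `F`; it is the
limit of the corresponding identity between difference quotients. -/
theorem HasWeakGrad.comp (h : HasWeakGrad U u G) (hU : IsOpen U) (hu : IntegrableOn u U)
    (hG : IntegrableOn G U) {F F' : ℝ → ℝ} (hF : ∀ t, HasDerivAt F (F' t) t) {L : ℝ}
    (hL : ∀ t, |F' t| ≤ L) (hF'm : Measurable F') :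
    HasWeakGrad U (fun x => F (u x)) (fun x => F' (u x) • G x) := by
  obtain ⟨u', hum, hui, huu, -⟩ := exists_stronglyMeasurable_extension hU.measurableSet hu
  obtain ⟨G', hGm, hGi, hGG, -⟩ := exists_stronglyMeasurable_extension hU.measurableSet hG
  suffices hs : HasWeakGrad U (fun x => F (u' x)) (fun x => F' (u' x) • G' x) by
    refine hs.congr_ae (huu.mono fun x hx => by simp only [hx]) ?_
    filter_upwards [huu, hGG] with x hx hx'
    rw [hx, hx']
  have h' : HasWeakGrad U u' G' := h.congr_ae huu hGG
  have hFd : Differentiable ℝ F := fun t => (hF t).differentiableAt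
  have hL0 : 0 ≤ L := (abs_nonneg _).trans (hL 0)
  have hFlip : ∀ a b, |F b - F a| ≤ L * |b - a| := fun a b => by
    have := (convex_univ (𝕜 := ℝ) (E := ℝ)).norm_image_sub_le_of_norm_hasDerivWithin_le
      (fun t _ => (hF t).hasDerivWithinAt) (fun t _ => hL t) (mem_univ a) (mem_univ b)
    simpa using this
  intro φ hφ hφc hφU i
  set e : Plane := EuclideanSpace.single i 1 with he
  have hen : ‖e‖ = 1 := by simp [he]
  set K := tsupport φ
  have hK : IsCompact K := hφc
  obtain ⟨δ, hδ, hδU⟩ := hK.exists_thickening_subset_open hU hφU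
  set t₀ : ℕ → ℝ := fun n => δ / 2 * (1 / ((n : ℝ) + 1))
  have ht₀ : Tendsto t₀ atTop (𝓝 0) := by
    simpa [t₀] using tendsto_one_div_add_atTop_nhds_zero_nat.const_mul (δ / 2)
  obtain ⟨ns, hns, hae⟩ := exists_subseq_ae_tendsto (f := fun n x => u' (x + t₀ n • e)) (g := u')
    (fun n => hui.comp_add_right _) hui
    ((tendsto_integral_norm_translate_sub hui).comp (by simpa using ht₀.smul_const e))
  set t : ℕ → ℝ := fun n => t₀ (ns n)
  have ht : Tendsto t atTop (𝓝 0) := ht₀.comp hns.tendsto_atTop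
  have htpos : ∀ n, 0 < t n := fun n => by simp only [t, t₀]; positivity
  have htδ : ∀ n, t n ≤ δ / 2 := fun n => by
    simp only [t, t₀]
    refine mul_le_of_le_one_right (by positivity) ?_
    rw [div_le_one (by positivity)]
    linarith [(ns n).cast_nonneg (α := ℝ)]
  set f : Plane → ℝ := fun x => F (u' x)
  have hFc : Continuous F := hFd.continuous
  have hfm : StronglyMeasurable f := hFc.comp_stronglyMeasurable hum
  have hfloc : LocallyIntegrable f := by
    refine ((locallyIntegrable_const |F 0|).add (hui.norm.const_mul L).locallyIntegrable).mono
      hfm.aestronglyMeasurable (ae_of_all _ fun x => ?_)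
    have h1 := hFlip 0 (u' x)
    rw [sub_zero] at h1
    have h2 : ‖f x‖ ≤ |F 0| + L * |u' x| := by
      rw [Real.norm_eq_abs]
      have := abs_sub_abs_le_abs_sub (F (u' x)) (F 0)
      simp only [f]; linarith
    exact h2.trans (le_abs_self _)
  -- the left-hand side as a limit of difference quotients of the test function
  obtain ⟨C, hClip⟩ := hφ.lipschitzWith_of_hasCompactSupport hφc (by simp)
  have hKc : IsCompact (cthickening δ K) := hK.cthickening
  have hlim1 : Tendsto (fun n => ∫ x, f x * ((t n)⁻¹ * (φ (x - t n • e) - φ x))) atTop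
      (𝓝 (∫ x, f x * -fderiv ℝ φ x e)) := by
    refine tendsto_integral_of_dominated_convergence
      ((cthickening δ K).indicator fun x => ‖f x‖ * C) ?_ ?_ ?_ ?_
    · have := hφ.continuous
      exact fun n => hfm.aestronglyMeasurable.mul (Continuous.aestronglyMeasurable (by fun_prop))
    · exact (integrable_indicator_iff hKc.measurableSet).2
        ((hfloc.integrableOn_isCompact hKc).norm.mul_const _)
    · refine fun n => ae_of_all _ fun x => ?_
      by_cases hx : x ∈ cthickening δ K
      · rw [indicator_of_mem hx, norm_mul, norm_mul]
        gcongr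
        rw [norm_inv, Real.norm_of_nonneg (htpos n).le, inv_mul_le_iff₀ (htpos n)]
        have h1 := hClip.dist_le_mul (x - t n • e) x
        rw [Real.dist_eq] at h1
        have h2 : dist (x - t n • e) x = t n := by
          rw [dist_eq_norm]; simp [norm_smul, hen, abs_of_pos (htpos n)]
        rw [h2] at h1
        rw [Real.norm_eq_abs]; linarith
      · have h1 : φ x = 0 := image_eq_zero_of_notMem_tsupport fun h =>
          hx (self_subset_cthickening _ h)
        have h2 : φ (x - t n • e) = 0 := image_eq_zero_of_notMem_tsupport fun h' =>
          hx (mem_cthickening_of_dist_le x (x - t n • e) δ _ h' (by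
            rw [dist_eq_norm]
            simp only [sub_sub_cancel, norm_smul, hen, mul_one, Real.norm_eq_abs]
            rw [abs_of_pos (htpos n)]; linarith [htδ n]))
        rw [h1, h2, indicator_of_notMem hx]; simp
    · refine ae_of_all _ fun x => Tendsto.const_mul _ ?_
      have h1 : HasDerivAt (fun s : ℝ => φ (x - s • e)) (-fderiv ℝ φ x e) 0 := by
        have h2 : HasDerivAt (fun s : ℝ => x - s • e) (-e) 0 := by
          simpa using ((hasDerivAt_id (0 : ℝ)).smul_const e).const_sub x
        have h3 := (hφ.differentiable (by simp) x).hasFDerivAt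
        rw [show x = x - (0 : ℝ) • e by simp] at h3
        have h4 := h3.comp_hasDerivAt (0 : ℝ) h2
        simp only [zero_smul, sub_zero, map_neg] at h4
        exact h4
      have h2 := h1.tendsto_slope_zero.comp
        (tendsto_nhdsWithin_iff.2 ⟨ht, Eventually.of_forall fun n => (htpos n).ne'⟩)
      simpa [Function.comp_def] using h2
  -- the difference quotient of `F ∘ u` is the product of the slope `m` of `F` and of the average `q` of
  -- the derivative of `u` along a segment
  set q : ℕ → Plane → ℝ := fun n x => ∫ s in (0 : ℝ)..1, G' (x + s • t n • e) i
  have hGii : Integrable fun x => G' x i := integrable_coord hGi i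
  have hGim : StronglyMeasurable fun x => G' x i :=
    (show Continuous fun x : Plane => x i by fun_prop).comp_stronglyMeasurable hGm
  have hq := tendsto_integral_norm_line_average_sub hGii hGim e ht
  have hqi : ∀ n, Integrable (q n) := fun n => by
    have := (integrable_comp_shear hGii hGim (volume.restrict (Ioc 0 1))
      (t n • e)).integral_prod_right
    simpa only [q, intervalIntegral.integral_of_le zero_le_one] using this
  set m : ℕ → Plane → ℝ := fun n x => dslope F (u' x) (u' (x + t n • e))
  have hmL : ∀ n x, ‖m n x‖ ≤ L := fun n x => by
    simp only [m]
    by_cases hb : u' (x + t n • e) = u' x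
    · rw [hb, dslope_same, (hF _).deriv]; exact hL _
    · rw [dslope_of_ne _ hb, slope_def_field, Real.norm_eq_abs, abs_div,
        div_le_iff₀ (abs_pos.2 (sub_ne_zero.2 hb))]
      exact hFlip _ _
  have hmm : ∀ n, AEStronglyMeasurable (m n) := fun n => by
    have hu2 : Measurable fun x => u' (x + t n • e) :=
      hum.measurable.comp (measurable_add_const _)
    have hd : Measurable fun x => if u' (x + t n • e) = u' x then F' (u' x) else
        (F (u' (x + t n • e)) - F (u' x)) / (u' (x + t n • e) - u' x) := by
      refine Measurable.ite (measurableSet_eq_fun hu2 hum.measurable)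
        (hF'm.comp hum.measurable) ?_
      exact ((hFc.measurable.comp hu2).sub (hFc.measurable.comp hum.measurable)).div
        (hu2.sub hum.measurable)
    convert hd.aestronglyMeasurable using 2 with x
    simp only [m]
    split_ifs with hb
    · rw [hb, dslope_same, (hF _).deriv]
    · rw [dslope_of_ne _ hb, slope_def_field]
  have hmlim : ∀ᵐ x, Tendsto (fun n => m n x) atTop (𝓝 (F' (u' x))) := by
    filter_upwards [hae] with x hx
    have h1 : ContinuousAt (dslope F (u' x)) (u' x) := continuousAt_dslope_same.2 (hFd _)
    have h2 := h1.tendsto.comp hx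
    rwa [dslope_same, (hF _).deriv] at h2
  obtain ⟨B, hB⟩ := hφ.continuous.bounded_above_of_compact_support hφc
  have hGφ : Integrable fun x => G' x i * φ x :=
    integrable_mul_of_hasCompactSupport hGii hφ.continuous hφc
  have hlim2 : Tendsto (fun n => ∫ x, m n x * q n x * φ x) atTop
      (𝓝 (∫ x, F' (u' x) * (G' x i * φ x))) := by
    have hA : Tendsto (fun n => ∫ x, m n x * (G' x i * φ x)) atTop
        (𝓝 (∫ x, F' (u' x) * (G' x i * φ x))) := by
      refine tendsto_integral_of_dominated_convergence (fun x => L * ‖G' x i * φ x‖)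
        (fun n => (hmm n).mul hGφ.aestronglyMeasurable) (hGφ.norm.const_mul _)
        (fun n => ae_of_all _ fun x => ?_) ?_
      · rw [norm_mul]; gcongr; exact hmL n x
      · filter_upwards [hmlim] with x hx
        exact hx.mul_const _
    have hB' : Tendsto (fun n => ∫ x, m n x * (q n x - G' x i) * φ x) atTop (𝓝 0) := by
      refine squeeze_zero_norm (fun n => ?_) (by simpa using hq.const_mul (L * B))
      rw [← integral_const_mul]
      refine norm_integral_le_of_norm_le (((hqi n).sub hGii).norm.const_mul (L * B))
        (ae_of_all _ fun x => ?_)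
      rw [norm_mul, norm_mul]
      calc ‖m n x‖ * ‖q n x - G' x i‖ * ‖φ x‖ ≤ L * ‖q n x - G' x i‖ * B := by
            gcongr
            · exact hmL n x
            · exact hB x
        _ = L * B * ‖q n x - G' x i‖ := by ring
    have hsum := hA.add hB'
    rw [add_zero] at hsum
    refine hsum.congr fun n => ?_
    rw [← integral_add]
    · refine integral_congr_ae (ae_of_all _ fun x => ?_)
      simp only; ring
    · exact hGφ.bdd_mul (hmm n) (ae_of_all _ (hmL n))
    · exact (((hqi n).sub hGii).bdd_mul (hmm n) (ae_of_all _ (hmL n))).mul_bdd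
        hφ.continuous.aestronglyMeasurable (ae_of_all _ hB)
  have heq : ∀ n, ∫ x, f x * ((t n)⁻¹ * (φ (x - t n • e) - φ x)) =
      ∫ x, m n x * q n x * φ x := by
    intro n
    have hline := h'.ae_sub_eq_integral hui hGi hGm (isOpen_thickening (δ := δ / 2) (E := K))
      (h := t n • e) (fun x hx s hs => hδU (by
        obtain ⟨y, hy, hxy⟩ := mem_thickening_iff.1 hx
        refine mem_thickening_iff.2 ⟨y, hy, ?_⟩
        have h1 : dist (x + s • t n • e) x ≤ δ / 2 := by
          rw [dist_eq_norm]
          simp only [add_sub_cancel_left, norm_smul, hen, mul_one, Real.norm_eq_abs]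
          rw [abs_of_nonneg hs.1, abs_of_pos (htpos n)]
          nlinarith [htδ n, hs.2, htpos n]
        linarith [dist_triangle (x + s • t n • e) x y]))
    have h1 : Integrable fun x => f x * φ x := by
      simpa only [smul_eq_mul, mul_comm] using
        hfloc.integrable_smul_left_of_hasCompactSupport hφ.continuous hφc
    have hft : LocallyIntegrable fun x => f (x + t n • e) := by
      refine ((locallyIntegrable_const |F 0|).add
        ((hui.comp_add_right (t n • e)).norm.const_mul L).locallyIntegrable).mono
        (hfm.comp_measurable (measurable_add_const _)).aestronglyMeasurable
        (ae_of_all _ fun x => ?_)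
      have h1 := hFlip 0 (u' (x + t n • e))
      rw [sub_zero] at h1
      have h2 : ‖f (x + t n • e)‖ ≤ |F 0| + L * |u' (x + t n • e)| := by
        rw [Real.norm_eq_abs]
        have := abs_sub_abs_le_abs_sub (F (u' (x + t n • e))) (F 0)
        simp only [f]; linarith
      exact h2.trans (le_abs_self _)
    have h2 : Integrable fun x => f (x + t n • e) * φ x := by
      simpa only [smul_eq_mul, mul_comm] using
        hft.integrable_smul_left_of_hasCompactSupport hφ.continuous hφc
    have h3 : Integrable fun x => f x * φ (x - t n • e) := by
      simpa using h2.comp_sub_right (t n • e)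
    have h4 : ∫ x, f x * φ (x - t n • e) = ∫ x, f (x + t n • e) * φ x := by
      rw [← integral_add_right_eq_self (fun x => f x * φ (x - t n • e)) (t n • e)]; simp
    calc ∫ x, f x * ((t n)⁻¹ * (φ (x - t n • e) - φ x))
        = (t n)⁻¹ * ((∫ x, f x * φ (x - t n • e)) - ∫ x, f x * φ x) := by
          rw [← integral_sub h3 h1, ← integral_const_mul]
          refine integral_congr_ae (ae_of_all _ fun x => ?_)
          simp only; ring
      _ = ∫ x, (t n)⁻¹ * (f (x + t n • e) * φ x - f x * φ x) := by
          rw [h4, ← integral_sub h2 h1, ← integral_const_mul]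
      _ = ∫ x, m n x * q n x * φ x := by
          refine integral_congr_ae ?_
          filter_upwards [hline] with x hx
          by_cases hxK : x ∈ K
          · have h5 := hx (self_subset_thickening (by positivity) _ hxK)
            have h6 : (u' (x + t n • e) - u' x) = t n * q n x := by
              rw [h5]
              simp only [q, he, inner_smul_right, EuclideanSpace.inner_single_right]
              rw [intervalIntegral.integral_const_mul]
              simp
            have h7 : f (x + t n • e) - f x = (t n * q n x) * m n x := by
              rw [← h6]; exact (sub_smul_dslope F (u' x) (u' (x + t n • e))).symm
            rw [← sub_mul, h7]
            field_simp [(htpos n).ne']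
          · have h8 : φ x = 0 := image_eq_zero_of_notMem_tsupport hxK
            rw [h8]; simp
  have hfin := tendsto_nhds_unique (hlim1.congr heq) hlim2
  have hsup : ∀ x, x ∉ U → φ x = 0 := fun x hx => image_eq_zero_of_notMem_tsupport fun h => hx (hφU h)
  have hsup' : ∀ x, x ∉ U → fderiv ℝ φ x e = 0 := fun x hx => by
    rw [image_eq_zero_of_notMem_tsupport (f := fderiv ℝ φ)
      fun h => hx (hφU (tsupport_fderiv_subset ℝ h))]; rfl
  rw [setIntegral_eq_integral_of_forall_compl_eq_zero fun x hx => by rw [hsup' x hx, mul_zero],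
    setIntegral_eq_integral_of_forall_compl_eq_zero fun x hx => by rw [hsup x hx, mul_zero]]
  simp only [mul_neg, integral_neg] at hfin
  simp only [PiLp.smul_apply, smul_eq_mul, mul_assoc]
  linarith

end ChainRule

/-! ### Truncation of functions with weak gradients -/

section Truncation

/-- A smooth approximation of `t ↦ max t 0` whose derivative converges to the indicator function
of `(0, ∞)` everywhere as `δ → 0`, including at `t = 0`. -/
noncomputable def smoothPos (δ t : ℝ) : ℝ := ((t - δ) + √((t - δ) ^ 2 + δ ^ 4)) / 2

/-- The derivative of `smoothPos δ`. -/
noncomputable def smoothPosDeriv (δ t : ℝ) : ℝ := (1 + (t - δ) / √((t - δ) ^ 2 + δ ^ 4)) / 2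

lemma hasDerivAt_smoothPos {δ : ℝ} (hδ : 0 < δ) (t : ℝ) :
    HasDerivAt (smoothPos δ) (smoothPosDeriv δ t) t := by
  have h0 : (t - δ) ^ 2 + δ ^ 4 ≠ 0 := by positivity
  have h1 : HasDerivAt (fun t : ℝ => t - δ) 1 t := (hasDerivAt_id t).sub_const δ
  have h2 : HasDerivAt (fun t : ℝ => (t - δ) ^ 2 + δ ^ 4) (2 * (t - δ)) t := by
    simpa using (h1.pow 2).add_const (δ ^ 4)
  refine ((h1.add (h2.sqrt h0)).div_const 2).congr_deriv ?_
  rw [smoothPosDeriv]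
  congr 2
  rw [mul_div_mul_left _ _ two_ne_zero]

lemma abs_smoothPosDeriv_le (δ t : ℝ) : |smoothPosDeriv δ t| ≤ 1 := by
  have h1 : |(t - δ) / √((t - δ) ^ 2 + δ ^ 4)| ≤ 1 := by
    rw [abs_div, abs_of_nonneg (Real.sqrt_nonneg _)]
    refine div_le_one_of_le₀ (Real.abs_le_sqrt ?_) (Real.sqrt_nonneg _)
    have : 0 ≤ δ ^ 4 := by positivity
    linarith
  rw [abs_le] at h1 ⊢
  rw [smoothPosDeriv]
  constructor <;> linarith

lemma abs_smoothPos_sub_le {δ : ℝ} (hδ : 0 < δ) (hδ1 : δ ≤ 1) (t : ℝ) :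
    |smoothPos δ t - max t 0| ≤ δ := by
  have h1 : max t 0 = (t + |t|) / 2 := by
    rcases le_total 0 t with h | h
    · rw [max_eq_left h, abs_of_nonneg h]; ring
    · rw [max_eq_right h, abs_of_nonpos h]; ring
  have h2 : |t - δ| ≤ √((t - δ) ^ 2 + δ ^ 4) := by
    refine Real.abs_le_sqrt ?_
    have : 0 ≤ δ ^ 4 := by positivity
    linarith
  have h3 : √((t - δ) ^ 2 + δ ^ 4) ≤ |t - δ| + δ ^ 2 := by
    refine Real.sqrt_le_iff.2 ⟨by positivity, ?_⟩
    have : 0 ≤ 2 * |t - δ| * δ ^ 2 := by positivity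
    nlinarith [sq_abs (t - δ)]
  have h4 : |t - δ| ≤ |t| + δ := (abs_sub _ _).trans_eq (by rw [abs_of_pos hδ])
  have h5 : |t| ≤ |t - δ| + δ := by
    have := abs_add_le (t - δ) δ
    rwa [sub_add_cancel, abs_of_pos hδ] at this
  have h6 : δ ^ 2 ≤ δ := by nlinarith
  rw [h1, smoothPos, abs_le]
  constructor <;> linarith

lemma tendsto_smoothPosDeriv (t : ℝ) :
    Tendsto (fun δ => smoothPosDeriv δ t) (𝓝[>] 0) (𝓝 (if 0 < t then 1 else 0)) := by
  rcases eq_or_ne t 0 with rfl | ht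
  · have h1 : Tendsto (fun δ : ℝ => (1 - 1 / √(1 + δ ^ 2)) / 2) (𝓝[>] 0) (𝓝 0) := by
      have h2 : ContinuousAt (fun δ : ℝ => (1 - 1 / √(1 + δ ^ 2)) / 2) 0 := by
        have : √(1 + (0 : ℝ) ^ 2) ≠ 0 := by simp
        fun_prop (disch := assumption)
      simpa [ContinuousAt] using h2.mono_left nhdsWithin_le_nhds
    simp only [lt_irrefl, if_false]
    refine h1.congr' ?_
    filter_upwards [self_mem_nhdsWithin] with δ (hδ : 0 < δ)
    have h3 : √((0 - δ) ^ 2 + δ ^ 4) = δ * √(1 + δ ^ 2) := by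
      rw [show (0 - δ) ^ 2 + δ ^ 4 = δ ^ 2 * (1 + δ ^ 2) by ring, Real.sqrt_mul (sq_nonneg _),
        Real.sqrt_sq hδ.le]
    have h4 : √(1 + δ ^ 2) ≠ 0 := by positivity
    rw [smoothPosDeriv, h3]
    field_simp
    ring
  · have h2 : ContinuousAt (fun δ : ℝ => smoothPosDeriv δ t) 0 := by
      have : √((t - 0) ^ 2 + (0 : ℝ) ^ 4) ≠ 0 := by
        rw [Real.sqrt_ne_zero']; have := sq_pos_of_ne_zero ht; simpa using this
      unfold smoothPosDeriv
      fun_prop (disch := assumption)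
    have h3 : smoothPosDeriv 0 t = if 0 < t then 1 else 0 := by
      rw [smoothPosDeriv]
      simp only [sub_zero, ne_eq, OfNat.ofNat_ne_zero, not_false_eq_true, zero_pow, add_zero,
        Real.sqrt_sq_eq_abs]
      rcases lt_or_gt_of_ne ht with h | h
      · rw [abs_of_neg h, if_neg h.not_gt, div_neg, div_self ht]; ring
      · rw [abs_of_pos h, if_pos h, div_self ht]; ring
    rw [← h3]
    exact h2.tendsto.mono_left nhdsWithin_le_nhds

variable {U : Set Plane} {u : Plane → ℝ} {G : Plane → Plane}

/-- Truncation from below: `∇ (u - k)⁺ = 1_{u > k} ∇ u`. -/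
theorem HasWeakGrad.posPart (h : HasWeakGrad U u G) (hU : IsOpen U) (hUf : volume U ≠ ⊤)
    (hu : IntegrableOn u U) (hG : IntegrableOn G U) (k : ℝ) :
    HasWeakGrad U (fun x => max (u x - k) 0) ({x | k < u x}.indicator G) := by
  have hfin : IsFiniteMeasure (volume.restrict U) := ⟨by simpa using hUf.lt_top⟩
  set δ : ℕ → ℝ := fun n => 1 / ((n : ℝ) + 1)
  have hδ : ∀ n, 0 < δ n := fun n => by simp only [δ]; positivity
  have hδ1 : ∀ n, δ n ≤ 1 := fun n => by
    simp only [δ]; rw [div_le_one (by positivity)]; linarith [n.cast_nonneg (α := ℝ)]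
  have hδ0 : Tendsto δ atTop (𝓝 0) := tendsto_one_div_add_atTop_nhds_zero_nat
  have hδw : Tendsto δ atTop (𝓝[>] 0) :=
    tendsto_nhdsWithin_iff.2 ⟨hδ0, Eventually.of_forall hδ⟩
  have hder : ∀ n t, HasDerivAt (fun t => smoothPos (δ n) (t - k)) (smoothPosDeriv (δ n) (t - k)) t :=
    fun n t => by simpa using (hasDerivAt_smoothPos (hδ n) (t - k)).comp_sub_const t k
  have hdm : ∀ n, Measurable fun t => smoothPosDeriv (δ n) (t - k) := fun n => by
    unfold smoothPosDeriv; fun_prop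
  have hui : IntegrableOn (fun x => max (u x - k) 0) U := (hu.sub (integrable_const k)).pos_part
  have hsm : ∀ n, Continuous fun t => smoothPos (δ n) (t - k) := fun n =>
    continuous_iff_continuousAt.2 fun t => (hder n t).continuousAt
  have hdiff : ∀ n, IntegrableOn (fun x => smoothPos (δ n) (u x - k) - max (u x - k) 0) U :=
    fun n => Integrable.mono' (integrable_const (δ n))
      (((hsm n).comp_aestronglyMeasurable hu.aestronglyMeasurable).sub hui.aestronglyMeasurable)
      (ae_of_all _ fun x => abs_smoothPos_sub_le (hδ n) (hδ1 n) _)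
  have hun : ∀ n, IntegrableOn (fun x => smoothPos (δ n) (u x - k)) U := fun n => by
    exact ((hdiff n).add hui).congr (ae_of_all _ fun x => by simp)
  have hdum : ∀ n, AEStronglyMeasurable (fun x => smoothPosDeriv (δ n) (u x - k))
      (volume.restrict U) := fun n =>
    ((hdm n).comp_aemeasurable hu.aestronglyMeasurable.aemeasurable).aestronglyMeasurable
  have hGn : ∀ n, IntegrableOn (fun x => smoothPosDeriv (δ n) (u x - k) • G x) U := fun n => by
    refine Integrable.mono hG ((hdum n).smul hG.aestronglyMeasurable) (ae_of_all _ fun x => ?_)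
    rw [norm_smul]
    exact mul_le_of_le_one_left (norm_nonneg _) (abs_smoothPosDeriv_le _ _)
  have hlim : ∀ x, Tendsto (fun n => smoothPosDeriv (δ n) (u x - k) • G x) atTop
      (𝓝 ({x | k < u x}.indicator G x)) := fun x => by
    have h1 := ((tendsto_smoothPosDeriv (u x - k)).comp hδw).smul_const (G x)
    have h2 : {x | k < u x}.indicator G x = (if 0 < u x - k then (1 : ℝ) else 0) • G x := by
      by_cases hx : k < u x <;> simp [indicator, hx]
    rw [h2]; exact h1
  have hGi : IntegrableOn ({x | k < u x}.indicator G) U := by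
    refine Integrable.mono hG (aestronglyMeasurable_of_tendsto_ae atTop
      (fun n => (hGn n).aestronglyMeasurable) (ae_of_all _ hlim)) (ae_of_all _ fun x => ?_)
    exact norm_indicator_le_norm_self _ _
  refine HasWeakGrad.of_tendsto
    (fun n => h.comp hU hu hG (hder n) (fun t => abs_smoothPosDeriv_le _ _) (hdm n))
    hun hGn hui hGi ?_ ?_
  · refine squeeze_zero (fun n => integral_nonneg fun _ => norm_nonneg _) (fun n => ?_)
      (by simpa using hδ0.const_mul (volume.real U))
    refine (integral_mono (hdiff n).norm (integrable_const (δ n)) fun x =>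
      abs_smoothPos_sub_le (hδ n) (hδ1 n) _).trans_eq ?_
    simp
  · have h0 : (0 : ℝ) = ∫ x in U, (0 : ℝ) := by simp
    conv_rhs => rw [h0]
    refine tendsto_integral_of_dominated_convergence (fun x => 2 * ‖G x‖)
      (fun n => ((hGn n).sub hGi).norm.aestronglyMeasurable) (hG.norm.const_mul 2)
      (fun n => ae_of_all _ fun x => ?_) (ae_of_all _ fun x => ?_)
    · rw [norm_norm]
      refine (norm_sub_le _ _).trans ?_
      have h1 : ‖smoothPosDeriv (δ n) (u x - k) • G x‖ ≤ ‖G x‖ := by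
        rw [norm_smul]
        exact mul_le_of_le_one_left (norm_nonneg _) (abs_smoothPosDeriv_le _ _)
      have h2 := norm_indicator_le_norm_self (s := {x | k < u x}) G x
      linarith
    · simpa using ((hlim x).sub_const ({x | k < u x}.indicator G x)).norm

end Truncation

/-! ### The spaces `W^{1,p}` -/

section SobolevSpace

variable {Ω : Set Plane} {p : ℝ≥0∞} {u w : Plane → ℝ} {G H : Plane → Plane}

lemma IsW1.hasWeakGrad (h : IsW1 Ω p u G) : HasWeakGrad Ω u G := h.integral_eq

lemma IsBoundedLipschitzDomain.volume_ne_top (hΩ : IsBoundedLipschitzDomain Ω) :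
    volume Ω ≠ ⊤ := hΩ.isBounded.measure_lt_top.ne

lemma IsW1.integrableOn (h : IsW1 Ω p u G) (hΩ : volume Ω ≠ ⊤) (hp : 1 ≤ p) :
    IntegrableOn u Ω :=
  have : IsFiniteMeasure (volume.restrict Ω) := ⟨by simpa using hΩ.lt_top⟩
  h.memLp.integrable hp

lemma IsW1.integrableOn_grad (h : IsW1 Ω p u G) (hΩ : volume Ω ≠ ⊤) (hp : 1 ≤ p) :
    IntegrableOn G Ω :=
  have : IsFiniteMeasure (volume.restrict Ω) := ⟨by simpa using hΩ.lt_top⟩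
  h.memLp_grad.integrable hp

lemma IsW1.mono {q : ℝ≥0∞} (h : IsW1 Ω p u G) (hΩ : volume Ω ≠ ⊤) (hqp : q ≤ p) : IsW1 Ω q u G :=
  have : IsFiniteMeasure (volume.restrict Ω) := ⟨by simpa using hΩ.lt_top⟩
  ⟨h.memLp.mono_exponent hqp, h.memLp_grad.mono_exponent hqp, h.integral_eq⟩

lemma IsW1.add (h : IsW1 Ω p u G) (h' : IsW1 Ω p w H) (hΩ : volume Ω ≠ ⊤) (hp : 1 ≤ p) :
    IsW1 Ω p (fun x => u x + w x) (fun x => G x + H x) :=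
  ⟨h.memLp.add h'.memLp, h.memLp_grad.add h'.memLp_grad,
    h.hasWeakGrad.add h'.hasWeakGrad (h.integrableOn hΩ hp) (h.integrableOn_grad hΩ hp)
      (h'.integrableOn hΩ hp) (h'.integrableOn_grad hΩ hp)⟩

lemma IsW1.const_mul (h : IsW1 Ω p u G) (c : ℝ) :
    IsW1 Ω p (fun x => c * u x) (fun x => c • G x) :=
  ⟨h.memLp.const_mul c, h.memLp_grad.const_smul c, h.hasWeakGrad.const_mul c⟩

lemma IsW1.neg (h : IsW1 Ω p u G) : IsW1 Ω p (fun x => -u x) (fun x => -G x) := by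
  simpa using h.const_mul (-1)

lemma IsW1.sub (h : IsW1 Ω p u G) (h' : IsW1 Ω p w H) (hΩ : volume Ω ≠ ⊤) (hp : 1 ≤ p) :
    IsW1 Ω p (fun x => u x - w x) (fun x => G x - H x) := by
  simpa only [sub_eq_add_neg] using h.add h'.neg hΩ hp

lemma IsW1.congr_ae (h : IsW1 Ω p u G) (hu : u =ᵐ[volume.restrict Ω] w)
    (hG : G =ᵐ[volume.restrict Ω] H) : IsW1 Ω p w H :=
  ⟨h.memLp.ae_eq hu, h.memLp_grad.ae_eq hG, h.hasWeakGrad.congr_ae hu hG⟩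

lemma nullMeasurableSet_lt_const {μ : Measure Plane} (hu : AEStronglyMeasurable u μ) (k : ℝ) :
    NullMeasurableSet {x | k < u x} μ :=
  hu.aemeasurable.nullMeasurable measurableSet_Ioi

lemma IsW1.posPart (h : IsW1 Ω p u G) (hΩo : IsOpen Ω) (hΩ : volume Ω ≠ ⊤) (hp : 1 ≤ p) (k : ℝ) :
    IsW1 Ω p (fun x => max (u x - k) 0) ({x | k < u x}.indicator G) := by
  have : IsFiniteMeasure (volume.restrict Ω) := ⟨by simpa using hΩ.lt_top⟩
  refine ⟨(h.memLp.sub (memLp_const k)).pos_part, ?_, h.hasWeakGrad.posPart hΩo hΩ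
    (h.integrableOn hΩ hp) (h.integrableOn_grad hΩ hp) k⟩
  refine h.memLp_grad.mono ?_ (ae_of_all _ fun x => norm_indicator_le_norm_self _ _)
  exact h.memLp_grad.aestronglyMeasurable.indicator₀ (nullMeasurableSet_lt_const h.memLp.1 k)

/-- Truncation to the interval `[-M, M]`. -/
noncomputable def clip (M t : ℝ) : ℝ := max (min t M) (-M)

lemma continuous_clip (M : ℝ) : Continuous (clip M) := by unfold clip; fun_prop

lemma abs_clip_le {M : ℝ} (hM : 0 ≤ M) (t : ℝ) : |clip M t| ≤ M := by
  unfold clip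
  rw [abs_le]
  exact ⟨le_max_right _ _, max_le (min_le_right _ _) (by linarith)⟩

lemma clip_eq_self {M t : ℝ} (h : |t| ≤ M) : clip M t = t := by
  rw [abs_le] at h
  rw [clip, min_eq_left h.2, max_eq_left h.1]

lemma abs_clip_sub_clip_le (M s t : ℝ) : |clip M s - clip M t| ≤ |s - t| := by
  unfold clip
  exact (abs_max_sub_max_le_abs _ _ _).trans (abs_min_sub_min_le_max _ _ _ _ |>.trans (by simp))

lemma clip_mul_self_nonneg {M : ℝ} (hM : 0 ≤ M) (t : ℝ) : clip M t ^ 2 ≤ t * clip M t := by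
  unfold clip
  rcases le_total t M with h | h
  · rw [min_eq_left h]
    rcases le_total t (-M) with h' | h'
    · rw [max_eq_right h']; nlinarith
    · rw [max_eq_left h']; nlinarith
  · rw [min_eq_right h, max_eq_left (by linarith)]; nlinarith

lemma IsW1.clip (h : IsW1 Ω p u G) (hΩo : IsOpen Ω) (hΩ : volume Ω ≠ ⊤) (hp : 1 ≤ p) {M : ℝ}
    (hM : 0 ≤ M) :
    IsW1 Ω p (fun x => clip M (u x)) ({x | |u x| ≤ M}.indicator G) := by
  have h1 := h.posPart hΩo hΩ hp M
  have h2 := h.neg.posPart hΩo hΩ hp M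
  have h3 := (h.sub h1 hΩ hp).add h2 hΩ hp
  refine h3.congr_ae (ae_of_all _ fun x => ?_) (ae_of_all _ fun x => ?_)
  · simp only [CrystalSurface.clip]
    rcases le_total (u x) M with h | h
    · rw [min_eq_left h, max_eq_right (by linarith : u x - M ≤ 0)]
      rcases le_total (u x) (-M) with h' | h'
      · rw [max_eq_right h', max_eq_left (by linarith)]; ring
      · rw [max_eq_left h', max_eq_right (by linarith)]; ring
    · rw [min_eq_right h, max_eq_left (by linarith : -M ≤ M), max_eq_left (by linarith),
        max_eq_right (by linarith)]; ring
  · simp only [indicator, mem_ofPred_eq, abs_le]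
    by_cases h1 : M < u x
    · have h2 : ¬ M < -u x := by linarith
      have h3 : ¬ (-M ≤ u x ∧ u x ≤ M) := fun h => by linarith [h.2]
      simp [h1, h2, h3]
    · by_cases h2 : M < -u x
      · have h3 : ¬ (-M ≤ u x ∧ u x ≤ M) := fun h => by linarith [h.1]
        simp [h1, h2, h3]
      · have h3 : -M ≤ u x ∧ u x ≤ M := ⟨by linarith, by linarith⟩
        simp [h1, h2, h3]

end SobolevSpace

/-! ### The Sobolev inequality in Lipschitz domains of the plane -/

section SobolevInequality

/-- The two-dimensional Gagliardo inequality in oblique coordinates: a product of two functions, each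
constant along one of two independent directions, is integrated by Tonelli's theorem. -/
lemma exists_lintegral_line_mul_line_le {d₁ d₂ : Plane}
    (hd : ∀ s t : ℝ, s • d₁ + t • d₂ = 0 → s = 0 ∧ t = 0) :
    ∃ C : ℝ≥0, ∀ k : Plane → ℝ≥0∞, Measurable k →
      ∫⁻ x, (∫⁻ s : ℝ, k (x + s • d₁)) * (∫⁻ s : ℝ, k (x + s • d₂)) ≤ C * (∫⁻ x, k x) ^ 2 := by
  let A : ℝ × ℝ →ₗ[ℝ] Plane :=
    (LinearMap.fst ℝ ℝ ℝ).smulRight d₁ + (LinearMap.snd ℝ ℝ ℝ).smulRight d₂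
  have hA : Function.Injective A := by
    rw [injective_iff_map_eq_zero]
    rintro ⟨s, t⟩ h
    obtain ⟨h1, h2⟩ := hd s t h
    rw [h1, h2]; rfl
  let L : (ℝ × ℝ) ≃L[ℝ] Plane :=
    (LinearEquiv.ofInjectiveOfFinrankEq A hA (by simp)).toContinuousLinearEquiv
  have hL : ∀ z : ℝ × ℝ, L z = z.1 • d₁ + z.2 • d₂ := fun z => rfl
  set ν : Measure Plane := (volume : Measure (ℝ × ℝ)).map L
  have hν : ν.IsAddHaarMeasure := L.isAddHaarMeasure_map _
  set c : ℝ≥0 := Measure.addHaarScalarFactor (volume : Measure Plane) ν with hc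
  have hc0 : 0 < c := Measure.addHaarScalarFactor_pos_of_isAddHaarMeasure _ _
  have hvol : (volume : Measure Plane) = c • ν := Measure.isAddLeftInvariant_eq_smul _ _
  have hint : ∀ F : Plane → ℝ≥0∞, Measurable F →
      ∫⁻ x, F x = c * ∫⁻ t : ℝ, ∫⁻ s : ℝ, F (s • d₁ + t • d₂) := by
    intro F hF
    have hFL : Measurable fun z : ℝ × ℝ => F (L z) := hF.comp L.continuous.measurable
    conv_lhs => rw [hvol]
    rw [lintegral_smul_measure, ENNReal.smul_def, smul_eq_mul, lintegral_map hF L.continuous.measurable,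
      Measure.volume_eq_prod, lintegral_prod_symm' _ hFL]
    rfl
  refine ⟨c⁻¹, fun k hk => ?_⟩
  have hk2 : Measurable fun z : ℝ × ℝ => k (z.1 • d₁ + z.2 • d₂) := hk.comp (by fun_prop)
  set A₁ : ℝ → ℝ≥0∞ := fun t => ∫⁻ s : ℝ, k (s • d₁ + t • d₂)
  set A₂ : ℝ → ℝ≥0∞ := fun s => ∫⁻ t : ℝ, k (s • d₁ + t • d₂)
  have hA₁ : Measurable A₁ := Measurable.lintegral_prod_left' hk2
  have hA₂ : Measurable A₂ := Measurable.lintegral_prod_right' hk2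
  have hm : ∀ d : Plane, Measurable fun x : Plane => ∫⁻ s : ℝ, k (x + s • d) := fun d =>
    Measurable.lintegral_prod_right' (f := fun z : Plane × ℝ => k (z.1 + z.2 • d))
      (hk.comp (by fun_prop))
  have h1 : ∀ s t : ℝ, ∫⁻ s' : ℝ, k (s • d₁ + t • d₂ + s' • d₁) = A₁ t := by
    intro s t
    simp only [A₁]
    rw [← lintegral_add_left_eq_self (fun s' : ℝ => k (s' • d₁ + t • d₂)) s]
    refine lintegral_congr fun s' => ?_
    congr 1; rw [add_smul]; abel
  have h2 : ∀ s t : ℝ, ∫⁻ t' : ℝ, k (s • d₁ + t • d₂ + t' • d₂) = A₂ s := by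
    intro s t
    simp only [A₂]
    rw [← lintegral_add_left_eq_self (fun t' : ℝ => k (s • d₁ + t' • d₂)) t]
    refine lintegral_congr fun t' => ?_
    congr 1; rw [add_smul]; abel
  have h3 : ∫⁻ s : ℝ, A₂ s = ∫⁻ t : ℝ, A₁ t := lintegral_lintegral_swap hk2.aemeasurable
  rw [hint (fun x => (∫⁻ s : ℝ, k (x + s • d₁)) * ∫⁻ s : ℝ, k (x + s • d₂))
    ((hm d₁).mul (hm d₂)), hint k hk]
  simp_rw [h1, h2]
  have h4 : ∫⁻ t : ℝ, ∫⁻ s : ℝ, A₁ t * A₂ s = (∫⁻ t : ℝ, A₁ t) ^ 2 := by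
    simp_rw [lintegral_const_mul _ hA₂]
    rw [lintegral_mul_const _ hA₁, h3, sq]
  rw [h4, mul_pow, ← mul_assoc]
  refine le_of_eq ?_
  congr 1
  have h5 : (c : ℝ≥0∞) ≠ 0 := by exact_mod_cast hc0.ne'
  rw [ENNReal.coe_inv hc0.ne', sq, ← mul_assoc, ENNReal.inv_mul_cancel h5 ENNReal.coe_ne_top,
    one_mul]

variable {Ω : Set Plane} {u : Plane → ℝ} {G : Plane → Plane}

lemma gradient_apply (φ : Plane → ℝ) (x : Plane) (i : Fin 2) :
    gradient φ x i = fderiv ℝ φ x (EuclideanSpace.single i 1) := by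
  have h := InnerProductSpace.toDual_symm_apply (𝕜 := ℝ) (x := EuclideanSpace.single i (1 : ℝ))
    (y := fderiv ℝ φ x)
  rw [← h, EuclideanSpace.inner_single_right]
  simp [gradient]

/-- Localization: multiplication of `u` by a cutoff function supported in a ball `B`, in which `Ω`
coincides with `V`, yields a function with a weak gradient in `V`. -/
lemma HasWeakGrad.mul_cutoff {V B : Set Plane} (h : HasWeakGrad Ω u G) (hu : Integrable u)
    (hG : Integrable G) (hu0 : ∀ x, x ∉ Ω → u x = 0) (hG0 : ∀ x, x ∉ Ω → G x = 0)
    (hVB : V ∩ B ⊆ Ω)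
    {ζ : Plane → ℝ} (hζ : ContDiff ℝ ∞ ζ) (hζc : HasCompactSupport ζ) (hζB : tsupport ζ ⊆ B) :
    HasWeakGrad V (fun x => ζ x * u x) (fun x => ζ x • G x + u x • gradient ζ x) := by
  intro φ hφ hφc hφV i
  set e : Plane := EuclideanSpace.single i 1
  have hψ : ContDiff ℝ ∞ fun x => ζ x * φ x := hζ.mul hφ
  have hψc : HasCompactSupport fun x => ζ x * φ x := hφc.mul_left
  have hψΩ : tsupport (fun x => ζ x * φ x) ⊆ Ω := fun x hx =>
    hVB ⟨hφV (tsupport_mul_subset_right hx), hζB (tsupport_mul_subset_left hx)⟩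
  have htest := h _ hψ hψc hψΩ i
  have hder : ∀ x, fderiv ℝ (fun x => ζ x * φ x) x e =
      ζ x * fderiv ℝ φ x e + φ x * fderiv ℝ ζ x e := fun x => by
    have h1 := ((hζ.differentiable (by simp) x).hasFDerivAt.mul
      (hφ.differentiable (by simp) x).hasFDerivAt).fderiv
    have h2 := congrArg (fun L : Plane →L[ℝ] ℝ => L e) h1
    simp only [add_apply, smul_apply, smul_eq_mul] at h2
    exact h2
  have hsup : ∀ x, x ∉ V → φ x = 0 := fun x hx => image_eq_zero_of_notMem_tsupport fun h => hx (hφV h)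
  have hsup' : ∀ x, x ∉ V → fderiv ℝ φ x e = 0 := fun x hx => by
    rw [image_eq_zero_of_notMem_tsupport (f := fderiv ℝ φ)
      fun h => hx (hφV (tsupport_fderiv_subset ℝ h))]; rfl
  rw [setIntegral_eq_integral_of_forall_compl_eq_zero fun x hx => by rw [hu0 x hx, zero_mul],
    setIntegral_eq_integral_of_forall_compl_eq_zero fun x hx => by rw [hG0 x hx]; simp] at htest
  rw [setIntegral_eq_integral_of_forall_compl_eq_zero fun x hx => by rw [hsup' x hx, mul_zero],
    setIntegral_eq_integral_of_forall_compl_eq_zero fun x hx => by rw [hsup x hx, mul_zero]]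
  have hdζ : Continuous fun x => fderiv ℝ ζ x e :=
    (hζ.continuous_fderiv (by simp)).clm_apply continuous_const
  have hdφ : Continuous fun x => fderiv ℝ φ x e :=
    (hφ.continuous_fderiv (by simp)).clm_apply continuous_const
  have i1 : Integrable fun x => u x * (ζ x * fderiv ℝ φ x e) :=
    integrable_mul_of_hasCompactSupport hu (hζ.continuous.mul hdφ) hζc.mul_right
  have i2 : Integrable fun x => u x * (φ x * fderiv ℝ ζ x e) :=
    integrable_mul_of_hasCompactSupport hu (hφ.continuous.mul hdζ) hφc.mul_right
  have i3 : Integrable fun x => G x i * (ζ x * φ x) :=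
    integrable_mul_of_hasCompactSupport (integrable_coord hG i) hψ.continuous hψc
  have e1 : ∫ x, u x * fderiv ℝ (fun x => ζ x * φ x) x e =
      (∫ x, u x * (ζ x * fderiv ℝ φ x e)) + ∫ x, u x * (φ x * fderiv ℝ ζ x e) := by
    rw [← integral_add i1 i2]
    exact integral_congr_ae (ae_of_all _ fun x => by simp only [hder]; ring)
  have e2 : ∫ x, (ζ x • G x + u x • gradient ζ x) i * φ x =
      (∫ x, G x i * (ζ x * φ x)) + ∫ x, u x * (φ x * fderiv ℝ ζ x e) := by
    rw [← integral_add i3 i2]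
    refine integral_congr_ae (ae_of_all _ fun x => ?_)
    simp only [PiLp.add_apply, PiLp.smul_apply, smul_eq_mul, gradient_apply]
    ring
  have e3 : ∫ x, ζ x * u x * fderiv ℝ φ x e = ∫ x, u x * (ζ x * fderiv ℝ φ x e) :=
    integral_congr_ae (ae_of_all _ fun x => by simp only; ring)
  rw [e2, e3]
  rw [e1] at htest
  linarith

/-- The Sobolev inequality near a point at which `Ω` is the region above a Lipschitz graph. The two
directions point into the region, so that the values of a localized function are bounded by line
integrals of its gradient in both directions. -/
lemma exists_sobolev_of_graph {z : Plane} {r : ℝ} (hr : 0 < r) (hΩo : IsOpen Ω)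
    (e : Plane ≃ₗᵢ[ℝ] Plane)
    {K : ℝ≥0} {γ : ℝ → ℝ} (hγ : LipschitzWith K γ)
    (hΩ : Ω ∩ ball z r = {x | x ∈ ball z r ∧ γ ((e x) 0) < (e x) 1}) :
    ∃ C : ℝ≥0, ∀ u G, IsW1 Ω 1 u G →
      ∫⁻ x in Ω ∩ ball z (r / 2), ‖u x‖ₑ ^ 2 ≤
        C * ((∫⁻ x in Ω, ‖u x‖ₑ) + ∫⁻ x in Ω, ‖G x‖ₑ) ^ 2 := by
  set V : Set Plane := {x | γ ((e x) 0) < (e x) 1} with hV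
  have hVo : IsOpen V := by
    have := hγ.continuous
    exact isOpen_lt (by fun_prop) (by fun_prop)
  have hΩV : ∀ x ∈ ball z r, x ∈ Ω ↔ x ∈ V := fun x hx => by
    have := Set.ext_iff.1 hΩ x
    simp only [mem_inter_iff, hx, and_true, mem_ofPred_eq, true_and] at this
    exact this
  -- for `|σ| ≤ 1` this direction is steeper than the graph, so that it points into `V`; its length is at
  -- least the diameter of the ball, so that a segment from a point of the ball leaves the ball
  let dir : ℝ → Plane := fun σ => e.symm !₂[2 * r * σ, 2 * r * (K + 1)]
  have hedir : ∀ σ, e (dir σ) = !₂[2 * r * σ, 2 * r * (K + 1)] := fun σ => by simp [dir]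
  have hdirV : ∀ σ, |σ| ≤ 1 → ∀ x ∈ V, ∀ s ∈ Icc (0 : ℝ) 1, x + s • dir σ ∈ V := by
    intro σ hσ x hx s hs
    have h0 : e (x + s • dir σ) = e x + s • !₂[2 * r * σ, 2 * r * (K + 1)] := by
      rw [map_add, map_smul, hedir]
    simp only [hV, mem_ofPred_eq] at hx ⊢
    simp only [h0, PiLp.add_apply, PiLp.smul_apply, smul_eq_mul]
    simp only [Matrix.cons_val_zero, Matrix.cons_val_one]
    have h1 := hγ.dist_le_mul ((e x) 0 + s * (2 * r * σ)) ((e x) 0)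
    rw [Real.dist_eq, Real.dist_eq, add_sub_cancel_left, abs_mul, abs_mul, abs_of_nonneg hs.1,
      abs_of_pos (by positivity : 0 < 2 * r)] at h1
    have h2 := le_abs_self (γ ((e x) 0 + s * (2 * r * σ)) - γ ((e x) 0))
    have h3 : s * (2 * r * |σ|) ≤ s * (2 * r) := by
      have := mul_le_mul_of_nonneg_left hσ (by positivity : 0 ≤ 2 * r)
      rw [mul_one] at this
      exact mul_le_mul_of_nonneg_left this hs.1
    have h4 := mul_le_mul_of_nonneg_left h3 K.coe_nonneg
    have h5 : 0 ≤ s * (2 * r) := mul_nonneg hs.1 (by positivity)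
    nlinarith
  have hdirn : ∀ σ, 2 * r ≤ ‖dir σ‖ := by
    intro σ
    rw [← e.norm_map, hedir]
    have h1 := PiLp.norm_apply_le (!₂[2 * r * σ, 2 * r * (K + 1)] : Plane) 1
    simp only [Matrix.cons_val_one, Matrix.cons_val_fin_one] at h1
    have h2 : 0 ≤ r * K := by positivity
    have h3 := le_abs_self (2 * r * ((K : ℝ) + 1))
    rw [Real.norm_eq_abs] at h1
    linarith
  have hind : ∀ s t : ℝ, s • dir 1 + t • dir (-1) = 0 → s = 0 ∧ t = 0 := by
    intro s t h
    have h1 := congrArg e h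
    rw [map_add, map_smul, map_smul, hedir, hedir, map_zero] at h1
    have h2 := congrArg (fun v : Plane => v 0) h1
    have h3 := congrArg (fun v : Plane => v 1) h1
    simp at h2 h3
    have hK : (0 : ℝ) < K + 1 := by positivity
    have h4 : s = t := by
      have : r * (s - t) = 0 := by linarith
      rcases mul_eq_zero.1 this with h | h
      · exact absurd h hr.ne'
      · linarith
    have h5 : s * (r * (K + 1)) = 0 := by rw [h4] at h3 ⊢; linarith
    rcases mul_eq_zero.1 h5 with h | h
    · exact ⟨h, h4 ▸ h⟩
    · exact absurd h (by positivity)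
  obtain ⟨C, hC⟩ := exists_lintegral_line_mul_line_le hind
  let ζ : ContDiffBump z := ⟨r / 2, 3 * r / 4, by positivity, by linarith⟩
  have hζB : tsupport ζ ⊆ ball z r := by
    rw [ζ.tsupport_eq]; exact closedBall_subset_ball (by simp only [ζ]; linarith)
  have hζs : ContDiff ℝ ∞ ζ := ζ.contDiff
  have hgc : Continuous (gradient ζ) :=
    (InnerProductSpace.toDual ℝ Plane).symm.continuous.comp (hζs.continuous_fderiv (by simp))
  have hgs : ∀ x, x ∉ tsupport ζ → gradient ζ x = 0 := fun x hx => by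
    have : fderiv ℝ ζ x = 0 := image_eq_zero_of_notMem_tsupport (f := fderiv ℝ ζ)
      fun h => hx (tsupport_fderiv_subset ℝ h)
    simp [gradient, this]
  obtain ⟨D, hD⟩ := hgc.bounded_above_of_compact_support
    (HasCompactSupport.intro ζ.hasCompactSupport hgs)
  have hD0 : 0 ≤ D := (norm_nonneg _).trans (hD 0)
  set D' : ℝ≥0 := ⟨D, hD0⟩ + 1
  refine ⟨‖dir 1‖₊ * ‖dir (-1)‖₊ * C * D' ^ 2, fun u G huG => ?_⟩
  have hu1 : IntegrableOn u Ω := memLp_one_iff_integrable.1 huG.memLp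
  have hG1 : IntegrableOn G Ω := memLp_one_iff_integrable.1 huG.memLp_grad
  obtain ⟨u', hum, hui, huu, hu0⟩ := exists_stronglyMeasurable_extension hΩo.measurableSet hu1
  obtain ⟨G', hGm, hGi, hGG, hG0⟩ := exists_stronglyMeasurable_extension hΩo.measurableSet hG1
  have h' : HasWeakGrad Ω u' G' := huG.hasWeakGrad.congr_ae huu hGG
  set w : Plane → ℝ := fun x => ζ x * u' x
  set H : Plane → Plane := fun x => ζ x • G' x + u' x • gradient ζ x
  have hw : HasWeakGrad V w H := h'.mul_cutoff hui hGi hu0 hG0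
    (fun x hx => (hΩV x hx.2).2 hx.1) hζs ζ.hasCompactSupport hζB
  have hζ1 : ∀ x, ‖ζ x‖ ≤ 1 := fun x => by
    rw [Real.norm_of_nonneg ζ.nonneg]; exact ζ.le_one
  have hwi : Integrable w :=
    hui.bdd_mul ζ.continuous.aestronglyMeasurable (ae_of_all _ hζ1)
  have hHm : StronglyMeasurable H :=
    (ζ.continuous.stronglyMeasurable.smul hGm).add (hum.smul hgc.stronglyMeasurable)
  have hHn : ∀ x, ‖H x‖ ≤ ‖G' x‖ + ‖u' x‖ * D := fun x => by
    refine (norm_add_le _ _).trans ?_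
    rw [norm_smul, norm_smul]
    gcongr
    · exact mul_le_of_le_one_left (norm_nonneg _) (hζ1 x)
    · exact hD x
  have hHi : Integrable H :=
    (hGi.norm.add (hui.norm.mul_const D)).mono' hHm.aestronglyMeasurable (ae_of_all _ hHn)
  have hline : ∀ σ, |σ| ≤ 1 → ∀ᵐ x, ‖w x‖ₑ ≤ ‖dir σ‖ₑ * ∫⁻ s : ℝ, ‖H (x + s • dir σ)‖ₑ := by
    intro σ hσ
    filter_upwards [hw.ae_sub_eq_integral hwi hHi hHm hVo (hdirV σ hσ)] with x hx
    by_cases hw0 : w x = 0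
    · simp [hw0]
    have hxζ : ζ x ≠ 0 := left_ne_zero_of_mul hw0
    have hxB : x ∈ ball z r := hζB (subset_tsupport _ hxζ)
    have hxΩ : x ∈ Ω := by
      by_contra hxΩ; exact right_ne_zero_of_mul hw0 (hu0 x hxΩ)
    have hxd : w (x + dir σ) = 0 := by
      have : ζ (x + dir σ) = 0 := image_eq_zero_of_notMem_tsupport fun h1 => by
        have h2 := mem_ball.1 (hζB h1)
        have h3 := mem_ball.1 hxB
        have h4 : ‖dir σ‖ = dist (x + dir σ) x := by simp [dist_eq_norm]
        have h5 := dist_triangle_right (x + dir σ) x z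
        linarith [hdirn σ]
      simp [w, this]
    have h1 := hx ((hΩV x hxB).1 hxΩ)
    rw [hxd, zero_sub, intervalIntegral.integral_of_le zero_le_one] at h1
    rw [← enorm_neg, h1]
    calc ‖∫ s in Ioc (0 : ℝ) 1, inner ℝ (H (x + s • dir σ)) (dir σ)‖ₑ
        ≤ ∫⁻ s in Ioc (0 : ℝ) 1, ‖inner ℝ (H (x + s • dir σ)) (dir σ)‖ₑ :=
          enorm_integral_le_lintegral_enorm _
      _ ≤ ∫⁻ s : ℝ, ‖inner ℝ (H (x + s • dir σ)) (dir σ)‖ₑ :=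
          lintegral_mono' Measure.restrict_le_self le_rfl
      _ ≤ ∫⁻ s : ℝ, ‖dir σ‖ₑ * ‖H (x + s • dir σ)‖ₑ := by
          refine lintegral_mono fun s => ?_
          rw [mul_comm]
          simp only [enorm_eq_nnnorm]
          exact_mod_cast nnnorm_inner_le_nnnorm (𝕜 := ℝ) (H (x + s • dir σ)) (dir σ)
      _ = _ := by
          rw [lintegral_const_mul]
          exact (hHm.comp_measurable (by fun_prop)).enorm
  calc ∫⁻ x in Ω ∩ ball z (r / 2), ‖u x‖ₑ ^ 2
      = ∫⁻ x in Ω ∩ ball z (r / 2), ‖u' x‖ₑ ^ 2 := by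
        refine lintegral_congr_ae ?_
        filter_upwards [ae_restrict_of_ae_restrict_of_subset inter_subset_left huu] with x hx
        rw [hx]
    _ = ∫⁻ x in Ω ∩ ball z (r / 2), ‖w x‖ₑ ^ 2 := by
        refine setLIntegral_congr_fun (hΩo.inter isOpen_ball).measurableSet fun x hx => ?_
        have : ζ x = 1 := ζ.one_of_mem_closedBall (ball_subset_closedBall hx.2)
        simp [w, this]
    _ ≤ ∫⁻ x, ‖w x‖ₑ ^ 2 := lintegral_mono' Measure.restrict_le_self le_rfl
    _ ≤ ∫⁻ x, ‖dir 1‖ₑ * ‖dir (-1)‖ₑ *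
        ((∫⁻ s : ℝ, ‖H (x + s • dir 1)‖ₑ) * ∫⁻ s : ℝ, ‖H (x + s • dir (-1))‖ₑ) := by
        refine lintegral_mono_ae ?_
        filter_upwards [hline 1 (by simp), hline (-1) (by simp)] with x h1 h2
        rw [sq]
        refine (mul_le_mul' h1 h2).trans_eq ?_
        ring
    _ ≤ ‖dir 1‖ₑ * ‖dir (-1)‖ₑ * (C * (∫⁻ x, ‖H x‖ₑ) ^ 2) := by
        rw [lintegral_const_mul' _ _ (ENNReal.mul_ne_top enorm_ne_top enorm_ne_top)]
        gcongr
        exact hC _ hHm.enorm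
    _ ≤ ‖dir 1‖ₑ * ‖dir (-1)‖ₑ * (C * (D' * ((∫⁻ x, ‖u' x‖ₑ) + ∫⁻ x, ‖G' x‖ₑ)) ^ 2) := by
        gcongr
        rw [← lintegral_add_left hum.enorm,
          ← lintegral_const_mul (D' : ℝ≥0∞) (f := fun x => ‖u' x‖ₑ + ‖G' x‖ₑ)
            (hum.enorm.add hGm.enorm)]
        refine lintegral_mono fun x => ?_
        have h1 : ‖H x‖₊ ≤ D' * (‖u' x‖₊ + ‖G' x‖₊) := by
          rw [← NNReal.coe_le_coe]
          push_cast
          refine (hHn x).trans ?_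
          have : (D' : ℝ) = D + 1 := rfl
          rw [this]
          nlinarith [norm_nonneg (u' x), norm_nonneg (G' x)]
        simp only [enorm_eq_nnnorm]
        exact_mod_cast h1
    _ = _ := by
        have h1 : ∫⁻ x, ‖u' x‖ₑ = ∫⁻ x in Ω, ‖u x‖ₑ := by
          rw [← setLIntegral_eq_of_support_subset (s := Ω)]
          · exact lintegral_congr_ae (huu.mono fun x hx => by simp only [hx])
          · intro x hx
            by_contra h; exact hx (by simp [hu0 x h])
        have h2 : ∫⁻ x, ‖G' x‖ₑ = ∫⁻ x in Ω, ‖G x‖ₑ := by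
          rw [← setLIntegral_eq_of_support_subset (s := Ω)]
          · exact lintegral_congr_ae (hGG.mono fun x hx => by simp only [hx])
          · intro x hx
            by_contra h; exact hx (by simp [hG0 x h])
        rw [h1, h2]
        simp only [enorm_eq_nnnorm]
        push_cast
        ring

/-- The Sobolev inequality `‖u‖_{L²} ≤ C ‖u‖_{W^{1,1}}` in bounded Lipschitz domains of the plane. -/
theorem IsBoundedLipschitzDomain.exists_sobolev (hΩ : IsBoundedLipschitzDomain Ω) :
    ∃ C : ℝ≥0, ∀ u G, IsW1 Ω 1 u G →
      ∫⁻ x in Ω, ‖u x‖ₑ ^ 2 ≤ C * ((∫⁻ x in Ω, ‖u x‖ₑ) + ∫⁻ x in Ω, ‖G x‖ₑ) ^ 2 := by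
  have hcomp : IsCompact (closure Ω) := hΩ.isBounded.isCompact_closure
  have key : ∃ C : ℝ≥0, ∀ u G, IsW1 Ω 1 u G → ∫⁻ x in Ω ∩ closure Ω, ‖u x‖ₑ ^ 2 ≤
      C * ((∫⁻ x in Ω, ‖u x‖ₑ) + ∫⁻ x in Ω, ‖G x‖ₑ) ^ 2 := by
    refine hcomp.induction_on (p := fun s => ∃ C : ℝ≥0, ∀ u G, IsW1 Ω 1 u G →
      ∫⁻ x in Ω ∩ s, ‖u x‖ₑ ^ 2 ≤ C * ((∫⁻ x in Ω, ‖u x‖ₑ) + ∫⁻ x in Ω, ‖G x‖ₑ) ^ 2) ?_ ?_ ?_ ?_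
    · exact ⟨0, fun u G _ => by simp⟩
    · rintro s t hst ⟨C, hC⟩
      exact ⟨C, fun u G h => (lintegral_mono_set (inter_subset_inter_right _ hst)).trans (hC u G h)⟩
    · rintro s t ⟨C, hC⟩ ⟨C', hC'⟩
      refine ⟨C + C', fun u G h => ?_⟩
      rw [inter_union_distrib_left, ENNReal.coe_add, add_mul]
      exact (lintegral_union_le _ _ _).trans (add_le_add (hC u G h) (hC' u G h))
    · intro z hz
      by_cases hzΩ : z ∈ Ω
      · obtain ⟨r, hr, hrΩ⟩ := Metric.isOpen_iff.1 hΩ.isOpen z hzΩ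
        -- in a ball inside `Ω` the graph is a horizontal line that passes below the ball
        obtain ⟨C, hC⟩ := exists_sobolev_of_graph hr hΩ.isOpen (LinearIsometryEquiv.refl ℝ Plane)
          (LipschitzWith.const (z 1 - r)) (z := z) (by
            ext x
            simp only [mem_inter_iff, mem_ofPred_eq, LinearIsometryEquiv.coe_refl, id]
            refine ⟨fun h => ⟨h.2, ?_⟩, fun h => ⟨hrΩ h.1, h.1⟩⟩
            have h1 := PiLp.norm_apply_le (x - z) 1
            have h2 := mem_ball_iff_norm.1 h.2
            rw [Real.norm_eq_abs, PiLp.sub_apply] at h1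
            linarith [neg_abs_le (x 1 - z 1)])
        exact ⟨ball z (r / 2), mem_nhdsWithin_of_mem_nhds (ball_mem_nhds z (half_pos hr)), C, hC⟩
      · have hzf : z ∈ frontier Ω := ⟨hz, fun h => hzΩ (interior_subset h)⟩
        obtain ⟨r, hr, e, K, γ, hγ, hΩr⟩ := hΩ.lipschitz z hzf
        obtain ⟨C, hC⟩ := exists_sobolev_of_graph hr hΩ.isOpen e hγ hΩr
        exact ⟨ball z (r / 2), mem_nhdsWithin_of_mem_nhds (ball_mem_nhds z (half_pos hr)), C, hC⟩
  rwa [inter_eq_left.2 subset_closure] at key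

end SobolevInequality

/-! ### Averages over a grid of squares -/

section Cells

/-- The index of the square of side `1 / (m + 1)` containing `x`. -/
noncomputable def cellIndex (m : ℕ) (x : Plane) : ℤ × ℤ := (⌊(m + 1 : ℝ) * x 0⌋, ⌊(m + 1 : ℝ) * x 1⌋)

/-- The half-open squares of side `1 / (m + 1)`, which partition the plane. -/
def cell (m : ℕ) (i : ℤ × ℤ) : Set Plane := {x | cellIndex m x = i}

/-- The union of those squares of side `1 / (m + 1)` that are contained in `Ω`. -/
def innerCells (Ω : Set Plane) (m : ℕ) : Set Plane := {x | cell m (cellIndex m x) ⊆ Ω}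

open Classical in
/-- The average of `u` over the square with index `i`, or `0` if that square is not in `Ω`. -/
noncomputable def cellValue (Ω : Set Plane) (u : Plane → ℝ) (m : ℕ) (i : ℤ × ℤ) : ℝ :=
  if cell m i ⊆ Ω then ⨍ y in cell m i, u y else 0

/-- The finite-rank averaging operator: `u` is replaced by its averages over the squares of side
`1 / (m + 1)` contained in `Ω`, and by `0` elsewhere. -/
noncomputable def cellAverage (Ω : Set Plane) (m : ℕ) (u : Plane → ℝ) (x : Plane) : ℝ :=
  cellValue Ω u m (cellIndex m x)

variable {Ω : Set Plane} {m : ℕ} {i : ℤ × ℤ}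

lemma mem_cell_iff {x : Plane} : x ∈ cell m i ↔
    ((i.1 : ℝ) ≤ (m + 1 : ℝ) * x 0 ∧ (m + 1 : ℝ) * x 0 < i.1 + 1) ∧
      ((i.2 : ℝ) ≤ (m + 1 : ℝ) * x 1 ∧ (m + 1 : ℝ) * x 1 < i.2 + 1) := by
  rw [← Int.floor_eq_iff, ← Int.floor_eq_iff]
  exact Prod.ext_iff

lemma measurable_cellIndex (m : ℕ) : Measurable (cellIndex m) := by
  unfold cellIndex
  fun_prop

lemma measurableSet_cell : MeasurableSet (cell m i) :=
  measurable_cellIndex m (measurableSet_singleton i)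

lemma measurableSet_innerCells (Ω : Set Plane) (m : ℕ) : MeasurableSet (innerCells Ω m) :=
  measurable_cellIndex m (MeasurableSet.of_discrete (s := {i | cell m i ⊆ Ω}))

lemma innerCells_subset (Ω : Set Plane) (m : ℕ) : innerCells Ω m ⊆ Ω := fun _ hx => hx rfl

lemma measurable_cellAverage (Ω : Set Plane) (m : ℕ) (u : Plane → ℝ) :
    Measurable (cellAverage Ω m u) :=
  (measurable_of_countable (cellValue Ω u m)).comp (measurable_cellIndex m)

lemma convex_cell : Convex ℝ (cell m i) := by
  intro x hx y hy a b ha hb hab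
  rw [mem_cell_iff] at *
  obtain ⟨⟨h1, h2⟩, h3, h4⟩ := hx
  obtain ⟨⟨k1, k2⟩, k3, k4⟩ := hy
  have hb' : b = 1 - a := by linarith
  simp only [PiLp.add_apply, PiLp.smul_apply, smul_eq_mul]
  have e : ∀ j, (m + 1 : ℝ) * (a * x j + b * y j) =
      a * ((m + 1 : ℝ) * x j) + b * ((m + 1 : ℝ) * y j) := fun j => by ring
  rw [e, e]
  have key : ∀ {c s t : ℝ}, c ≤ s → s < c + 1 → c ≤ t → t < c + 1 →
      c ≤ a * s + b * t ∧ a * s + b * t < c + 1 := by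
    intro c s t h1 h2 h3 h4
    refine ⟨?_, ?_⟩
    · have := add_le_add (mul_le_mul_of_nonneg_left h1 ha) (mul_le_mul_of_nonneg_left h3 hb)
      rwa [← add_mul, hab, one_mul] at this
    · rcases ha.lt_or_eq with ha | ha
      · have := add_lt_add_of_lt_of_le (mul_lt_mul_of_pos_left h2 ha)
          (mul_le_mul_of_nonneg_left h4.le hb)
        rwa [← add_mul, hab, one_mul] at this
      · rw [← ha] at hab ⊢
        rw [zero_add] at hab
        rw [hab]; linarith
  exact ⟨key h1 h2 k1 k2, key h3 h4 k3 k4⟩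

lemma plane_norm_le (x : Plane) : ‖x‖ ≤ |x 0| + |x 1| := by
  rw [EuclideanSpace.norm_eq, Fin.sum_univ_two]
  refine Real.sqrt_le_iff.2 ⟨by positivity, ?_⟩
  rw [Real.norm_eq_abs, Real.norm_eq_abs]
  nlinarith [abs_nonneg (x 0), abs_nonneg (x 1)]

lemma norm_sub_le_of_mem_cell {x y : Plane} (hx : x ∈ cell m i) (hy : y ∈ cell m i) :
    ‖x - y‖ ≤ 2 / (m + 1) := by
  rw [mem_cell_iff] at *
  obtain ⟨⟨h1, h2⟩, h3, h4⟩ := hx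
  obtain ⟨⟨k1, k2⟩, k3, k4⟩ := hy
  have hm : (0 : ℝ) < m + 1 := by positivity
  have key : ∀ j, |(m + 1 : ℝ) * x j - (m + 1 : ℝ) * y j| ≤ 1 → |(x - y) j| ≤ 1 / (m + 1) := by
    intro j h
    rw [← mul_sub, abs_mul, abs_of_pos hm] at h
    rw [le_div_iff₀ hm, PiLp.sub_apply]
    linarith
  have e0 := key 0 (abs_le.2 ⟨by linarith, by linarith⟩)
  have e1 := key 1 (abs_le.2 ⟨by linarith, by linarith⟩)
  refine (plane_norm_le _).trans ((add_le_add e0 e1).trans_eq ?_)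
  ring

lemma le_volume_cell : ENNReal.ofReal ((1 / (2 * (m + 1))) ^ 2) * volume (ball (0 : Plane) 1) ≤
    volume (cell m i) := by
  have hm : (0 : ℝ) < m + 1 := by positivity
  set c : Plane := !₂[(i.1 + 1 / 2) / (m + 1), (i.2 + 1 / 2) / (m + 1)]
  have h := Measure.addHaar_ball (volume : Measure Plane) c
    (show (0 : ℝ) ≤ 1 / (2 * (m + 1)) by positivity)
  rw [finrank_euclideanSpace_fin] at h
  rw [← h]
  refine measure_mono fun x hx => ?_
  rw [mem_ball_iff_norm] at hx
  have key : ∀ j, |(m + 1 : ℝ) * x j - (m + 1 : ℝ) * c j| < 1 / 2 := by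
    intro j
    rw [← mul_sub, abs_mul, abs_of_pos hm]
    have h1 := (PiLp.norm_apply_le (x - c) j).trans_lt hx
    rw [Real.norm_eq_abs, PiLp.sub_apply, lt_div_iff₀ (by positivity)] at h1
    linarith
  have k0 := abs_lt.1 (key 0)
  have k1 := abs_lt.1 (key 1)
  have c0 : (m + 1 : ℝ) * c 0 = i.1 + 1 / 2 := by
    simp only [c, Matrix.cons_val_zero]; field_simp
  have c1 : (m + 1 : ℝ) * c 1 = i.2 + 1 / 2 := by
    simp only [c, Matrix.cons_val_one, Matrix.cons_val_fin_one]; field_simp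
  rw [c0] at k0
  rw [c1] at k1
  rw [mem_cell_iff]
  exact ⟨⟨by linarith, by linarith⟩, by linarith, by linarith⟩

lemma isBounded_cell : Bornology.IsBounded (cell m i) := by
  refine Metric.isBounded_iff.2 ⟨2 / (m + 1), fun x hx y hy => ?_⟩
  rw [dist_eq_norm]; exact norm_sub_le_of_mem_cell hx hy

lemma volume_cell_pos : 0 < volume (cell m i) := by
  refine lt_of_lt_of_le (ENNReal.mul_pos ?_ ?_) le_volume_cell
  · exact (ENNReal.ofReal_pos.2 (by positivity)).ne'
  · exact (measure_ball_pos _ _ one_pos).ne'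

lemma volume_cell_ne_top : volume (cell m i) ≠ ⊤ := isBounded_cell.measure_lt_top.ne

/-- A set of finite volume contains only finitely many squares of a given size. -/
lemma finite_setOf_cell_subset (hΩ : volume Ω ≠ ⊤) (m : ℕ) : {i | cell m i ⊆ Ω}.Finite := by
  have h0 : ENNReal.ofReal ((1 / (2 * (m + 1))) ^ 2) * volume (ball (0 : Plane) 1) ≠ 0 :=
    (ENNReal.mul_pos (ENNReal.ofReal_pos.2 (by positivity)).ne'
      (measure_ball_pos _ _ one_pos).ne').ne'
  have hfin := Measure.finite_const_le_meas_of_disjoint_iUnion (volume : Measure Plane)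
    (pos_iff_ne_zero.2 h0) (As := fun i : {i | cell m i ⊆ Ω} => cell m i.1)
    (fun i => measurableSet_cell) (fun i j hij => by
      refine disjoint_left.2 fun x hx hx' => hij (Subtype.ext ?_)
      exact hx.symm.trans hx') (ne_top_of_le_ne_top hΩ (measure_mono (iUnion_subset fun i => i.2)))
  have huniv : {i : {i | cell m i ⊆ Ω} | ENNReal.ofReal ((1 / (2 * (m + 1))) ^ 2) *
      volume (ball (0 : Plane) 1) ≤ volume (cell m i.1)} = univ :=
    eq_univ_of_forall fun i => le_volume_cell
  rw [huniv] at hfin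
  exact finite_coe_iff.1 (finite_univ_iff.1 hfin)

lemma isOpen_setOf_segment_subset (hΩ : IsOpen Ω) (h : Plane) :
    IsOpen {x | ∀ s ∈ Icc (0 : ℝ) 1, x + s • h ∈ Ω} := by
  rw [isOpen_iff_mem_nhds]
  intro x hx
  refine isCompact_Icc.eventually_forall_of_forall_eventually fun s hs => ?_
  have hc : Continuous fun z : Plane × ℝ => z.1 + z.2 • h := by fun_prop
  exact hc.continuousAt.eventually (hΩ.mem_nhds (hx s hs))

end Cells

/-! ### Compactness of bounded sequences in `W^{1,p}` -/

section Rellich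

variable {Ω : Set Plane} {u : Plane → ℝ} {G : Plane → Plane}

/-- The integral over all `x` of `|u (x + h) - u x|`, restricted to those `x` for which the segment
`[x, x + h]` is in `Ω`, is bounded by `|h| ‖∇u‖_{L¹}`. -/
lemma lintegral_translate_sub_le (hw : HasWeakGrad Ω u G) (hΩ : IsOpen Ω) (hu : Integrable u)
    (hG : Integrable G) (hGm : StronglyMeasurable G) (h : Plane) {S : Set Plane}
    (hS : ∀ x ∈ S, ∀ s ∈ Icc (0 : ℝ) 1, x + s • h ∈ Ω) :
    ∫⁻ x in S, ‖u (x + h) - u x‖ₑ ≤ ‖h‖ₑ * ∫⁻ x, ‖G x‖ₑ := by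
  set W := {x | ∀ s ∈ Icc (0 : ℝ) 1, x + s • h ∈ Ω}
  have hW : IsOpen W := isOpen_setOf_segment_subset hΩ h
  have hline := hw.ae_sub_eq_integral hu hG hGm hW (fun x hx => hx)
  have hm : Measurable fun z : Plane × ℝ => ‖G (z.1 + z.2 • h)‖ₑ :=
    hGm.enorm.comp (by fun_prop)
  calc ∫⁻ x in S, ‖u (x + h) - u x‖ₑ ≤ ∫⁻ x in W, ‖u (x + h) - u x‖ₑ := lintegral_mono_set hS
    _ ≤ ∫⁻ x in W, ∫⁻ s in Ioc (0 : ℝ) 1, ‖h‖ₑ * ‖G (x + s • h)‖ₑ := by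
        refine lintegral_mono_ae ?_
        filter_upwards [ae_restrict_of_ae hline, ae_restrict_mem hW.measurableSet] with x hx hxW
        rw [hx hxW, intervalIntegral.integral_of_le zero_le_one]
        refine (enorm_integral_le_lintegral_enorm _).trans (lintegral_mono fun s => ?_)
        rw [mul_comm]
        simp only [enorm_eq_nnnorm]
        exact_mod_cast nnnorm_inner_le_nnnorm (𝕜 := ℝ) (G (x + s • h)) h
    _ ≤ ∫⁻ x, ∫⁻ s in Ioc (0 : ℝ) 1, ‖h‖ₑ * ‖G (x + s • h)‖ₑ :=
        lintegral_mono' Measure.restrict_le_self le_rfl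
    _ = ∫⁻ s in Ioc (0 : ℝ) 1, ∫⁻ x, ‖h‖ₑ * ‖G (x + s • h)‖ₑ :=
        lintegral_lintegral_swap (hm.const_mul _).aemeasurable
    _ = ∫⁻ s in Ioc (0 : ℝ) 1, ‖h‖ₑ * ∫⁻ x, ‖G x‖ₑ := by
        refine lintegral_congr fun s => ?_
        rw [lintegral_const_mul' _ _ enorm_ne_top,
          lintegral_add_right_eq_self (fun x => ‖G x‖ₑ) (s • h)]
    _ = _ := by simp

/-- A Poincaré inequality on the squares contained in `Ω`, summed over all squares. -/
lemma lintegral_sub_cellAverage_le (h : IsW1 Ω 1 u G) (hΩ : IsOpen Ω) (m : ℕ) :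
    ∫⁻ x in innerCells Ω m, ‖u x - cellAverage Ω m u x‖ₑ ≤
      ENNReal.ofReal (32 / (m + 1)) * ∫⁻ x in Ω, ‖G x‖ₑ := by
  have hu1 : IntegrableOn u Ω := memLp_one_iff_integrable.1 h.memLp
  have hG1 : IntegrableOn G Ω := memLp_one_iff_integrable.1 h.memLp_grad
  obtain ⟨u', hum, hui, huu, hu0⟩ := exists_stronglyMeasurable_extension hΩ.measurableSet hu1
  obtain ⟨G', hGm, hGi, hGG, hG0⟩ := exists_stronglyMeasurable_extension hΩ.measurableSet hG1
  have h' : HasWeakGrad Ω u' G' := h.hasWeakGrad.congr_ae huu hGG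
  set b : ℝ≥0∞ := volume (ball (0 : Plane) 1)
  have hb0 : b ≠ 0 := (measure_ball_pos _ _ one_pos).ne'
  have hbt : b ≠ ⊤ := measure_ball_lt_top.ne
  set c : ℝ≥0∞ := ENNReal.ofReal ((1 / (2 * (m + 1))) ^ 2) * b with hc
  have hc0 : c ≠ 0 := mul_ne_zero (ENNReal.ofReal_pos.2 (by positivity)).ne' hb0
  have hct : c ≠ ⊤ := ENNReal.mul_ne_top ENNReal.ofReal_ne_top hbt
  set R : ℝ := 2 / (m + 1) with hR
  have hRpos : 0 < R := by positivity
  -- pointwise bound of the distance to the average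
  have hpt : ∀ x ∈ innerCells Ω m, ‖u' x - cellAverage Ω m u x‖ₑ ≤
      c⁻¹ * ∫⁻ h in closedBall (0 : Plane) R,
        (cell m (cellIndex m x)).indicator (fun y => ‖u' y - u' x‖ₑ) (x + h) := by
    intro x hx
    set Q := cell m (cellIndex m x)
    have hQΩ : Q ⊆ Ω := hx
    have hav : cellAverage Ω m u x = ⨍ y in Q, u' y := by
      have h1 : cellAverage Ω m u x = ⨍ y in Q, u y := if_pos hQΩ
      rw [h1]
      exact average_congr (ae_restrict_of_ae_restrict_of_subset hQΩ huu)
    have hQfin : Fact (volume Q < ⊤) := ⟨volume_cell_ne_top.lt_top⟩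
    have hQ0 : volume.restrict Q ≠ 0 := by
      rw [Ne, Measure.restrict_eq_zero]; exact volume_cell_pos.ne'
    have hQ1 : volume Q ≠ 0 := volume_cell_pos.ne'
    have h2 : u' x - ⨍ y in Q, u' y = ⨍ y in Q, (u' x - u' y) := by
      have hne : NeZero (volume.restrict Q) := ⟨hQ0⟩
      rw [setAverage_eq, setAverage_eq, integral_sub (integrable_const _) hui.integrableOn,
        smul_sub]
      congr 1
      rw [setIntegral_const, smul_smul, inv_mul_cancel₀, one_smul]
      exact (ENNReal.toReal_pos hQ1 volume_cell_ne_top).ne'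
    rw [hav, h2, setAverage_eq, enorm_smul]
    have h3 : ‖(volume.real Q)⁻¹‖ₑ ≤ c⁻¹ := by
      have hpos : volume.real Q ≠ 0 := (ENNReal.toReal_pos hQ1 volume_cell_ne_top).ne'
      rw [enorm_inv hpos]
      refine ENNReal.inv_le_inv.2 ?_
      rw [Real.enorm_of_nonneg measureReal_nonneg, Measure.real,
        ENNReal.ofReal_toReal volume_cell_ne_top]
      exact le_volume_cell
    refine mul_le_mul' h3 ((enorm_integral_le_lintegral_enorm _).trans ?_)
    have h4 : ∫⁻ y in Q, ‖u' x - u' y‖ₑ =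
        ∫⁻ h, Q.indicator (fun y => ‖u' y - u' x‖ₑ) (x + h) := by
      rw [lintegral_add_left_eq_self (Q.indicator fun y => ‖u' y - u' x‖ₑ) x,
        lintegral_indicator measurableSet_cell]
      exact lintegral_congr fun y => enorm_sub_rev _ _
    rw [h4, ← lintegral_indicator measurableSet_closedBall]
    refine lintegral_mono fun h => ?_
    by_cases hh : x + h ∈ Q
    · have : h ∈ closedBall (0 : Plane) R := by
        rw [mem_closedBall_zero_iff]
        have := norm_sub_le_of_mem_cell hh (show x ∈ Q from rfl)
        rwa [add_sub_cancel_left] at this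
      rw [indicator_of_mem this]
    · rw [indicator_of_notMem hh]; exact bot_le
  -- the shifted sets
  set S : Plane → Set Plane := fun h =>
    {x | x ∈ innerCells Ω m ∧ cellIndex m (x + h) = cellIndex m x}
  have hSseg : ∀ h, ∀ x ∈ S h, ∀ s ∈ Icc (0 : ℝ) 1, x + s • h ∈ Ω := by
    intro h x hx s hs
    refine hx.1 ?_
    have h1 : x ∈ cell m (cellIndex m x) := rfl
    have h2 : x + h ∈ cell m (cellIndex m x) := hx.2
    have h3 := convex_cell h1 h2 (show 0 ≤ 1 - s by linarith [hs.2]) hs.1 (by ring)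
    rwa [smul_add, ← add_assoc, ← add_smul, sub_add_cancel, one_smul] at h3
  have hSm : MeasurableSet {z : Plane × Plane | z.2 ∈ S z.1} := by
    refine MeasurableSet.inter (measurable_snd (measurableSet_innerCells Ω m)) ?_
    exact measurableSet_eq_fun ((measurable_cellIndex m).comp (by fun_prop))
      ((measurable_cellIndex m).comp (by fun_prop))
  have hFm : Measurable fun z : Plane × Plane =>
      {z : Plane × Plane | z.2 ∈ S z.1}.indicator (fun z => ‖u' (z.2 + z.1) - u' z.2‖ₑ) z := by
    refine Measurable.indicator ?_ hSm
    exact ((hum.comp_measurable (by fun_prop)).sub (hum.comp_measurable (by fun_prop))).enorm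
  calc ∫⁻ x in innerCells Ω m, ‖u x - cellAverage Ω m u x‖ₑ
      = ∫⁻ x in innerCells Ω m, ‖u' x - cellAverage Ω m u x‖ₑ := by
        refine lintegral_congr_ae ?_
        filter_upwards [ae_restrict_of_ae_restrict_of_subset (innerCells_subset Ω m) huu] with x hx
        rw [hx]
    _ ≤ ∫⁻ x in innerCells Ω m, c⁻¹ * ∫⁻ h in closedBall (0 : Plane) R,
        (cell m (cellIndex m x)).indicator (fun y => ‖u' y - u' x‖ₑ) (x + h) :=
        setLIntegral_mono_ae' (measurableSet_innerCells Ω m) (ae_of_all _ hpt)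
    _ = c⁻¹ * ∫⁻ x in innerCells Ω m, ∫⁻ h in closedBall (0 : Plane) R,
        (cell m (cellIndex m x)).indicator (fun y => ‖u' y - u' x‖ₑ) (x + h) :=
        lintegral_const_mul' _ _ (ENNReal.inv_ne_top.2 hc0)
    _ = c⁻¹ * ∫⁻ x, ∫⁻ h in closedBall (0 : Plane) R,
        {z : Plane × Plane | z.2 ∈ S z.1}.indicator (fun z => ‖u' (z.2 + z.1) - u' z.2‖ₑ)
          (h, x) := by
        rw [← lintegral_indicator (measurableSet_innerCells Ω m)]
        congr 1
        refine lintegral_congr fun x => ?_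
        by_cases hx : x ∈ innerCells Ω m
        · rw [indicator_of_mem hx]
          refine lintegral_congr fun h => ?_
          by_cases hh : cellIndex m (x + h) = cellIndex m x <;>
            simp [indicator, S, hx, cell, hh]
        · rw [indicator_of_notMem hx]
          refine (lintegral_eq_zero_of_ae_eq_zero (ae_of_all _ fun h => ?_)).symm
          simp [indicator, S, hx]
    _ = c⁻¹ * ∫⁻ h in closedBall (0 : Plane) R, ∫⁻ x in S h, ‖u' (x + h) - u' x‖ₑ := by
        rw [lintegral_lintegral_swap (f := fun x h =>
          {z : Plane × Plane | z.2 ∈ S z.1}.indicator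
            (fun z => ‖u' (z.2 + z.1) - u' z.2‖ₑ) (h, x))
          (hFm.comp measurable_swap).aemeasurable]
        congr 1
        refine lintegral_congr fun h => ?_
        have hSh : MeasurableSet (S h) := measurable_prodMk_left hSm
        rw [← lintegral_indicator hSh]
        rfl
    _ ≤ c⁻¹ * ∫⁻ h in closedBall (0 : Plane) R, ENNReal.ofReal R * ∫⁻ x, ‖G' x‖ₑ := by
        refine mul_le_mul' le_rfl (setLIntegral_mono' measurableSet_closedBall fun h hh => ?_)
        refine (lintegral_translate_sub_le h' hΩ hui hGi hGm h (hSseg h)).trans ?_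
        gcongr
        rw [← ofReal_norm]
        exact ENNReal.ofReal_le_ofReal (mem_closedBall_zero_iff.1 hh)
    _ = ENNReal.ofReal (32 / (m + 1)) * ∫⁻ x, ‖G' x‖ₑ := by
        have hm : (0 : ℝ) < m + 1 := by positivity
        rw [setLIntegral_const, Measure.addHaar_closedBall _ _ hRpos.le, finrank_euclideanSpace_fin]
        have e1 : ENNReal.ofReal (32 / (m + 1)) * c =
            ENNReal.ofReal R * (ENNReal.ofReal (R ^ 2) * b) := by
          rw [hc, ← mul_assoc, ← mul_assoc, ← ENNReal.ofReal_mul (by positivity),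
            ← ENNReal.ofReal_mul (by positivity)]
          congr 2
          rw [hR]; field_simp; norm_num
        calc c⁻¹ * (ENNReal.ofReal R * (∫⁻ x, ‖G' x‖ₑ) * (ENNReal.ofReal (R ^ 2) * b))
            = c⁻¹ * (ENNReal.ofReal R * (ENNReal.ofReal (R ^ 2) * b)) * ∫⁻ x, ‖G' x‖ₑ := by ring
          _ = c⁻¹ * c * (ENNReal.ofReal (32 / (m + 1)) * ∫⁻ x, ‖G' x‖ₑ) := by rw [← e1]; ring
          _ = _ := by rw [ENNReal.inv_mul_cancel hc0 hct, one_mul]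
    _ = _ := by
        congr 1
        rw [← setLIntegral_eq_of_support_subset (s := Ω)]
        · exact lintegral_congr_ae (hGG.mono fun x hx => by simp only [hx])
        · intro x hx
          by_contra h; exact hx (by simp [hG0 x h])

/-- The part of `Ω` that is not covered by squares in `Ω` is small for small squares. -/
lemma tendsto_volume_diff_innerCells (hΩ : IsOpen Ω) (hΩf : volume Ω ≠ ⊤) :
    Tendsto (fun m => volume.real (Ω \ innerCells Ω m)) atTop (𝓝 0) := by
  have hev : ∀ x ∈ Ω, ∀ᶠ m in atTop, x ∈ innerCells Ω m := by
    intro x hx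
    obtain ⟨r, hr, hrΩ⟩ := Metric.isOpen_iff.1 hΩ x hx
    have h1 : Tendsto (fun m : ℕ => 2 * (1 / ((m : ℝ) + 1))) atTop (𝓝 0) := by
      simpa using tendsto_one_div_add_atTop_nhds_zero_nat.const_mul (2 : ℝ)
    filter_upwards [h1.eventually_lt_const hr] with m hm y hy
    refine hrΩ (mem_ball_iff_norm.2 (lt_of_le_of_lt (norm_sub_le_of_mem_cell hy rfl) ?_))
    rwa [← mul_one_div]
  have hmeas : ∀ m, MeasurableSet (Ω \ innerCells Ω m) := fun m =>
    hΩ.measurableSet.diff (measurableSet_innerCells Ω m)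
  have h1 : Tendsto (fun m => ∫ x in Ω, (Ω \ innerCells Ω m).indicator (fun _ => (1 : ℝ)) x) atTop
      (𝓝 (∫ x in Ω, (0 : ℝ))) := by
    have hfin : IsFiniteMeasure (volume.restrict Ω) := ⟨by simpa using hΩf.lt_top⟩
    refine tendsto_integral_of_dominated_convergence (fun _ => 1) (fun m => ?_)
      (integrable_const _) (fun m => ae_of_all _ fun x => ?_) ?_
    · exact aestronglyMeasurable_const.indicator (hmeas m)
    · by_cases hx : x ∈ Ω \ innerCells Ω m <;> simp [hx]
    · filter_upwards [ae_restrict_mem hΩ.measurableSet] with x hx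
      refine tendsto_const_nhds.congr' ?_
      filter_upwards [hev x hx] with m hm
      rw [indicator_of_notMem fun h => h.2 hm]
  rw [integral_zero] at h1
  refine h1.congr fun m => ?_
  rw [integral_indicator_const _ (hmeas m), smul_eq_mul, mul_one,
    measureReal_restrict_apply (hmeas m), inter_eq_left.2 sdiff_subset]

lemma cellAverage_eq_zero {m : ℕ} {x : Plane} (hx : x ∉ innerCells Ω m) :
    cellAverage Ω m u x = 0 := if_neg hx

lemma abs_cellValue_le (hu : IntegrableOn u Ω) (m : ℕ) (i : ℤ × ℤ) :
    |cellValue Ω u m i| ≤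
      ((1 / (2 * (m + 1))) ^ 2 * volume.real (ball (0 : Plane) 1))⁻¹ * ∫ x in Ω, |u x| := by
  unfold cellValue
  split_ifs with h
  · rw [setAverage_eq, smul_eq_mul, abs_mul, abs_inv, abs_of_nonneg measureReal_nonneg]
    have h1 : 0 < volume.real (ball (0 : Plane) 1) :=
      ENNReal.toReal_pos (measure_ball_pos _ _ one_pos).ne' measure_ball_lt_top.ne
    have h2 : (1 / (2 * (m + 1) : ℝ)) ^ 2 * volume.real (ball (0 : Plane) 1) ≤
        volume.real (cell m i) := by
      have := ENNReal.toReal_mono volume_cell_ne_top (le_volume_cell (m := m) (i := i))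
      rwa [ENNReal.toReal_mul, ENNReal.toReal_ofReal (by positivity)] at this
    gcongr
    refine (abs_integral_le_integral_abs).trans ?_
    exact setIntegral_mono_set hu.abs (ae_of_all _ fun _ => abs_nonneg _) h.eventuallyLE
  · rw [abs_zero]
    have : 0 ≤ ∫ x in Ω, |u x| := integral_nonneg fun _ => abs_nonneg _
    positivity

lemma integrableOn_cellAverage (hΩf : volume Ω ≠ ⊤)
    (hu : IntegrableOn u Ω) (m : ℕ) : IntegrableOn (cellAverage Ω m u) Ω := by
  have hfin : IsFiniteMeasure (volume.restrict Ω) := ⟨by simpa using hΩf.lt_top⟩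
  exact Integrable.mono' (integrable_const _) (measurable_cellAverage Ω m u).aestronglyMeasurable
    (ae_of_all _ fun x => abs_cellValue_le hu m _)

/-- The cell averages approximate uniformly on bounded sets of `W^{1,p}(Ω)`, `p > 1`. Near the boundary,
where no cells are available, the bound in `L^p` gives uniform integrability. -/
lemma exists_integral_sub_cellAverage_le (hΩ : IsOpen Ω) (hΩf : volume Ω ≠ ⊤) {p : ℝ} (hp : 1 < p)
    (C : ℝ) {ε : ℝ} (hε : 0 < ε) :
    ∃ m₀ : ℕ, ∀ m ≥ m₀, ∀ u G, IsW1 Ω (ENNReal.ofReal p) u G → ∫ x in Ω, |u x| ^ p ≤ C →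
      ∫ x in Ω, ‖G x‖ ≤ C → ∫ x in Ω, ‖u x - cellAverage Ω m u x‖ ≤ ε := by
  have hfin : IsFiniteMeasure (volume.restrict Ω) := ⟨by simpa using hΩf.lt_top⟩
  have hp1 : 1 ≤ ENNReal.ofReal p := by
    rw [← ENNReal.ofReal_one]; exact ENNReal.ofReal_le_ofReal hp.le
  set C' := max C 0
  obtain ⟨R, hR0, hR⟩ : ∃ R : ℝ, 0 < R ∧ R ^ (1 - p) * C' ≤ ε / 3 := by
    have h1 : Tendsto (fun R : ℝ => R ^ (-(p - 1)) * C') atTop (𝓝 0) := by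
      simpa using (tendsto_rpow_neg_atTop (sub_pos.2 hp)).mul_const C'
    obtain ⟨R, h2, h3⟩ := ((h1.eventually_le_const (show 0 < ε / 3 by positivity)).and
      (eventually_gt_atTop 0)).exists
    exact ⟨R, h3, by rwa [neg_sub] at h2⟩
  have h1 : Tendsto (fun m : ℕ => 32 * C' * (1 / ((m : ℝ) + 1))) atTop (𝓝 0) := by
    simpa using tendsto_one_div_add_atTop_nhds_zero_nat.const_mul (32 * C')
  have h2 := (tendsto_volume_diff_innerCells hΩ hΩf).const_mul R
  rw [mul_zero] at h2
  obtain ⟨m₀, hm₀⟩ := eventually_atTop.1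
    ((h1.eventually_le_const (show 0 < ε / 3 by positivity)).and
      (h2.eventually_le_const (show 0 < ε / 3 by positivity)))
  refine ⟨m₀, fun m hm u G hW hup hG => ?_⟩
  obtain ⟨k1, k2⟩ := hm₀ m hm
  have hu := hW.integrableOn hΩf hp1
  have hGi := hW.integrableOn_grad hΩf hp1
  have hav := integrableOn_cellAverage hΩf hu m
  have hupi : IntegrableOn (fun x => |u x| ^ p) Ω := by
    have := hW.memLp.integrable_norm_rpow (by simp; linarith) ENNReal.ofReal_ne_top
    rwa [ENNReal.toReal_ofReal (by linarith)] at this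
  have hI := measurableSet_innerCells Ω m
  have hsplit : ∫ x in Ω, ‖u x - cellAverage Ω m u x‖ =
      (∫ x in innerCells Ω m, ‖u x - cellAverage Ω m u x‖) +
        ∫ x in Ω \ innerCells Ω m, ‖u x - cellAverage Ω m u x‖ := by
    rw [← integral_inter_add_sdiff (f := fun x => ‖u x - cellAverage Ω m u x‖) hI
      (hu.sub hav).norm, inter_eq_right.2 (innerCells_subset Ω m)]
  have hpart1 : ∫ x in innerCells Ω m, ‖u x - cellAverage Ω m u x‖ ≤ ε / 3 := by
    have hin : IntegrableOn (fun x => u x - cellAverage Ω m u x) (innerCells Ω m) :=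
      (hu.sub hav).mono_set (innerCells_subset Ω m)
    have h3 := lintegral_sub_cellAverage_le (hW.mono hΩf hp1) hΩ m
    rw [← ofReal_integral_norm_eq_lintegral_enorm hin,
      ← ofReal_integral_norm_eq_lintegral_enorm hGi, ← ENNReal.ofReal_mul (by positivity)] at h3
    have h4 := (ENNReal.ofReal_le_ofReal_iff (mul_nonneg (by positivity)
      (integral_nonneg fun _ => norm_nonneg _))).1 h3
    refine h4.trans (le_trans ?_ k1)
    rw [show 32 * C' * (1 / ((m : ℝ) + 1)) = 32 / (m + 1) * C' by ring]
    gcongr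
    exact hG.trans (le_max_left _ _)
  have hpart2 : ∫ x in Ω \ innerCells Ω m, ‖u x - cellAverage Ω m u x‖ ≤ ε / 3 + ε / 3 := by
    have hmd : MeasurableSet (Ω \ innerCells Ω m) := hΩ.measurableSet.diff hI
    have hfin' : IsFiniteMeasure (volume.restrict (Ω \ innerCells Ω m)) :=
      ⟨by simpa using lt_of_le_of_lt (measure_mono sdiff_subset) hΩf.lt_top⟩
    have hup' : IntegrableOn (fun x => |u x| ^ p) (Ω \ innerCells Ω m) :=
      hupi.mono_set sdiff_subset
    calc ∫ x in Ω \ innerCells Ω m, ‖u x - cellAverage Ω m u x‖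
        ≤ ∫ x in Ω \ innerCells Ω m, (R + R ^ (1 - p) * |u x| ^ p) := by
          refine setIntegral_mono_on (IntegrableOn.mono_set (hu.sub hav).norm sdiff_subset)
            ((integrable_const R).add (hup'.const_mul _)) hmd fun x hx => ?_
          rw [cellAverage_eq_zero hx.2, sub_zero, Real.norm_eq_abs]
          have hnn : 0 ≤ R ^ (1 - p) * |u x| ^ p := by positivity
          rcases le_total |u x| R with h | h
          · linarith
          · have h5 : R ^ (1 - p) * |u x| ^ p = |u x| * (|u x| / R) ^ (p - 1) := by
              have hx0 : 0 < |u x| := hR0.trans_le h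
              rw [Real.div_rpow hx0.le hR0.le, show 1 - p = -(p - 1) by ring,
                Real.rpow_neg hR0.le, show |u x| ^ p = |u x| * |u x| ^ (p - 1) by
                  rw [← Real.rpow_one_add' hx0.le (by linarith)]; congr 1; ring]
              field_simp
            have h6 : 1 ≤ (|u x| / R) ^ (p - 1) :=
              Real.one_le_rpow ((one_le_div hR0).2 h) (by linarith)
            have h7 := mul_le_mul_of_nonneg_left h6 (abs_nonneg (u x))
            linarith
      _ = R * volume.real (Ω \ innerCells Ω m) +
          R ^ (1 - p) * ∫ x in Ω \ innerCells Ω m, |u x| ^ p := by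
          rw [integral_add (integrable_const R) (hup'.const_mul _), setIntegral_const,
            integral_const_mul, smul_eq_mul, mul_comm]
      _ ≤ ε / 3 + ε / 3 := by
          refine add_le_add k2 (le_trans ?_ hR)
          gcongr
          exact (setIntegral_mono_set hupi (ae_of_all _ fun _ => by positivity)
            (sdiff_subset.eventuallyLE)).trans (hup.trans (le_max_left _ _))
  linarith

lemma integral_norm_sub_le {α F : Type*} [MeasurableSpace α] {μ : Measure α}
    [NormedAddCommGroup F] {f g h : α → F} (hf : Integrable f μ) (hg : Integrable g μ)
    (hh : Integrable h μ) :
    ∫ x, ‖f x - h x‖ ∂μ ≤ (∫ x, ‖f x - g x‖ ∂μ) + ∫ x, ‖g x - h x‖ ∂μ := by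
  have h1 : Integrable (fun x => ‖f x - g x‖) μ := (hf.sub hg).norm
  have h2 : Integrable (fun x => ‖g x - h x‖) μ := (hg.sub hh).norm
  rw [← integral_add h1 h2]
  exact integral_mono (hf.sub hh).norm (h1.add h2)
    fun x => norm_sub_le_norm_sub_add_norm_sub _ _ _

lemma exists_limit_of_cauchy_integral {α F : Type*} [MeasurableSpace α] {μ : Measure α}
    [NormedAddCommGroup F] [CompleteSpace F] {f : ℕ → α → F} (hf : ∀ n, Integrable (f n) μ)
    (hc : ∀ ε > 0, ∃ N, ∀ n ≥ N, ∀ k ≥ N, ∫ x, ‖f n x - f k x‖ ∂μ ≤ ε) :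
    ∃ g, Integrable g μ ∧ Tendsto (fun n => ∫ x, ‖f n x - g x‖ ∂μ) atTop (𝓝 0) := by
  set F' : ℕ → Lp F 1 μ := fun n => (hf n).toL1
  have hd : ∀ n k, dist (F' n) (F' k) = ∫ x, ‖f n x - f k x‖ ∂μ := fun n k => by
    rw [dist_eq_norm, ← Integrable.toL1_sub _ _ (hf n) (hf k), L1.norm_of_fun_eq_integral_norm]
    rfl
  have hcs : CauchySeq F' := by
    refine Metric.cauchySeq_iff.2 fun ε hε => ?_
    obtain ⟨N, hN⟩ := hc (ε / 2) (half_pos hε)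
    exact ⟨N, fun n hn k hk => by rw [hd]; linarith [hN n hn k hk]⟩
  obtain ⟨g, hg⟩ := cauchySeq_tendsto_of_complete hcs
  refine ⟨g, L1.integrable_coeFn g, ?_⟩
  have h1 := tendsto_iff_dist_tendsto_zero.1 hg
  refine h1.congr fun n => ?_
  rw [dist_eq_norm, L1.norm_eq_integral_norm]
  refine integral_congr_ae ?_
  filter_upwards [Lp.coeFn_sub (F' n) g, (hf n).coeFn_toL1] with x h2 h3
  rw [h2, Pi.sub_apply, h3]

/-- A sequence that is bounded in `W^{1,p}(Ω)`, and whose cell averages converge, is Cauchy in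
`L¹(Ω)`. -/
lemma cauchy_integral_of_tendsto_cellValue (hΩ : IsOpen Ω) (hΩf : volume Ω ≠ ⊤) {p : ℝ}
    (hp : 1 < p) {C : ℝ} {u : ℕ → Plane → ℝ} {G : ℕ → Plane → Plane}
    (hW : ∀ n, IsW1 Ω (ENNReal.ofReal p) (u n) (G n)) (hu : ∀ n, ∫ x in Ω, |u n x| ^ p ≤ C)
    (hG : ∀ n, ∫ x in Ω, ‖G n x‖ ≤ C) {B : ℕ → ℝ} (hB : ∀ n m i, |cellValue Ω (u n) m i| ≤ B m)
    {a : ℕ → ℤ × ℤ → ℝ}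
    (ha' : ∀ m i, Tendsto (fun n => cellValue Ω (u n) m i) atTop (𝓝 (a m i))) {ε : ℝ}
    (hε : 0 < ε) : ∃ N, ∀ n ≥ N, ∀ k ≥ N, ∫ x in Ω, ‖u n x - u k x‖ ≤ ε := by
  have hfin : IsFiniteMeasure (volume.restrict Ω) := ⟨by simpa using hΩf.lt_top⟩
  have hp1 : 1 ≤ ENNReal.ofReal p := by
    rw [← ENNReal.ofReal_one]; exact ENNReal.ofReal_le_ofReal hp.le
  have hui : ∀ n, IntegrableOn (u n) Ω := fun n => (hW n).integrableOn hΩf hp1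
  obtain ⟨m, hm⟩ := exists_integral_sub_cellAverage_le hΩ hΩf hp C
    (show 0 < ε / 4 by positivity)
  have happ := fun n => hm m le_rfl _ _ (hW n) (hu n) (hG n)
  set g : Plane → ℝ := fun x => a m (cellIndex m x)
  have hgm : Measurable g :=
    (measurable_of_countable (a m)).comp (measurable_cellIndex m)
  have hav := fun n => integrableOn_cellAverage hΩf (hui n) m
  have hgb : ∀ x, |g x| ≤ B m := fun x =>
    le_of_tendsto (ha' m (cellIndex m x)).abs (Eventually.of_forall fun n => hB _ _ _)
  have hgi : IntegrableOn g Ω :=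
    Integrable.mono' (integrable_const (B m)) hgm.aestronglyMeasurable (ae_of_all _ hgb)
  have hconv : Tendsto (fun n => ∫ x in Ω, ‖cellAverage Ω m (u n) x - g x‖) atTop
      (𝓝 (∫ x in Ω, (0 : ℝ))) := by
    refine tendsto_integral_of_dominated_convergence (fun _ => 2 * B m)
      (fun n => ((hav n).sub hgi).norm.aestronglyMeasurable) (integrable_const _)
      (fun n => ae_of_all _ fun x => ?_) (ae_of_all _ fun x => ?_)
    · rw [norm_norm]
      refine (norm_sub_le _ _).trans ?_
      have h1 := hB n m (cellIndex m x)
      have h2 := hgb x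
      rw [Real.norm_eq_abs, Real.norm_eq_abs]
      unfold cellAverage
      linarith
    · have h1 := ((ha' m (cellIndex m x)).sub_const (g x)).norm
      rwa [show a m (cellIndex m x) - g x = 0 from sub_self _, norm_zero] at h1
  rw [integral_zero] at hconv
  obtain ⟨N, hN⟩ := eventually_atTop.1
    (hconv.eventually_le_const (show 0 < ε / 4 by positivity))
  have hone : ∀ n ≥ N, ∫ x in Ω, ‖u n x - g x‖ ≤ ε / 2 := fun n hn => by
    have h3 := integral_norm_sub_le (hui n) (hav n) hgi
    linarith [happ n, hN n hn]
  refine ⟨N, fun n hn k hk => ?_⟩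
  have h3 := integral_norm_sub_le (hui n) hgi (hui k)
  have h4 : ∫ x in Ω, ‖g x - u k x‖ = ∫ x in Ω, ‖u k x - g x‖ :=
    integral_congr_ae (ae_of_all _ fun x => norm_sub_rev _ _)
  linarith [hone n hn, hone k hk]

/-- **Rellich's theorem**: bounded sequences in `W^{1,p}(Ω)`, `p > 1`, have subsequences that converge
in `L¹(Ω)`; no regularity of the boundary is needed. -/
theorem exists_subseq_tendsto_of_bounded (hΩ : IsOpen Ω) (hΩf : volume Ω ≠ ⊤) {p : ℝ} (hp : 1 < p)
    {C : ℝ} {u : ℕ → Plane → ℝ} {G : ℕ → Plane → Plane}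
    (hW : ∀ n, IsW1 Ω (ENNReal.ofReal p) (u n) (G n)) (hu : ∀ n, ∫ x in Ω, |u n x| ^ p ≤ C)
    (hG : ∀ n, ∫ x in Ω, ‖G n x‖ ≤ C) :
    ∃ (ns : ℕ → ℕ) (w : Plane → ℝ), StrictMono ns ∧ IntegrableOn w Ω ∧
      Tendsto (fun n => ∫ x in Ω, ‖u (ns n) x - w x‖) atTop (𝓝 0) := by
  have hfin : IsFiniteMeasure (volume.restrict Ω) := ⟨by simpa using hΩf.lt_top⟩
  have hp1 : 1 ≤ ENNReal.ofReal p := by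
    rw [← ENNReal.ofReal_one]; exact ENNReal.ofReal_le_ofReal hp.le
  have hui : ∀ n, IntegrableOn (u n) Ω := fun n => (hW n).integrableOn hΩf hp1
  have hupi : ∀ n, IntegrableOn (fun x => |u n x| ^ p) Ω := fun n => by
    have := (hW n).memLp.integrable_norm_rpow (by simp; linarith) ENNReal.ofReal_ne_top
    rwa [ENNReal.toReal_ofReal (by linarith)] at this
  have hL1 : ∀ n, ∫ x in Ω, |u n x| ≤ volume.real Ω + C := by
    intro n
    refine (integral_mono (hui n).abs ((integrable_const 1).add (hupi n)) fun x => ?_).trans ?_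
    · have hnn : 0 ≤ |u n x| ^ p := by positivity
      simp only [Pi.add_apply]
      rcases le_total |u n x| 1 with h | h
      · linarith
      · have := Real.rpow_le_rpow_of_exponent_le h hp.le
        rw [Real.rpow_one] at this
        linarith
    · simp only [Pi.add_apply]
      rw [integral_add (integrable_const 1) (hupi n), setIntegral_const, smul_eq_mul, mul_one]
      linarith [hu n]
  set B : ℕ → ℝ := fun m =>
    ((1 / (2 * (m + 1))) ^ 2 * volume.real (ball (0 : Plane) 1))⁻¹ * (volume.real Ω + C)
  have hB : ∀ n m i, |cellValue Ω (u n) m i| ≤ B m := fun n m i => by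
    refine (abs_cellValue_le (hui n) m i).trans ?_
    have := hL1 n
    simp only [B]
    gcongr
  -- all the cell averages form a point of a countable product of compact intervals, which is
  -- sequentially compact
  set K : ℕ × ℤ × ℤ → Set ℝ := fun j => Icc (-B j.1) (B j.1)
  have hK : IsCompact (univ.pi K) := isCompact_univ_pi fun j => isCompact_Icc
  set X : ℕ → ℕ × ℤ × ℤ → ℝ := fun n j => cellValue Ω (u n) j.1 j.2
  have hX : ∀ n, X n ∈ univ.pi K := fun n j _ => abs_le.1 (hB n j.1 j.2)
  obtain ⟨a, -, ns, hns, ha⟩ := hK.tendsto_subseq hX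
  have ha' : ∀ m i, Tendsto (fun n => cellValue Ω (u (ns n)) m i) atTop (𝓝 (a (m, i))) :=
    fun m i => tendsto_pi_nhds.1 ha (m, i)
  obtain ⟨w, hw, hlim⟩ := exists_limit_of_cauchy_integral (f := fun n => u (ns n))
    (μ := volume.restrict Ω) (fun n => hui (ns n)) fun ε hε =>
      cauchy_integral_of_tendsto_cellValue hΩ hΩf hp (fun n => hW (ns n)) (fun n => hu (ns n))
        (fun n => hG (ns n)) (fun n => hB (ns n)) (a := fun m i => a (m, i)) ha' hε
  exact ⟨ns, w, hns, hw, hlim⟩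

end Rellich

/-! ### The monotone vector field `ρ_τ(|ξ|²) ξ` and its potential -/

section Flux

/-- The regularized length `√(|ξ|² + τ)`. -/
noncomputable def regNorm (τ : ℝ) (ξ : Plane) : ℝ := √(‖ξ‖ ^ 2 + τ)

/-- The vector field `ρ_τ(|ξ|²) ξ`. -/
noncomputable def flux (p β τ : ℝ) (ξ : Plane) : Plane := rho p β τ (‖ξ‖ ^ 2) • ξ

/-- The convex potential of `flux`. -/
noncomputable def potential (p β τ : ℝ) (ξ : Plane) : ℝ :=
  regNorm τ ξ ^ p / p + β * regNorm τ ξ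

variable {p β τ : ℝ}

lemma regNorm_sq (hτ : 0 < τ) (ξ : Plane) : regNorm τ ξ ^ 2 = ‖ξ‖ ^ 2 + τ :=
  Real.sq_sqrt (by positivity)

lemma regNorm_pos (hτ : 0 < τ) (ξ : Plane) : 0 < regNorm τ ξ := Real.sqrt_pos.2 (by positivity)

lemma norm_le_regNorm (hτ : 0 < τ) (ξ : Plane) : ‖ξ‖ ≤ regNorm τ ξ :=
  Real.le_sqrt_of_sq_le (by linarith)

lemma regNorm_le (hτ : 0 < τ) (hτ' : τ ≤ 1) (ξ : Plane) : regNorm τ ξ ≤ ‖ξ‖ + 1 := by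
  refine Real.sqrt_le_iff.2 ⟨by positivity, ?_⟩
  nlinarith [norm_nonneg ξ]

lemma continuous_regNorm (τ : ℝ) : Continuous (regNorm τ) := by unfold regNorm; fun_prop

lemma rho_eq (hτ : 0 < τ) (ξ : Plane) :
    rho p β τ (‖ξ‖ ^ 2) = regNorm τ ξ ^ (p - 2) + β / regNorm τ ξ := by
  have h0 : 0 ≤ ‖ξ‖ ^ 2 + τ := by positivity
  unfold rho regNorm
  rw [Real.sqrt_eq_rpow, ← Real.rpow_mul h0, div_eq_mul_inv β, ← Real.rpow_neg h0]
  congr 2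
  ring

lemma continuous_flux (hτ : 0 < τ) : Continuous (flux p β τ) := by
  unfold flux
  simp_rw [rho_eq hτ]
  have h := continuous_regNorm τ
  have h1 : Continuous fun ξ => regNorm τ ξ ^ (p - 2) :=
    h.rpow_const fun ξ => Or.inl (regNorm_pos hτ ξ).ne'
  have h2 : Continuous fun ξ => β / regNorm τ ξ :=
    continuous_const.div h fun ξ => (regNorm_pos hτ ξ).ne'
  exact (h1.add h2).smul continuous_id

lemma continuous_potential (hp : 0 < p) : Continuous (potential p β τ) := by
  unfold potential
  have h := continuous_regNorm τ
  exact ((h.rpow_const fun ξ => Or.inr hp.le).div_const p).add (h.const_mul β)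

lemma flux_neg (ξ : Plane) : flux p β τ (-ξ) = -flux p β τ ξ := by simp [flux]

lemma rho_nonneg (hτ : 0 < τ) (hβ : 0 < β) (ξ : Plane) : 0 ≤ rho p β τ (‖ξ‖ ^ 2) := by
  rw [rho_eq hτ]
  have := regNorm_pos hτ ξ
  positivity

lemma inner_flux_nonneg (hτ : 0 < τ) (hβ : 0 < β) (ξ : Plane) :
    0 ≤ inner ℝ (flux p β τ ξ) ξ := by
  rw [flux, real_inner_smul_left, real_inner_self_eq_norm_sq]
  exact mul_nonneg (rho_nonneg hτ hβ ξ) (sq_nonneg _)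

/-- The singular part of the flux controls the length of `ξ` linearly, whatever `p` is. -/
lemma le_inner_flux (hτ : 0 < τ) (hβ : 0 < β) (ξ : Plane) :
    β * (‖ξ‖ - √τ) ≤ inner ℝ (flux p β τ ξ) ξ := by
  rw [flux, real_inner_smul_left, real_inner_self_eq_norm_sq, rho_eq hτ]
  have hx := regNorm_pos hτ ξ
  have h1 : ‖ξ‖ - √τ ≤ ‖ξ‖ ^ 2 / regNorm τ ξ := by
    rw [le_div_iff₀ hx]
    have h2 : regNorm τ ξ ≤ ‖ξ‖ + √τ := by
      refine Real.sqrt_le_iff.2 ⟨by positivity, ?_⟩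
      nlinarith [norm_nonneg ξ, Real.sqrt_nonneg τ, Real.sq_sqrt hτ.le,
        mul_nonneg (norm_nonneg ξ) (Real.sqrt_nonneg τ)]
    rcases le_total ‖ξ‖ (√τ) with h | h
    · nlinarith [sq_nonneg ‖ξ‖]
    · nlinarith [Real.sq_sqrt hτ.le]
  have h3 : 0 ≤ regNorm τ ξ ^ (p - 2) * ‖ξ‖ ^ 2 := by positivity
  have h4 := mul_le_mul_of_nonneg_left h1 hβ.le
  calc β * (‖ξ‖ - √τ) ≤ β * (‖ξ‖ ^ 2 / regNorm τ ξ) := h4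
    _ ≤ regNorm τ ξ ^ (p - 2) * ‖ξ‖ ^ 2 + β * (‖ξ‖ ^ 2 / regNorm τ ξ) := by linarith
    _ = _ := by ring

lemma norm_flux_le (hτ : 0 < τ) (hβ : 0 < β) (ξ : Plane) :
    ‖flux p β τ ξ‖ ≤ regNorm τ ξ ^ (p - 1) + β := by
  have hx := regNorm_pos hτ ξ
  rw [flux, norm_smul, Real.norm_of_nonneg (rho_nonneg hτ hβ ξ)]
  refine (mul_le_mul_of_nonneg_left (norm_le_regNorm hτ ξ) (rho_nonneg hτ hβ ξ)).trans_eq ?_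
  rw [rho_eq hτ, add_mul, div_mul_cancel₀ _ hx.ne']
  congr 1
  nth_rewrite 2 [← Real.rpow_one (regNorm τ ξ)]
  rw [← Real.rpow_add hx]
  congr 1; ring

/-- The quantitative form of the strict convexity of `regNorm`; the right-hand side does not exceed
the defect in the triangle inequality for the vectors `(a, √τ)` and `(b, √τ)`. -/
lemma four_mul_le_sub_sq (hτ : 0 < τ) (a b : Plane) :
    4 * τ * ‖a - b‖ ^ 2 ≤
      (‖a - b‖ ^ 2 - (regNorm τ a - regNorm τ b) ^ 2) * (regNorm τ a + regNorm τ b) ^ 2 := by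
  set x := regNorm τ a
  set y := regNorm τ b
  set d := ‖a - b‖
  have hx : x ^ 2 = ‖a‖ ^ 2 + τ := regNorm_sq hτ a
  have hy : y ^ 2 = ‖b‖ ^ 2 + τ := regNorm_sq hτ b
  have hx0 : 0 < x := regNorm_pos hτ a
  have hy0 : 0 < y := regNorm_pos hτ b
  have hd : |‖a‖ - ‖b‖| ≤ d := abs_norm_sub_norm_le a b
  have h1 : (‖a‖ - ‖b‖) ^ 2 ≤ d ^ 2 := sq_le_sq' (by linarith [(abs_le.1 hd).1]) (abs_le.1 hd).2
  have h2 : ‖a‖ * ‖b‖ + τ ≤ x * y := by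
    have h3 : (‖a‖ * ‖b‖ + τ) ^ 2 ≤ (x * y) ^ 2 := by
      rw [mul_pow, hx, hy]
      nlinarith [mul_nonneg hτ.le (sq_nonneg (‖a‖ - ‖b‖))]
    exact (abs_le_of_sq_le_sq' h3 (by positivity)).2
  have h4 : (‖a‖ + ‖b‖) ^ 2 + 4 * τ ≤ (x + y) ^ 2 := by nlinarith
  have h5 : ((x - y) * (x + y)) ^ 2 = ((‖a‖ - ‖b‖) * (‖a‖ + ‖b‖)) ^ 2 := by
    congr 1
    linear_combination hx - hy
  have h6 : (x - y) ^ 2 * (x + y) ^ 2 ≤ d ^ 2 * (‖a‖ + ‖b‖) ^ 2 := by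
    rw [← mul_pow, h5, mul_pow]
    exact mul_le_mul_of_nonneg_right h1 (sq_nonneg _)
  have h7 := mul_le_mul_of_nonneg_left h4 (sq_nonneg d)
  nlinarith

/-- The modulus by which both the monotonicity of `flux` and the convexity of `potential` are
measured. -/
noncomputable def gap (τ : ℝ) (a b : Plane) : ℝ :=
  ‖a - b‖ ^ 2 / (regNorm τ a + regNorm τ b) ^ 3

lemma gap_nonneg (hτ : 0 < τ) (a b : Plane) : 0 ≤ gap τ a b := by
  have h1 := regNorm_pos hτ a
  have h2 := regNorm_pos hτ b
  unfold gap; positivity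

/-- Monotonicity of the power part of the flux, by reduction to the radial functions. -/
lemma inner_rpow_smul_sub_nonneg (hτ : 0 < τ) (hp : 1 < p) (a b : Plane) :
    0 ≤ inner ℝ (regNorm τ a ^ (p - 2) • a - regNorm τ b ^ (p - 2) • b) (a - b) := by
  set x := regNorm τ a
  set y := regNorm τ b
  have hx0 : 0 < x := regNorm_pos hτ a
  have hy0 : 0 < y := regNorm_pos hτ b
  have e1 : inner ℝ (x ^ (p - 2) • a - y ^ (p - 2) • b) (a - b) =
      x ^ (p - 2) * ‖a‖ ^ 2 + y ^ (p - 2) * ‖b‖ ^ 2 -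
        (x ^ (p - 2) + y ^ (p - 2)) * inner ℝ a b := by
    simp only [inner_sub_left, inner_sub_right, real_inner_smul_left, real_inner_self_eq_norm_sq,
      real_inner_comm a b]
    ring
  have hX : 0 ≤ x ^ (p - 2) := by positivity
  have hY : 0 ≤ y ^ (p - 2) := by positivity
  have e2 : (x ^ (p - 2) + y ^ (p - 2)) * inner ℝ a b ≤
      (x ^ (p - 2) + y ^ (p - 2)) * (‖a‖ * ‖b‖) :=
    mul_le_mul_of_nonneg_left (real_inner_le_norm a b) (by positivity)
  have hmono : ∀ s t : ℝ, 0 ≤ s → s ≤ t →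
      √(s ^ 2 + τ) ^ (p - 2) * s ≤ √(t ^ 2 + τ) ^ (p - 2) * t := by
    intro s t hs hst
    have hs1 : 0 < √(s ^ 2 + τ) := Real.sqrt_pos.2 (by positivity)
    have ht1 : 0 < √(t ^ 2 + τ) := Real.sqrt_pos.2 (by positivity)
    have hle : √(s ^ 2 + τ) ≤ √(t ^ 2 + τ) := Real.sqrt_le_sqrt (by gcongr)
    have e3 : ∀ r : ℝ, 0 < √(r ^ 2 + τ) → √(r ^ 2 + τ) ^ (p - 2) * r =
        √(r ^ 2 + τ) ^ (p - 1) * (r / √(r ^ 2 + τ)) := fun r hr => by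
      rw [show p - 1 = (p - 2) + 1 by ring, Real.rpow_add_one hr.ne']
      field_simp
    rw [e3 s hs1, e3 t ht1]
    have h4 : s / √(s ^ 2 + τ) ≤ t / √(t ^ 2 + τ) := by
      rw [div_le_div_iff₀ hs1 ht1]
      have h5 : (s * √(t ^ 2 + τ)) ^ 2 ≤ (t * √(s ^ 2 + τ)) ^ 2 := by
        rw [mul_pow, mul_pow, Real.sq_sqrt (by positivity), Real.sq_sqrt (by positivity)]
        have : s ^ 2 ≤ t ^ 2 := by gcongr
        nlinarith
      exact (abs_le_of_sq_le_sq' h5 (mul_nonneg (hs.trans hst) hs1.le)).2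
    have h6 : √(s ^ 2 + τ) ^ (p - 1) ≤ √(t ^ 2 + τ) ^ (p - 1) :=
      Real.rpow_le_rpow hs1.le hle (by linarith)
    exact mul_le_mul h6 h4 (by positivity) (by positivity)
  have h7 : 0 ≤ (x ^ (p - 2) * ‖a‖ - y ^ (p - 2) * ‖b‖) * (‖a‖ - ‖b‖) := by
    rcases le_total ‖a‖ ‖b‖ with h | h
    · exact mul_nonneg_of_nonpos_of_nonpos
        (sub_nonpos.2 (hmono _ _ (norm_nonneg a) h)) (sub_nonpos.2 h)
    · exact mul_nonneg (sub_nonneg.2 (hmono _ _ (norm_nonneg b) h)) (sub_nonneg.2 h)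
  rw [e1]
  nlinarith

/-- Strict monotonicity of the flux. -/
lemma le_inner_flux_sub (hτ : 0 < τ) (hβ : 0 < β) (hp : 1 < p) (a b : Plane) :
    2 * β * τ * gap τ a b ≤ inner ℝ (flux p β τ a - flux p β τ b) (a - b) := by
  have h0 := inner_rpow_smul_sub_nonneg hτ hp a b
  have h1 := four_mul_le_sub_sq hτ a b
  have hx : regNorm τ a ^ 2 = ‖a‖ ^ 2 + τ := regNorm_sq hτ a
  have hy : regNorm τ b ^ 2 = ‖b‖ ^ 2 + τ := regNorm_sq hτ b
  have hx0 : 0 < regNorm τ a := regNorm_pos hτ a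
  have hy0 : 0 < regNorm τ b := regNorm_pos hτ b
  have e1 : inner ℝ (flux p β τ a - flux p β τ b) (a - b) =
      inner ℝ (regNorm τ a ^ (p - 2) • a - regNorm τ b ^ (p - 2) • b) (a - b) +
        β * (‖a‖ ^ 2 / regNorm τ a + ‖b‖ ^ 2 / regNorm τ b -
          (1 / regNorm τ a + 1 / regNorm τ b) * inner ℝ a b) := by
    simp only [flux, rho_eq hτ, inner_sub_left, inner_sub_right, real_inner_smul_left,
      real_inner_self_eq_norm_sq, real_inner_comm a b]
    ring
  have hd : ‖a - b‖ ^ 2 = ‖a‖ ^ 2 - 2 * inner ℝ a b + ‖b‖ ^ 2 := norm_sub_sq_real a b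
  rw [e1]
  unfold gap
  generalize regNorm τ a = x at *
  generalize regNorm τ b = y at *
  generalize ‖a - b‖ = d at *
  have e2 : ‖a‖ ^ 2 / x + ‖b‖ ^ 2 / y - (1 / x + 1 / y) * inner ℝ a b =
      (d ^ 2 - (x - y) ^ 2) * (x + y) / (2 * (x * y)) := by
    have ha : ‖a‖ ^ 2 = x ^ 2 - τ := by linarith
    have hb : ‖b‖ ^ 2 = y ^ 2 - τ := by linarith
    have hi : inner ℝ a b = (x ^ 2 + y ^ 2 - 2 * τ - d ^ 2) / 2 := by linarith
    rw [ha, hb, hi]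
    field_simp
    ring
  have h2 : 2 * τ * (d ^ 2 / (x + y) ^ 3) ≤ (d ^ 2 - (x - y) ^ 2) * (x + y) / (2 * (x * y)) := by
    rw [le_div_iff₀ (by positivity), mul_div_assoc', div_mul_eq_mul_div, div_le_iff₀ (by positivity)]
    have h3 : x * y ≤ (x + y) ^ 2 := by nlinarith
    have h4 : 2 * τ * d ^ 2 * (2 * (x * y)) ≤ 4 * τ * d ^ 2 * (x + y) ^ 2 := by
      have := mul_le_mul_of_nonneg_left h3 (by positivity : 0 ≤ 4 * τ * d ^ 2)
      linarith
    have h5 := mul_le_mul_of_nonneg_right h1 (sq_nonneg (x + y))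
    nlinarith
  rw [e2]
  have h6 := mul_le_mul_of_nonneg_left h2 hβ.le
  linarith

lemma half_add_half_rpow_le (hp : 1 ≤ p) {x y : ℝ} (hx : 0 ≤ x) (hy : 0 ≤ y) :
    (1 / 2 * x + 1 / 2 * y) ^ p ≤ 1 / 2 * x ^ p + 1 / 2 * y ^ p := by
  simpa using (convexOn_rpow hp).2 (mem_Ici.2 hx) (mem_Ici.2 hy) (by norm_num : (0 : ℝ) ≤ 1 / 2)
    (by norm_num : (0 : ℝ) ≤ 1 / 2) (by norm_num)

/-- Strict midpoint convexity of the potential. -/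
lemma potential_midpoint (hτ : 0 < τ) (hβ : 0 < β) (hp : 1 < p) (a b : Plane) :
    potential p β τ ((1 / 2 : ℝ) • (a + b)) + β * τ * gap τ a b ≤
      (potential p β τ a + potential p β τ b) / 2 := by
  have h1 := four_mul_le_sub_sq hτ a b
  have hx : regNorm τ a ^ 2 = ‖a‖ ^ 2 + τ := regNorm_sq hτ a
  have hy : regNorm τ b ^ 2 = ‖b‖ ^ 2 + τ := regNorm_sq hτ b
  have hn : regNorm τ ((1 / 2 : ℝ) • (a + b)) ^ 2 = ‖a + b‖ ^ 2 / 4 + τ := by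
    rw [regNorm_sq hτ, norm_smul, mul_pow]
    norm_num
    ring
  have hx0 : 0 < regNorm τ a := regNorm_pos hτ a
  have hy0 : 0 < regNorm τ b := regNorm_pos hτ b
  have hn0 : 0 < regNorm τ ((1 / 2 : ℝ) • (a + b)) := regNorm_pos hτ _
  have hd : ‖a - b‖ ^ 2 = ‖a‖ ^ 2 - 2 * inner ℝ a b + ‖b‖ ^ 2 := norm_sub_sq_real a b
  have hs : ‖a + b‖ ^ 2 = ‖a‖ ^ 2 + 2 * inner ℝ a b + ‖b‖ ^ 2 := norm_add_sq_real a b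
  unfold potential gap
  generalize regNorm τ a = x at *
  generalize regNorm τ b = y at *
  generalize regNorm τ ((1 / 2 : ℝ) • (a + b)) = n at *
  generalize ‖a - b‖ = d at *
  have e1 : (x + y) ^ 2 - 4 * n ^ 2 = d ^ 2 - (x - y) ^ 2 := by
    rw [hn]; linarith
  have hpos : 0 ≤ d ^ 2 - (x - y) ^ 2 := by
    have h2 : 0 ≤ (d ^ 2 - (x - y) ^ 2) * (x + y) ^ 2 := le_trans (by positivity) h1
    exact nonneg_of_mul_nonneg_left h2 (by positivity)
  have hnle : 2 * n ≤ x + y :=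
    (abs_le_of_sq_le_sq' (by linarith : (2 * n) ^ 2 ≤ (x + y) ^ 2) (by positivity)).2
  have h2 : 2 * τ * (d ^ 2 / (x + y) ^ 3) ≤ x + y - 2 * n := by
    rw [mul_div_assoc', div_le_iff₀ (by positivity)]
    have h3 : d ^ 2 - (x - y) ^ 2 ≤ (x + y - 2 * n) * (2 * (x + y)) := by
      rw [← e1, show (x + y) ^ 2 - 4 * n ^ 2 = (x + y - 2 * n) * (x + y + 2 * n) by ring]
      exact mul_le_mul_of_nonneg_left (by linarith) (by linarith)
    have h4 := mul_le_mul_of_nonneg_right h3 (sq_nonneg (x + y))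
    nlinarith
  have h5 : n ^ p ≤ (x ^ p + y ^ p) / 2 := by
    have h6 : n ^ p ≤ (1 / 2 * x + 1 / 2 * y) ^ p :=
      Real.rpow_le_rpow hn0.le (by linarith) (by linarith)
    have h7 := half_add_half_rpow_le hp.le hx0.le hy0.le
    linarith
  have h8 := mul_le_mul_of_nonneg_left h2 hβ.le
  have h9 : n ^ p / p ≤ (x ^ p / p + y ^ p / p) / 2 := by
    rw [← add_div, div_div, mul_comm p 2, ← div_div]
    exact div_le_div_of_nonneg_right h5 (by linarith)
  linarith

/-- The modulus `gap` controls the distance, up to an error that is small with respect to the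
`p`-th powers of the lengths. -/
lemma exists_norm_sub_le_gap (hτ : 0 < τ) (hp : 1 < p) {ε : ℝ} (hε : 0 < ε) :
    ∃ C : ℝ, 0 ≤ C ∧ ∀ a b : Plane,
      ‖a - b‖ ≤ ε * (1 + regNorm τ a ^ p + regNorm τ b ^ p) + C * gap τ a b := by
  have h2p : (0 : ℝ) < 2 ^ p := by positivity
  set ε' := ε / 2 ^ p with hε'
  have hε'0 : 0 < ε' := by positivity
  obtain ⟨R, hR0, hR⟩ : ∃ R : ℝ, 0 < R ∧ R ^ (1 - p) ≤ ε' := by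
    obtain ⟨R, h2, h3⟩ := (((tendsto_rpow_neg_atTop (sub_pos.2 hp)).eventually_le_const
      hε'0).and (eventually_gt_atTop 0)).exists
    exact ⟨R, h3, by rwa [neg_sub] at h2⟩
  refine ⟨R ^ 3 / (4 * ε), by positivity, fun a b => ?_⟩
  have hx0 : 0 < regNorm τ a := regNorm_pos hτ a
  have hy0 : 0 < regNorm τ b := regNorm_pos hτ b
  have hd : ‖a - b‖ ≤ regNorm τ a + regNorm τ b :=
    (norm_sub_le a b).trans (add_le_add (norm_le_regNorm hτ a) (norm_le_regNorm hτ b))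
  have hd0 := norm_nonneg (a - b)
  unfold gap
  generalize regNorm τ a = x at *
  generalize regNorm τ b = y at *
  generalize ‖a - b‖ = d at *
  have hxp : 0 ≤ x ^ p := by positivity
  have hyp : 0 ≤ y ^ p := by positivity
  rcases le_total (x + y) R with h | h
  · have h1 : d ≤ ε + d ^ 2 / (4 * ε) := by
      have : d * (4 * ε) ≤ 4 * ε ^ 2 + d ^ 2 := by nlinarith [sq_nonneg (d - 2 * ε)]
      have h2 : ε + d ^ 2 / (4 * ε) = (4 * ε ^ 2 + d ^ 2) / (4 * ε) := by field_simp
      rw [h2, le_div_iff₀ (by positivity)]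
      exact this
    have h2 : d ^ 2 / (4 * ε) ≤ R ^ 3 / (4 * ε) * (d ^ 2 / (x + y) ^ 3) := by
      rw [div_mul_div_comm, div_le_div_iff₀ (by positivity) (by positivity)]
      have h3 : (x + y) ^ 3 ≤ R ^ 3 := by gcongr
      have := mul_le_mul_of_nonneg_left h3 (by positivity : 0 ≤ d ^ 2 * (4 * ε))
      linarith
    have h3 : 0 ≤ ε * (x ^ p + y ^ p) := by positivity
    linarith
  · have hs0 : 0 < x + y := by positivity
    have h1 : x + y ≤ ε' * (x + y) ^ p := by
      have h2 : (x + y) ^ (1 - p) ≤ ε' :=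
        (Real.rpow_le_rpow_of_nonpos hR0 h (by linarith)).trans hR
      calc x + y = (x + y) ^ (1 - p) * (x + y) ^ p := by
            rw [← Real.rpow_add hs0]; simp
        _ ≤ ε' * (x + y) ^ p := by gcongr
    have h2 : (x + y) ^ p ≤ 2 ^ p * (x ^ p + y ^ p) := by
      have h7 := half_add_half_rpow_le hp.le hx0.le hy0.le
      have h8 : (x + y) ^ p = 2 ^ p * (1 / 2 * x + 1 / 2 * y) ^ p := by
        rw [← Real.mul_rpow (by norm_num) (by positivity)]; congr 1; ring
      rw [h8]
      refine mul_le_mul_of_nonneg_left (h7.trans ?_) h2p.le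
      linarith
    have h3 : ε' * (x + y) ^ p ≤ ε * (x ^ p + y ^ p) := by
      calc ε' * (x + y) ^ p ≤ ε' * (2 ^ p * (x ^ p + y ^ p)) := by gcongr
        _ = ε * (x ^ p + y ^ p) := by rw [hε']; field_simp
    have h4 : 0 ≤ R ^ 3 / (4 * ε) * (d ^ 2 / (x + y) ^ 3) := by positivity
    linarith

lemma hasDerivAt_potential (hτ : 0 < τ) (hp : 1 < p) (a b : Plane) (t : ℝ) :
    HasDerivAt (fun t : ℝ => potential p β τ (a + t • b))
      (inner ℝ (flux p β τ (a + t • b)) b) t := by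
  set ξ := a + t • b
  have hx := regNorm_pos hτ ξ
  have h1 : HasDerivAt (fun t : ℝ => a + t • b) b t := by
    simpa using ((hasDerivAt_id t).smul_const b).const_add a
  have h2 : HasDerivAt (fun t : ℝ => ‖a + t • b‖ ^ 2 + τ) (2 * inner ℝ ξ b) t :=
    h1.norm_sq.add_const τ
  have h3 : HasDerivAt (fun t : ℝ => regNorm τ (a + t • b))
      (2 * inner ℝ ξ b / (2 * √(‖ξ‖ ^ 2 + τ))) t :=
    h2.sqrt (by positivity)
  have h4 := (h3.rpow_const (p := p) (Or.inl hx.ne')).div_const p |>.add (h3.const_mul β)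
  refine h4.congr_deriv ?_
  have h5 : √(‖ξ‖ ^ 2 + τ) = regNorm τ ξ := rfl
  rw [flux, real_inner_smul_left, rho_eq hτ, h5, show p - 1 = (p - 2) + 1 by ring,
    Real.rpow_add_one hx.ne']
  have hp0 : p ≠ 0 := by linarith
  field_simp

end Flux

/-! ### Minimization of the energy -/

section Energy

variable {p β τ : ℝ} {Ω : Set Plane}

lemma one_le_ofReal (hp : 1 < p) : 1 ≤ ENNReal.ofReal p := by
  rw [← ENNReal.ofReal_one]; exact ENNReal.ofReal_le_ofReal hp.le

lemma rpow_sub_one_mul_le (hp : 1 < p) {x y z : ℝ} (hx : 0 ≤ x) (hy : 0 ≤ y) (hxz : x ≤ z)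
    (hyz : y ≤ z) : x ^ (p - 1) * y ≤ z ^ p := by
  have hz : 0 ≤ z := hx.trans hxz
  rcases hz.eq_or_lt with rfl | hz0
  · rw [le_antisymm hyz hy, mul_zero]
    positivity
  · calc x ^ (p - 1) * y ≤ z ^ (p - 1) * z := by
          have := Real.rpow_le_rpow hx hxz (by linarith : 0 ≤ p - 1)
          gcongr
      _ = z ^ p := by rw [← Real.rpow_add_one hz0.ne']; simp

lemma le_one_add_rpow (hp : 1 < p) {t : ℝ} (ht : 0 ≤ t) : t ≤ 1 + t ^ p := by
  rcases le_total t 1 with h | h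
  · have : 0 ≤ t ^ p := by positivity
    linarith
  · have := Real.rpow_le_rpow_of_exponent_le h hp.le
    rw [Real.rpow_one] at this
    linarith

lemma exists_mul_le_rpow_add (hp : 1 < p) {c M : ℝ} (hc : 0 < c) (hM : 0 ≤ M) :
    ∃ C, 0 ≤ C ∧ ∀ t, 0 ≤ t → M * t ≤ c * t ^ p + C := by
  obtain ⟨R, hR0, hR⟩ : ∃ R : ℝ, 0 < R ∧ M ≤ c * R ^ (p - 1) := by
    obtain ⟨R, h2, h3⟩ := (((tendsto_rpow_atTop (sub_pos.2 hp)).eventually_ge_atTop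
      (M / c)).and (eventually_gt_atTop 0)).exists
    exact ⟨R, h3, by rwa [div_le_iff₀' hc] at h2⟩
  refine ⟨M * R, by positivity, fun t ht => ?_⟩
  have h0 : 0 ≤ c * t ^ p := by positivity
  rcases le_total t R with h | h
  · have := mul_le_mul_of_nonneg_left h hM
    linarith
  · have ht0 : 0 < t := hR0.trans_le h
    have h1 : M ≤ c * t ^ (p - 1) := by
      have := Real.rpow_le_rpow hR0.le h (by linarith : 0 ≤ p - 1)
      exact hR.trans (by gcongr)
    have h2 : M * t ≤ c * t ^ p := by
      calc M * t ≤ c * t ^ (p - 1) * t := by gcongr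
        _ = c * t ^ p := by rw [mul_assoc, ← Real.rpow_add_one ht0.ne']; simp
    have : 0 ≤ M * R := by positivity
    linarith

lemma memLp_rpow_integrable {α : Type*} [MeasurableSpace α] {μ : Measure α} (hp : 1 < p)
    {f : α → ℝ} (hf : MemLp f (ENNReal.ofReal p) μ) : Integrable (fun x => |f x| ^ p) μ := by
  have := hf.integrable_norm_rpow (by simp; linarith) ENNReal.ofReal_ne_top
  rwa [ENNReal.toReal_ofReal (by linarith)] at this

lemma memLp_of_integrable_rpow {α F : Type*} [MeasurableSpace α] [NormedAddCommGroup F]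
    {μ : Measure α} (hp : 1 < p) {f : α → F} (hf : AEStronglyMeasurable f μ)
    (h : Integrable (fun x => ‖f x‖ ^ p) μ) : MemLp f (ENNReal.ofReal p) μ := by
  refine (integrable_norm_rpow_iff hf (by simp; linarith) ENNReal.ofReal_ne_top).1 ?_
  rwa [ENNReal.toReal_ofReal (by linarith)]

section Measure

variable {α : Type*} [MeasurableSpace α] {μ : Measure α}

lemma integrable_regNorm_rpow [IsFiniteMeasure μ] {G : α → Plane} (hp : 1 < p) (hτ : 0 < τ)
    (hτ' : τ ≤ 1) (hG : MemLp G (ENNReal.ofReal p) μ) :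
    Integrable (fun x => regNorm τ (G x) ^ p) μ := by
  refine (memLp_rpow_integrable hp (hG.norm.add (memLp_const 1))).mono' ?_ (ae_of_all _ fun x => ?_)
  · exact (((continuous_regNorm τ).rpow_const fun ξ => Or.inl (regNorm_pos hτ ξ).ne')
      ).comp_aestronglyMeasurable hG.1
  · have h1 := regNorm_pos hτ (G x)
    rw [Real.norm_of_nonneg (by positivity)]
    exact Real.rpow_le_rpow h1.le ((regNorm_le hτ hτ' _).trans (le_abs_self _)) (by linarith)

lemma continuous_gap (hτ : 0 < τ) : Continuous fun z : Plane × Plane => gap τ z.1 z.2 := by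
  unfold gap
  have h := continuous_regNorm τ
  refine Continuous.div (by fun_prop) (by fun_prop) fun z => ?_
  have h1 := regNorm_pos hτ z.1
  have h2 := regNorm_pos hτ z.2
  positivity

lemma integrable_gap [IsFiniteMeasure μ] {G H : α → Plane} (hτ : 0 < τ)
    (hG : AEStronglyMeasurable G μ) (hH : AEStronglyMeasurable H μ) :
    Integrable (fun x => gap τ (G x) (H x)) μ := by
  have hm : AEStronglyMeasurable (fun x => gap τ (G x) (H x)) μ :=
    (continuous_gap hτ).comp_aestronglyMeasurable (g := fun z : Plane × Plane => gap τ z.1 z.2)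
      (f := fun x => (G x, H x)) (hG.prodMk hH)
  refine (integrable_const (1 / √τ)).mono' hm (ae_of_all _ fun x => ?_)
  rw [Real.norm_of_nonneg (gap_nonneg hτ _ _)]
  have hd : ‖G x - H x‖ ≤ regNorm τ (G x) + regNorm τ (H x) :=
    (norm_sub_le _ _).trans (add_le_add (norm_le_regNorm hτ _) (norm_le_regNorm hτ _))
  have h1 : √τ ≤ regNorm τ (G x) := Real.sqrt_le_sqrt (by nlinarith [sq_nonneg ‖G x‖])
  have h2 := regNorm_pos hτ (H x)
  have h3 : 0 < √τ := Real.sqrt_pos.2 hτ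
  unfold gap
  set s := regNorm τ (G x) + regNorm τ (H x)
  have hs : √τ ≤ s := by linarith
  have hs0 : 0 < s := by linarith
  rw [div_le_div_iff₀ (by positivity) h3, one_mul]
  have h4 : ‖G x - H x‖ ^ 2 ≤ s ^ 2 := by gcongr
  calc ‖G x - H x‖ ^ 2 * √τ ≤ s ^ 2 * s := by gcongr
    _ = s ^ 3 := by ring

/-- On a set bounded in `L^p` the functional `∫ gap` controls the distance in `L¹`. -/
lemma exists_integral_norm_sub_le_gap [IsFiniteMeasure μ] (hp : 1 < p) (hτ : 0 < τ) (hτ' : τ ≤ 1)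
    {ε : ℝ} (hε : 0 < ε) (B : ℝ) :
    ∃ C : ℝ, 0 ≤ C ∧ ∀ G H : α → Plane, MemLp G (ENNReal.ofReal p) μ →
      MemLp H (ENNReal.ofReal p) μ → ∫ x, regNorm τ (G x) ^ p ∂μ ≤ B →
      ∫ x, regNorm τ (H x) ^ p ∂μ ≤ B →
      ∫ x, ‖G x - H x‖ ∂μ ≤ ε + C * ∫ x, gap τ (G x) (H x) ∂μ := by
  set D := |μ.real univ + B + B| + 1
  have hD : 0 < D := by positivity
  obtain ⟨C, hC0, hC⟩ := exists_norm_sub_le_gap hτ hp (div_pos hε hD)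
  refine ⟨C, hC0, fun G H hG hH hGB hHB => ?_⟩
  have iG := integrable_regNorm_rpow hp hτ hτ' hG
  have iH := integrable_regNorm_rpow hp hτ hτ' hH
  have ig := integrable_gap hτ hG.1 hH.1
  have i1 : Integrable (fun x => 1 + regNorm τ (G x) ^ p + regNorm τ (H x) ^ p) μ :=
    ((integrable_const 1).add iG).add iH
  have h1 : ∫ x, ‖G x - H x‖ ∂μ ≤ ∫ x, (ε / D * (1 + regNorm τ (G x) ^ p + regNorm τ (H x) ^ p) +
      C * gap τ (G x) (H x)) ∂μ := by
    refine integral_mono_of_nonneg (ae_of_all _ fun x => norm_nonneg _)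
      ((i1.const_mul _).add (ig.const_mul _)) (ae_of_all _ fun x => hC _ _)
  have h2 : ∫ x, (1 + regNorm τ (G x) ^ p + regNorm τ (H x) ^ p) ∂μ =
      μ.real univ + (∫ x, regNorm τ (G x) ^ p ∂μ) + ∫ x, regNorm τ (H x) ^ p ∂μ := by
    rw [integral_add (f := fun x => 1 + regNorm τ (G x) ^ p) ((integrable_const 1).add iG) iH,
      integral_add (integrable_const 1) iG]
    simp
  rw [integral_add (i1.const_mul _) (ig.const_mul _), integral_const_mul, integral_const_mul,
    h2] at h1
  refine h1.trans (add_le_add_left ?_ _)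
  rw [div_mul_eq_mul_div, div_le_iff₀ hD]
  refine mul_le_mul_of_nonneg_left ?_ hε.le
  have := le_abs_self (μ.real univ + B + B)
  simp only [D]
  linarith

/-- Fatou's lemma for a sequence of nonnegative functions whose integrals are bounded by a
convergent sequence. -/
lemma integral_le_of_ae_tendsto {F : ℕ → α → ℝ} {F' : α → ℝ} {c : ℕ → ℝ} {c' : ℝ}
    (hF : ∀ n, Integrable (F n) μ) (h0 : ∀ n, 0 ≤ᵐ[μ] F n)
    (hlim : ∀ᵐ x ∂μ, Tendsto (fun n => F n x) atTop (𝓝 (F' x)))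
    (hc : ∀ n, ∫ x, F n x ∂μ ≤ c n) (hcl : Tendsto c atTop (𝓝 c')) :
    Integrable F' μ ∧ ∫ x, F' x ∂μ ≤ c' := by
  have hm : AEStronglyMeasurable F' μ :=
    aestronglyMeasurable_of_tendsto_ae atTop (fun n => (hF n).1) hlim
  have h0' : 0 ≤ᵐ[μ] F' := by
    filter_upwards [ae_all_iff.2 h0, hlim] with x hx hl
    exact ge_of_tendsto' hl hx
  have h1 : ∫⁻ x, ENNReal.ofReal (F' x) ∂μ ≤ ENNReal.ofReal c' := by
    calc ∫⁻ x, ENNReal.ofReal (F' x) ∂μ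
        = ∫⁻ x, liminf (fun n => ENNReal.ofReal (F n x)) atTop ∂μ := by
          refine lintegral_congr_ae ?_
          filter_upwards [hlim] with x hx
          exact ((ENNReal.tendsto_ofReal hx).liminf_eq).symm
      _ ≤ liminf (fun n => ∫⁻ x, ENNReal.ofReal (F n x) ∂μ) atTop :=
          lintegral_liminf_le' fun n => (hF n).1.aemeasurable.ennreal_ofReal
      _ ≤ liminf (fun n => ENNReal.ofReal (c n)) atTop := by
          refine liminf_le_liminf (Eventually.of_forall fun n => ?_)
          rw [← ofReal_integral_eq_lintegral_ofReal (hF n) (h0 n)]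
          exact ENNReal.ofReal_le_ofReal (hc n)
      _ = ENNReal.ofReal c' := (ENNReal.tendsto_ofReal hcl).liminf_eq
  have hi : Integrable F' μ := by
    refine ⟨hm, ?_⟩
    rw [hasFiniteIntegral_iff_ofReal h0']
    exact h1.trans_lt ENNReal.ofReal_lt_top
  refine ⟨hi, ?_⟩
  rw [← ofReal_integral_eq_lintegral_ofReal hi h0'] at h1
  have hc0 : 0 ≤ c' := ge_of_tendsto' hcl fun n => (integral_nonneg_of_ae (h0 n)).trans (hc n)
  exact (ENNReal.ofReal_le_ofReal_iff hc0).1 h1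

end Measure

/-- The density of the functional whose critical points are the weak solutions of
`-div (flux (∇u)) + τ |u|^{p-2} u = g`. -/
noncomputable def energyDensity (p β τ g s : ℝ) (ξ : Plane) : ℝ :=
  potential p β τ ξ + τ / p * |s| ^ p - g * s

lemma exists_le_energyDensity (hp : 1 < p) (hβ : 0 < β) (hτ : 0 < τ) {M : ℝ} (hM : 0 ≤ M) :
    ∃ C, 0 ≤ C ∧ ∀ g s ξ, |g| ≤ M →
      regNorm τ ξ ^ p / p + τ / (2 * p) * |s| ^ p - C ≤ energyDensity p β τ g s ξ := by
  obtain ⟨C, hC0, hC⟩ := exists_mul_le_rpow_add hp (c := τ / (2 * p)) (by positivity) hM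
  refine ⟨C, hC0, fun g s ξ hg => ?_⟩
  have h1 := hC |s| (abs_nonneg s)
  have h2 : g * s ≤ M * |s| := by
    refine (le_abs_self _).trans ?_
    rw [abs_mul]
    gcongr
  have h3 : 0 ≤ β * regNorm τ ξ := mul_nonneg hβ.le (regNorm_pos hτ ξ).le
  have h4 : τ / p * |s| ^ p = τ / (2 * p) * |s| ^ p + τ / (2 * p) * |s| ^ p := by
    field_simp; ring
  unfold energyDensity potential
  linarith

section Minimizer

variable {g u w : Plane → ℝ} {G H : Plane → Plane} {M : ℝ}

lemma integrable_energyDensity (hΩf : volume Ω ≠ ⊤) (hp : 1 < p) (hτ : 0 < τ) (hτ' : τ ≤ 1)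
    (hg : AEStronglyMeasurable g (volume.restrict Ω)) (hgM : ∀ᵐ x ∂volume.restrict Ω, |g x| ≤ M)
    (h : IsW1 Ω (ENNReal.ofReal p) u G) :
    IntegrableOn (fun x => energyDensity p β τ (g x) (u x) (G x)) Ω := by
  have : IsFiniteMeasure (volume.restrict Ω) := ⟨by simpa using hΩf.lt_top⟩
  have hu := h.integrableOn hΩf (one_le_ofReal hp)
  have hG := h.integrableOn_grad hΩf (one_le_ofReal hp)
  have h1 : IntegrableOn (fun x => regNorm τ (G x)) Ω := by
    refine (hG.norm.add (integrable_const 1)).mono'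
      ((continuous_regNorm τ).comp_aestronglyMeasurable hG.1) (ae_of_all _ fun x => ?_)
    rw [Real.norm_of_nonneg (regNorm_pos hτ _).le]
    exact regNorm_le hτ hτ' _
  have h2 : IntegrableOn (fun x => g x * u x) Ω := hu.bdd_mul hg hgM
  exact ((((integrable_regNorm_rpow hp hτ hτ' h.memLp_grad).div_const p).add
    (h1.const_mul β)).add ((memLp_rpow_integrable hp h.memLp).const_mul _)).sub h2

/-- Uniform convexity: the distance between two competitors, measured by `gap`, is controlled by
the excess of their energies over the infimum. -/
lemma integral_gap_le_energy (hΩf : volume Ω ≠ ⊤) (hp : 1 < p) (hβ : 0 < β) (hτ : 0 < τ)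
    (hτ' : τ ≤ 1) (hg : AEStronglyMeasurable g (volume.restrict Ω))
    (hgM : ∀ᵐ x ∂volume.restrict Ω, |g x| ≤ M) {m : ℝ}
    (hm : ∀ w H, IsW1 Ω (ENNReal.ofReal p) w H →
      m ≤ ∫ x in Ω, energyDensity p β τ (g x) (w x) (H x))
    (hu : IsW1 Ω (ENNReal.ofReal p) u G) (hw : IsW1 Ω (ENNReal.ofReal p) w H) :
    β * τ * ∫ x in Ω, gap τ (G x) (H x) ≤ ((∫ x in Ω, energyDensity p β τ (g x) (u x) (G x)) +
      ∫ x in Ω, energyDensity p β τ (g x) (w x) (H x)) / 2 - m := by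
  have : IsFiniteMeasure (volume.restrict Ω) := ⟨by simpa using hΩf.lt_top⟩
  have hv := (hu.add hw hΩf (one_le_ofReal hp)).const_mul (1 / 2)
  have h1 := hm _ _ hv
  have iu := integrable_energyDensity (β := β) hΩf hp hτ hτ' hg hgM hu
  have iw := integrable_energyDensity (β := β) hΩf hp hτ hτ' hg hgM hw
  have iv := integrable_energyDensity (β := β) hΩf hp hτ hτ' hg hgM hv
  have ig : IntegrableOn (fun x => gap τ (G x) (H x)) Ω :=
    integrable_gap hτ hu.memLp_grad.1 hw.memLp_grad.1
  have h2 : (∫ x in Ω, energyDensity p β τ (g x) (1 / 2 * (u x + w x)) ((1 / 2 : ℝ) • (G x + H x)))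
      + β * τ * ∫ x in Ω, gap τ (G x) (H x) ≤
      ((∫ x in Ω, energyDensity p β τ (g x) (u x) (G x)) +
      ∫ x in Ω, energyDensity p β τ (g x) (w x) (H x)) / 2 := by
    rw [← integral_const_mul, ← integral_add iv (ig.const_mul _), ← integral_add iu iw,
      ← integral_div]
    refine integral_mono (iv.add (ig.const_mul _)) ((iu.add iw).div_const 2) fun x => ?_
    have h3 := potential_midpoint hτ hβ hp (G x) (H x)
    have h4 : |1 / 2 * (u x + w x)| ^ p ≤ 1 / 2 * |u x| ^ p + 1 / 2 * |w x| ^ p := by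
      refine le_trans ?_ (half_add_half_rpow_le hp.le (abs_nonneg (u x)) (abs_nonneg (w x)))
      refine Real.rpow_le_rpow (abs_nonneg _) ?_ (by linarith)
      rw [abs_mul, abs_of_pos (by norm_num : (0 : ℝ) < 1 / 2)]
      linarith [abs_add_le (u x) (w x)]
    have h5 := mul_le_mul_of_nonneg_left h4 (by positivity : 0 ≤ τ / p)
    simp only [energyDensity]
    linarith
  linarith

lemma isW1_zero (q : ℝ≥0∞) : IsW1 Ω q (fun _ => 0) (fun _ => 0) :=
  ⟨MemLp.zero', MemLp.zero', fun φ _ _ _ i => by simp⟩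

/-- The direct method: the energy attains its minimum. Minimizing sequences converge strongly in
`L¹` together with their gradients, by uniform convexity and Rellich's theorem. -/
theorem exists_minimizer (hΩo : IsOpen Ω) (hΩf : volume Ω ≠ ⊤) (hp : 1 < p) (hβ : 0 < β)
    (hτ : 0 < τ) (hτ' : τ ≤ 1) (hg : AEStronglyMeasurable g (volume.restrict Ω)) (hM : 0 ≤ M)
    (hgM : ∀ᵐ x ∂volume.restrict Ω, |g x| ≤ M) :
    ∃ u G, IsW1 Ω (ENNReal.ofReal p) u G ∧ ∀ w H, IsW1 Ω (ENNReal.ofReal p) w H →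
      ∫ x in Ω, energyDensity p β τ (g x) (u x) (G x) ≤
        ∫ x in Ω, energyDensity p β τ (g x) (w x) (H x) := by
  have : IsFiniteMeasure (volume.restrict Ω) := ⟨by simpa using hΩf.lt_top⟩
  have hp0 : 0 < p := by linarith
  obtain ⟨C, hC0, hC⟩ := exists_le_energyDensity hp hβ hτ hM
  set J : (Plane → ℝ) → (Plane → Plane) → ℝ := fun u G =>
    ∫ x in Ω, energyDensity p β τ (g x) (u x) (G x) with hJ
  set V := volume.real Ω
  have low : ∀ u G, IsW1 Ω (ENNReal.ofReal p) u G → (∫ x in Ω, regNorm τ (G x) ^ p) / p +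
      τ / (2 * p) * (∫ x in Ω, |u x| ^ p) - C * V ≤ J u G := by
    intro u G h
    have i1 := (integrable_regNorm_rpow hp hτ hτ' h.memLp_grad).div_const p
    have i2 := (memLp_rpow_integrable hp h.memLp).const_mul (τ / (2 * p))
    have h1 : ∫ x in Ω, (regNorm τ (G x) ^ p / p + τ / (2 * p) * |u x| ^ p - C) ≤ J u G := by
      refine integral_mono_ae ((i1.add i2).sub (integrable_const C))
        (integrable_energyDensity hΩf hp hτ hτ' hg hgM h) ?_
      filter_upwards [hgM] with x hx
      exact hC _ _ _ hx
    rw [integral_sub (f := fun x => regNorm τ (G x) ^ p / p + τ / (2 * p) * |u x| ^ p)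
      (i1.add i2) (integrable_const C), integral_add i1 i2, integral_div, integral_const_mul] at h1
    simp only [integral_const, smul_eq_mul, measureReal_restrict_apply_univ] at h1
    linarith
  have nonnegI : ∀ (u : Plane → ℝ) (G : Plane → Plane), 0 ≤ (∫ x in Ω, regNorm τ (G x) ^ p) / p ∧
      0 ≤ τ / (2 * p) * (∫ x in Ω, |u x| ^ p) := fun u G => by
    constructor
    · exact div_nonneg (integral_nonneg fun x => Real.rpow_nonneg (regNorm_pos hτ _).le _) hp0.le
    · exact mul_nonneg (by positivity) (integral_nonneg fun x => by positivity)
  set S : Set ℝ := {e | ∃ u G, IsW1 Ω (ENNReal.ofReal p) u G ∧ J u G = e}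
  have hSb : BddBelow S := by
    refine ⟨-(C * V), ?_⟩
    rintro e ⟨u, G, h, rfl⟩
    linarith [low u G h, (nonnegI u G).1, (nonnegI u G).2]
  have hSn : S.Nonempty := ⟨_, _, _, isW1_zero _, rfl⟩
  -- a minimizing sequence, which is bounded by coercivity
  set m := sInf S
  have hm : ∀ w H, IsW1 Ω (ENNReal.ofReal p) w H → m ≤ J w H :=
    fun w H h => csInf_le hSb ⟨w, H, h, rfl⟩
  have hex : ∀ n : ℕ, ∃ u G, IsW1 Ω (ENNReal.ofReal p) u G ∧ J u G < m + 1 / ((n : ℝ) + 1) := by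
    intro n
    obtain ⟨e, ⟨u, G, h, rfl⟩, h2⟩ := Real.lt_sInf_add_pos hSn
      (by positivity : (0 : ℝ) < 1 / ((n : ℝ) + 1))
    exact ⟨u, G, h, h2⟩
  choose u G hW hE using hex
  have hE1 : ∀ n, J (u n) (G n) ≤ m + 1 := fun n => by
    have : 1 / ((n : ℝ) + 1) ≤ 1 := by
      rw [div_le_one (by positivity)]; linarith [(n.cast_nonneg : (0 : ℝ) ≤ n)]
    linarith [hE n]
  set B := m + 1 + C * V
  have hBG : ∀ n, ∫ x in Ω, regNorm τ (G n x) ^ p ≤ p * B := fun n => by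
    have h1 : (∫ x in Ω, regNorm τ (G n x) ^ p) / p ≤ B := by
      linarith [low _ _ (hW n), hE1 n, (nonnegI (u n) (G n)).2]
    rwa [div_le_iff₀' hp0] at h1
  have hBu : ∀ n, ∫ x in Ω, |u n x| ^ p ≤ 2 * p / τ * B := fun n => by
    have h1 : τ / (2 * p) * (∫ x in Ω, |u n x| ^ p) ≤ B := by
      linarith [low _ _ (hW n), hE1 n, (nonnegI (u n) (G n)).1]
    have h2 := mul_le_mul_of_nonneg_left h1 (by positivity : 0 ≤ 2 * p / τ)
    rwa [← mul_assoc, show 2 * p / τ * (τ / (2 * p)) = 1 by field_simp, one_mul] at h2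
  have hBG1 : ∀ n, ∫ x in Ω, ‖G n x‖ ≤ V + p * B := fun n => by
    have i1 := integrable_regNorm_rpow hp hτ hτ' (hW n).memLp_grad
    have h1 : ∫ x in Ω, ‖G n x‖ ≤ ∫ x in Ω, (1 + regNorm τ (G n x) ^ p) :=
      integral_mono ((hW n).integrableOn_grad hΩf (one_le_ofReal hp)).norm
        ((integrable_const 1).add i1) fun x => (norm_le_regNorm hτ _).trans
          (le_one_add_rpow hp (regNorm_pos hτ _).le)
    rw [integral_add (integrable_const 1) i1] at h1
    simp only [integral_const, smul_eq_mul, measureReal_restrict_apply_univ, mul_one] at h1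
    linarith [hBG n]
  have hui : ∀ n, IntegrableOn (u n) Ω := fun n => (hW n).integrableOn hΩf (one_le_ofReal hp)
  have hGi : ∀ n, IntegrableOn (G n) Ω := fun n => (hW n).integrableOn_grad hΩf (one_le_ofReal hp)
  -- the gradients are Cauchy in `L¹`, by uniform convexity
  have hcauchy : ∀ ε > 0, ∃ N, ∀ n ≥ N, ∀ k ≥ N, ∫ x in Ω, ‖G n x - G k x‖ ≤ ε := by
    intro ε hε
    obtain ⟨D, hD0, hD⟩ := exists_integral_norm_sub_le_gap (α := Plane)
      (μ := volume.restrict Ω) hp hτ hτ' (half_pos hε) (p * B)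
    obtain ⟨N, hN⟩ := exists_nat_one_div_lt
      (show 0 < ε * (β * τ) / (2 * (D + 1)) by positivity)
    refine ⟨N, fun n hn k hk => ?_⟩
    have h1 := hD _ _ (hW n).memLp_grad (hW k).memLp_grad (hBG n) (hBG k)
    have h2 := integral_gap_le_energy hΩf hp hβ hτ hτ' hg hgM hm (hW n) (hW k)
    have h3 : ∀ n ≥ N, J (u n) (G n) ≤ m + ε * (β * τ) / (2 * (D + 1)) := fun n hn => by
      have : 1 / ((n : ℝ) + 1) ≤ 1 / ((N : ℝ) + 1) := by
        have : (N : ℝ) ≤ n := by exact_mod_cast hn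
        gcongr
      linarith [hE n]
    have h4 : β * τ * ∫ x in Ω, gap τ (G n x) (G k x) ≤ β * τ * (ε / (2 * (D + 1))) := by
      have e : ε * (β * τ) / (2 * (D + 1)) = β * τ * (ε / (2 * (D + 1))) := by ring
      linarith [h3 n hn, h3 k hk]
    have h5 := le_of_mul_le_mul_left h4 (by positivity)
    have h6 : D * ∫ x in Ω, gap τ (G n x) (G k x) ≤ ε / 2 := by
      refine (mul_le_mul_of_nonneg_left h5 hD0).trans ?_
      rw [mul_div_assoc', div_le_div_iff₀ (by positivity) (by norm_num)]
      nlinarith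
    linarith
  obtain ⟨G', hG'i, hG'⟩ := exists_limit_of_cauchy_integral hGi hcauchy
  set B' := max (2 * p / τ * B) (V + p * B)
  obtain ⟨ns, u', hns, hu'i, hu'⟩ := exists_subseq_tendsto_of_bounded hΩo hΩf hp hW
    (fun n => (hBu n).trans (le_max_left _ _ : _ ≤ B'))
    (fun n => (hBG1 n).trans (le_max_right _ _))
  have hG'' : Tendsto (fun n => ∫ x in Ω, ‖G (ns n) x - G' x‖) atTop (𝓝 0) :=
    hG'.comp hns.tendsto_atTop
  have hgrad : HasWeakGrad Ω u' G' := HasWeakGrad.of_tendsto (fun n => (hW (ns n)).hasWeakGrad)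
    (fun n => hui _) (fun n => hGi _) hu'i hG'i hu' hG''
  obtain ⟨ks, hks, hks'⟩ := exists_subseq_ae_tendsto (fun n => hui (ns n)) hu'i hu'
  obtain ⟨ls, hls, hls'⟩ := exists_subseq_ae_tendsto (fun n => hGi (ns (ks n))) hG'i
    (hG''.comp hks.tendsto_atTop)
  set r : ℕ → ℕ := fun n => ns (ks (ls n))
  have hr : Tendsto r atTop atTop :=
    hns.tendsto_atTop.comp (hks.tendsto_atTop.comp hls.tendsto_atTop)
  have hcont : ∀ c : ℝ, Continuous fun z : ℝ × Plane => energyDensity p β τ c z.1 z.2 := fun c => by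
    have h1 := continuous_potential (β := β) (τ := τ) hp0
    have h2 : Continuous fun z : ℝ × Plane => |z.1| ^ p :=
      continuous_fst.abs.rpow_const fun _ => Or.inr hp0.le
    unfold energyDensity
    exact ((h1.comp continuous_snd).add (h2.const_mul _)).sub (continuous_fst.const_mul c)
  have hpos : ∀ (w : Plane → ℝ) (H : Plane → Plane), ∀ᵐ x ∂volume.restrict Ω,
      regNorm τ (H x) ^ p / p + τ / (2 * p) * |w x| ^ p ≤
        energyDensity p β τ (g x) (w x) (H x) + C := fun w H => by
    filter_upwards [hgM] with x hx
    linarith [hC (g x) (w x) (H x) hx]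
  -- lower semicontinuity, by Fatou's lemma along an almost everywhere convergent subsequence
  have hlimE := integral_le_of_ae_tendsto (μ := volume.restrict Ω)
    (F := fun n x => energyDensity p β τ (g x) (u (r n) x) (G (r n) x) + C)
    (F' := fun x => energyDensity p β τ (g x) (u' x) (G' x) + C)
    (c := fun n => m + 1 / ((r n : ℝ) + 1) + C * V) (c' := m + 0 + C * V)
    (fun n => (integrable_energyDensity hΩf hp hτ hτ' hg hgM (hW _)).add (integrable_const C))
    (fun n => by
      filter_upwards [hpos (u (r n)) (G (r n))] with x hx
      have h1 := regNorm_pos hτ (G (r n) x)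
      exact le_trans (by positivity) hx)
    (by
      filter_upwards [hks', hls'] with x hx hx'
      have h1 : Tendsto (fun n => (u (r n) x, G (r n) x)) atTop (𝓝 (u' x, G' x)) :=
        (hx.comp hls.tendsto_atTop).prodMk_nhds hx'
      exact (((hcont (g x)).tendsto _).comp h1).add_const C)
    (fun n => by
      rw [integral_add (integrable_energyDensity hΩf hp hτ hτ' hg hgM (hW _)) (integrable_const C)]
      simp only [integral_const, smul_eq_mul, measureReal_restrict_apply_univ]
      linarith [hE (r n)])
    ((tendsto_const_nhds.add (tendsto_one_div_add_atTop_nhds_zero_nat.comp hr)).add_const _)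
  obtain ⟨hint, hle⟩ := hlimE
  -- the limit has finite energy, so that it lies in `L^p` together with its gradient
  have hmem : IsW1 Ω (ENNReal.ofReal p) u' G' := by
    refine ⟨memLp_of_integrable_rpow hp hu'i.1 ?_, memLp_of_integrable_rpow hp hG'i.1 ?_, hgrad⟩
    · refine (hint.const_mul (2 * p / τ)).mono' ?_ ?_
      · exact (hu'i.1.norm.aemeasurable.pow_const p).aestronglyMeasurable
      · filter_upwards [hpos u' G'] with x hx
        have h1 : 0 ≤ regNorm τ (G' x) ^ p / p := by
          have h1 := regNorm_pos hτ (G' x); positivity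
        have h2 : τ / (2 * p) * |u' x| ^ p ≤ energyDensity p β τ (g x) (u' x) (G' x) + C := by
          linarith
        rw [Real.norm_of_nonneg (by positivity), Real.norm_eq_abs]
        have h3 := mul_le_mul_of_nonneg_left h2 (by positivity : 0 ≤ 2 * p / τ)
        rwa [← mul_assoc, show 2 * p / τ * (τ / (2 * p)) = 1 by field_simp, one_mul] at h3
    · refine (hint.const_mul p).mono' ?_ ?_
      · exact (hG'i.1.norm.aemeasurable.pow_const p).aestronglyMeasurable
      · filter_upwards [hpos u' G'] with x hx
        have h1 : 0 ≤ τ / (2 * p) * |u' x| ^ p := by positivity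
        have h2 : regNorm τ (G' x) ^ p / p ≤ energyDensity p β τ (g x) (u' x) (G' x) + C := by
          linarith
        rw [div_le_iff₀' hp0] at h2
        rw [Real.norm_of_nonneg (by positivity)]
        exact (Real.rpow_le_rpow (norm_nonneg _) (norm_le_regNorm hτ _) hp0.le).trans h2
  refine ⟨u', G', hmem, fun w H hw => le_trans ?_ (hm w H hw)⟩
  rw [integral_add (integrable_energyDensity hΩf hp hτ hτ' hg hgM hmem) (integrable_const C)] at hle
  simp only [integral_const, smul_eq_mul, measureReal_restrict_apply_univ] at hle
  linarith

end Minimizer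

end Energy

/-! ### The odd power `|t|^{p-2} t` -/

section SignedPow

variable {p : ℝ}

/-- The odd power `|t|^{p-2} t`. -/
noncomputable def signedPow (p t : ℝ) : ℝ := |t| ^ (p - 2) * t

lemma abs_signedPow (hp : 1 < p) (t : ℝ) : |signedPow p t| = |t| ^ (p - 1) := by
  rw [signedPow, abs_mul, abs_of_nonneg (by positivity : 0 ≤ |t| ^ (p - 2))]
  rcases eq_or_ne t 0 with rfl | ht
  · rw [abs_zero, mul_zero, Real.zero_rpow (by linarith)]
  · rw [← Real.rpow_add_one (abs_pos.2 ht).ne']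
    congr 1; ring

lemma signedPow_of_nonneg (hp : 1 < p) {t : ℝ} (ht : 0 ≤ t) : signedPow p t = t ^ (p - 1) := by
  have h := abs_signedPow hp t
  rw [abs_of_nonneg ht] at h
  rwa [abs_of_nonneg] at h
  rw [signedPow]; positivity

lemma signedPow_neg (t : ℝ) : signedPow p (-t) = -signedPow p t := by simp [signedPow]

lemma signedPow_mul_self_nonneg (t : ℝ) : 0 ≤ signedPow p t * t := by
  rw [signedPow, mul_assoc]
  exact mul_nonneg (by positivity) (mul_self_nonneg t)

lemma strictMono_signedPow (hp : 1 < p) : StrictMono (signedPow p) := by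
  have h0 : ∀ {s t : ℝ}, 0 ≤ s → s < t → signedPow p s < signedPow p t := by
    intro s t hs hst
    rw [signedPow_of_nonneg hp hs, signedPow_of_nonneg hp (hs.trans hst.le)]
    exact Real.rpow_lt_rpow hs hst (by linarith)
  have hz : signedPow p 0 = 0 := by simp [signedPow]
  intro s t hst
  rcases le_or_gt 0 s with hs | hs
  · exact h0 hs hst
  · rcases le_or_gt t 0 with ht | ht
    · have := h0 (neg_nonneg.2 ht) (neg_lt_neg hst)
      rw [signedPow_neg, signedPow_neg] at this
      linarith
    · have h1 := h0 le_rfl ht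
      have h2 := h0 le_rfl (neg_pos.2 hs)
      rw [signedPow_neg] at h2
      linarith

lemma hasDerivAt_abs_rpow_div (hp : 1 < p) (t : ℝ) :
    HasDerivAt (fun t : ℝ => |t| ^ p / p) (signedPow p t) t := by
  refine ((hasDerivAt_abs_rpow t hp).div_const p).congr_deriv ?_
  have : p ≠ 0 := by linarith
  rw [signedPow]; field_simp

lemma continuous_signedPow (hp : 1 < p) : Continuous (signedPow p) := by
  have hc : Continuous fun t : ℝ => |t| ^ (p - 1) :=
    continuous_abs.rpow_const fun _ => Or.inr (by linarith)
  refine continuous_iff_continuousAt.2 fun t => ?_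
  rcases eq_or_ne t 0 with rfl | ht
  · have hz : signedPow p 0 = 0 := by simp [signedPow]
    rw [ContinuousAt, hz, tendsto_zero_iff_abs_tendsto_zero]
    have := hc.tendsto 0
    rw [abs_zero, Real.zero_rpow (by linarith)] at this
    exact this.congr fun s => (abs_signedPow hp s).symm
  · exact (continuousAt_id.abs.rpow_const (Or.inl (abs_pos.2 ht).ne')).mul continuousAt_id

/-- Strict monotonicity of the odd power in quantitative form: on a bounded set, compactness makes the
monotonicity uniform for pairs at distance at least `ε`. -/
lemma exists_abs_sub_le_signedPow (hp : 1 < p) (K : ℝ) {ε : ℝ} (hε : 0 < ε) :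
    ∃ C, 0 ≤ C ∧ ∀ s t, |s| ≤ K → |t| ≤ K →
      |s - t| ≤ ε + C * ((signedPow p s - signedPow p t) * (s - t)) := by
  have hmon : ∀ s t, 0 ≤ (signedPow p s - signedPow p t) * (s - t) := fun s t => by
    rcases le_total s t with h | h
    · exact mul_nonneg_of_nonpos_of_nonpos
        (sub_nonpos.2 ((strictMono_signedPow hp).monotone h)) (sub_nonpos.2 h)
    · exact mul_nonneg (sub_nonneg.2 ((strictMono_signedPow hp).monotone h)) (sub_nonneg.2 h)
  set T : Set (ℝ × ℝ) := (Icc (-K) K ×ˢ Icc (-K) K) ∩ {z | ε ≤ |z.1 - z.2|}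
  have hT : IsCompact T := (isCompact_Icc.prod isCompact_Icc).inter_right
    (isClosed_le continuous_const (by fun_prop))
  have hcont : Continuous fun z : ℝ × ℝ => (signedPow p z.1 - signedPow p z.2) * (z.1 - z.2) := by
    have := continuous_signedPow hp
    fun_prop
  rcases T.eq_empty_or_nonempty with hemp | hne
  · refine ⟨0, le_rfl, fun s t hs ht => ?_⟩
    by_contra! h
    have : (s, t) ∈ T := ⟨⟨abs_le.1 hs, abs_le.1 ht⟩, by
      rw [Set.mem_ofPred_eq]; linarith⟩
    simp [hemp] at this
  · obtain ⟨z, hz, hmin⟩ := hT.exists_isMinOn hne hcont.continuousOn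
    set δ := (signedPow p z.1 - signedPow p z.2) * (z.1 - z.2)
    have hz2 : z.1 ≠ z.2 := fun h => by
      have : ε ≤ |z.1 - z.2| := hz.2
      rw [h, sub_self, abs_zero] at this
      linarith
    have hδ : 0 < δ := by
      refine (hmon z.1 z.2).lt_of_ne' (mul_ne_zero (sub_ne_zero.2 fun h => hz2 ?_)
        (sub_ne_zero.2 hz2))
      exact (strictMono_signedPow hp).injective h
    have hK : 0 ≤ K := by have := hz.1.1; linarith [this.1, this.2]
    refine ⟨2 * K / δ, by positivity, fun s t hs ht => ?_⟩
    have h0 := hmon s t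
    by_cases h : ε ≤ |s - t|
    · have h1 : δ ≤ (signedPow p s - signedPow p t) * (s - t) :=
        hmin (show (s, t) ∈ T from ⟨⟨abs_le.1 hs, abs_le.1 ht⟩, h⟩)
      have h2 : |s - t| ≤ 2 * K := by
        have := abs_sub s t
        linarith
      have h3 : 2 * K ≤ 2 * K / δ * ((signedPow p s - signedPow p t) * (s - t)) := by
        rw [div_mul_eq_mul_div, le_div_iff₀ hδ]
        exact mul_le_mul_of_nonneg_left h1 (by linarith)
      linarith
    · have : 0 ≤ 2 * K / δ * ((signedPow p s - signedPow p t) * (s - t)) := by positivity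
      linarith

end SignedPow

/-! ### The quasilinear equation for `u` -/

section FluxEquation

variable {p β τ M : ℝ} {Ω : Set Plane} {g h u w : Plane → ℝ} {G H : Plane → Plane}

lemma abs_inner_flux_le (hp : 1 < p) (hτ : 0 < τ) (hβ : 0 < β) {ξ η : Plane} {Z : ℝ}
    (hξ : regNorm τ ξ ≤ Z) (hη : ‖η‖ ≤ Z) : |inner ℝ (flux p β τ ξ) η| ≤ Z ^ p + β * Z := by
  have h0 := regNorm_pos hτ ξ
  calc |inner ℝ (flux p β τ ξ) η| ≤ ‖flux p β τ ξ‖ * ‖η‖ := abs_real_inner_le_norm _ _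
    _ ≤ (regNorm τ ξ ^ (p - 1) + β) * ‖η‖ := by
        gcongr
        exact norm_flux_le hτ hβ ξ
    _ = regNorm τ ξ ^ (p - 1) * ‖η‖ + β * ‖η‖ := add_mul _ _ _
    _ ≤ Z ^ p + β * Z := by
        have := rpow_sub_one_mul_le hp h0.le (norm_nonneg η) hξ hη
        gcongr

lemma abs_signedPow_mul_le (hp : 1 < p) {s t Z : ℝ} (hs : |s| ≤ Z) (ht : |t| ≤ Z) :
    |signedPow p s * t| ≤ Z ^ p := by
  rw [abs_mul, abs_signedPow hp]
  exact rpow_sub_one_mul_le hp (abs_nonneg s) (abs_nonneg t) hs ht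

section Measure

variable {α : Type*} [MeasurableSpace α] {μ : Measure α} [IsFiniteMeasure μ]

lemma integrable_inner_flux {G H : α → Plane} (hp : 1 < p) (hτ : 0 < τ) (hτ' : τ ≤ 1)
    (hβ : 0 < β) (hG : MemLp G (ENNReal.ofReal p) μ) (hH : MemLp H (ENNReal.ofReal p) μ) :
    Integrable (fun x => inner ℝ (flux p β τ (G x)) (H x)) μ := by
  have hZ : MemLp (fun x => ‖G x‖ + ‖H x‖ + 1) (ENNReal.ofReal p) μ :=
    (hG.norm.add hH.norm).add (memLp_const 1)
  refine ((memLp_rpow_integrable hp hZ).add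
    ((hZ.integrable (one_le_ofReal hp)).const_mul β)).mono'
    (((continuous_flux hτ).comp_aestronglyMeasurable hG.1).inner hH.1) (ae_of_all _ fun x => ?_)
  have h0 : 0 ≤ ‖G x‖ + ‖H x‖ + 1 := by positivity
  simp only [Pi.add_apply, abs_of_nonneg h0]
  refine abs_inner_flux_le hp hτ hβ ((regNorm_le hτ hτ' _).trans ?_) ?_
  · linarith [norm_nonneg (H x)]
  · linarith [norm_nonneg (G x)]

end Measure

lemma integrable_signedPow_mul {α : Type*} [MeasurableSpace α] {μ : Measure α} {u φ : α → ℝ}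
    (hp : 1 < p) (hu : MemLp u (ENNReal.ofReal p) μ) (hφ : MemLp φ (ENNReal.ofReal p) μ) :
    Integrable (fun x => signedPow p (u x) * φ x) μ := by
  refine (memLp_rpow_integrable hp (hu.norm.add hφ.norm)).mono'
    (((continuous_signedPow hp).comp_aestronglyMeasurable hu.1).mul hφ.1) (ae_of_all _ fun x => ?_)
  have h0 : 0 ≤ ‖u x‖ + ‖φ x‖ := by positivity
  simp only [Pi.add_apply, abs_of_nonneg h0]
  exact abs_signedPow_mul_le hp (le_add_of_nonneg_right (norm_nonneg _))
    (le_add_of_nonneg_left (norm_nonneg _))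

/-- `u`, with weak gradient `G`, is a weak solution in `W^{1,p}(Ω)` of
`-div (flux (∇u)) + τ |u|^{p-2} u = g` with the natural boundary condition. -/
structure IsFluxSolution (Ω : Set Plane) (p β τ : ℝ) (g u : Plane → ℝ) (G : Plane → Plane) :
    Prop where
  isW1 : IsW1 Ω (ENNReal.ofReal p) u G
  integral_eq : ∀ (φ : Plane → ℝ) (Gφ : Plane → Plane), IsW1 Ω (ENNReal.ofReal p) φ Gφ →
    (∫ x in Ω, inner ℝ (flux p β τ (G x)) (Gφ x)) + τ * ∫ x in Ω, signedPow p (u x) * φ x =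
      ∫ x in Ω, g x * φ x

/-- The Euler–Lagrange equation of the energy. -/
theorem exists_isFluxSolution (hΩo : IsOpen Ω) (hΩf : volume Ω ≠ ⊤) (hp : 1 < p) (hβ : 0 < β)
    (hτ : 0 < τ) (hτ' : τ ≤ 1) (hg : AEStronglyMeasurable g (volume.restrict Ω)) (hM : 0 ≤ M)
    (hgM : ∀ᵐ x ∂volume.restrict Ω, |g x| ≤ M) : ∃ u G, IsFluxSolution Ω p β τ g u G := by
  have : IsFiniteMeasure (volume.restrict Ω) := ⟨by simpa using hΩf.lt_top⟩
  obtain ⟨u, G, hW, hmin⟩ := exists_minimizer hΩo hΩf hp hβ hτ hτ' hg hM hgM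
  refine ⟨u, G, hW, fun φ Gφ hφ => ?_⟩
  have hp1 := one_le_ofReal hp
  have hadm : ∀ t : ℝ, IsW1 Ω (ENNReal.ofReal p) (fun x => u x + t * φ x)
      (fun x => G x + t • Gφ x) := fun t => hW.add (hφ.const_mul t) hΩf hp1
  set F : ℝ → Plane → ℝ := fun t x => energyDensity p β τ (g x) (u x + t * φ x) (G x + t • Gφ x)
  set F' : ℝ → Plane → ℝ := fun t x => inner ℝ (flux p β τ (G x + t • Gφ x)) (Gφ x) +
    τ * (signedPow p (u x + t * φ x) * φ x) - g x * φ x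
  have hFi : ∀ t, IntegrableOn (F t) Ω := fun t =>
    integrable_energyDensity hΩf hp hτ hτ' hg hgM (hadm t)
  have iφ := hφ.integrableOn hΩf hp1
  have i1 := integrable_inner_flux hp hτ hτ' hβ (hadm 0).memLp_grad hφ.memLp_grad
  have i2 := integrable_signedPow_mul hp (hadm 0).memLp hφ.memLp
  have i3 : IntegrableOn (fun x => g x * φ x) Ω := iφ.bdd_mul hg hgM
  have hZ : MemLp (fun x => ‖G x‖ + ‖Gφ x‖ + 1) (ENNReal.ofReal p) (volume.restrict Ω) :=
    (hW.memLp_grad.norm.add hφ.memLp_grad.norm).add (memLp_const 1)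
  have hY : MemLp (fun x => ‖u x‖ + ‖φ x‖) (ENNReal.ofReal p) (volume.restrict Ω) :=
    hW.memLp.norm.add hφ.memLp.norm
  set bound : Plane → ℝ := fun x => |‖G x‖ + ‖Gφ x‖ + 1| ^ p + β * (‖G x‖ + ‖Gφ x‖ + 1) +
    τ * |‖u x‖ + ‖φ x‖| ^ p + M * ‖φ x‖
  have hbi : IntegrableOn bound Ω := (((memLp_rpow_integrable hp hZ).add
    ((hZ.integrable hp1).const_mul β)).add ((memLp_rpow_integrable hp hY).const_mul τ)).add
      (iφ.norm.const_mul M)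
  -- the energy along the line `u + t φ` has a minimum at `t = 0`, where it is differentiated
  have hder := hasDerivAt_integral_of_dominated_loc_of_deriv_le (μ := volume.restrict Ω) (F := F)
    (F' := F') (x₀ := 0) (bound := bound) (ball_mem_nhds 0 one_pos)
    (Eventually.of_forall fun t => (hFi t).1) (hFi 0)
    ((i1.add (i2.const_mul τ)).sub i3).1
    (by
      filter_upwards [hgM] with x hx t ht
      have ht1 : |t| ≤ 1 := by simpa using (mem_ball_zero_iff.1 ht).le
      have b0 : ‖t • Gφ x‖ ≤ ‖Gφ x‖ := by
        rw [norm_smul, Real.norm_eq_abs]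
        exact mul_le_of_le_one_left (norm_nonneg _) ht1
      have b1 : |inner ℝ (flux p β τ (G x + t • Gφ x)) (Gφ x)| ≤
          |‖G x‖ + ‖Gφ x‖ + 1| ^ p + β * (‖G x‖ + ‖Gφ x‖ + 1) := by
        rw [abs_of_nonneg (by positivity : 0 ≤ ‖G x‖ + ‖Gφ x‖ + 1)]
        refine abs_inner_flux_le hp hτ hβ ((regNorm_le hτ hτ' _).trans ?_) ?_
        · linarith [norm_add_le (G x) (t • Gφ x)]
        · linarith [norm_nonneg (G x)]
      have b2 : |signedPow p (u x + t * φ x) * φ x| ≤ |‖u x‖ + ‖φ x‖| ^ p := by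
        rw [abs_of_nonneg (by positivity : 0 ≤ ‖u x‖ + ‖φ x‖)]
        refine abs_signedPow_mul_le hp ((abs_add_le _ _).trans ?_)
          (le_add_of_nonneg_left (norm_nonneg _))
        rw [abs_mul]
        exact add_le_add le_rfl (mul_le_of_le_one_left (abs_nonneg _) ht1)
      have b3 : |g x * φ x| ≤ M * ‖φ x‖ := by
        rw [abs_mul]
        exact mul_le_mul_of_nonneg_right hx (abs_nonneg _)
      calc ‖F' t x‖ ≤ |inner ℝ (flux p β τ (G x + t • Gφ x)) (Gφ x)| +
            |τ * (signedPow p (u x + t * φ x) * φ x)| + |g x * φ x| :=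
          (abs_sub _ _).trans (add_le_add (abs_add_le _ _) le_rfl)
        _ ≤ bound x := by
          rw [abs_mul τ, abs_of_pos hτ]
          have := mul_le_mul_of_nonneg_left b2 hτ.le
          exact add_le_add (add_le_add b1 this) b3)
    hbi
    (ae_of_all _ fun x t _ => by
      have d1 : HasDerivAt (fun t : ℝ => u x + t * φ x) (φ x) t := by
        simpa using ((hasDerivAt_id t).mul_const (φ x)).const_add (u x)
      have d2 := (hasDerivAt_abs_rpow_div hp (u x + t * φ x)).comp t d1
      have d3 := ((hasDerivAt_potential (β := β) hτ hp (G x) (Gφ x) t).add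
        (d2.const_mul τ)).sub (d1.const_mul (g x))
      refine (d3.congr_of_eventuallyEq (Eventually.of_forall fun s => ?_))
      simp only [F, energyDensity, Pi.add_apply, Pi.sub_apply, Function.comp_apply]
      ring)
  have hlm : IsLocalMin (fun t => ∫ x in Ω, F t x) 0 :=
    Eventually.of_forall fun t => by
      have := hmin _ _ (hadm t)
      simpa [F] using this
  have hz := hlm.hasDerivAt_eq_zero hder.2
  simp only [F', zero_mul, zero_smul, add_zero] at hz i1 i2
  rw [integral_sub (f := fun x => inner ℝ (flux p β τ (G x)) (Gφ x) +
      τ * (signedPow p (u x) * φ x)) (i1.add (i2.const_mul τ)) i3,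
    integral_add i1 (i2.const_mul τ), integral_const_mul] at hz
  linarith

lemma IsFluxSolution.neg (hs : IsFluxSolution Ω p β τ g u G) :
    IsFluxSolution Ω p β τ (fun x => -g x) (fun x => -u x) (fun x => -G x) := by
  refine ⟨hs.isW1.neg, fun φ Gφ hφ => ?_⟩
  have := hs.integral_eq φ Gφ hφ
  simp only [flux_neg, signedPow_neg, inner_neg_left, neg_mul, integral_neg]
  linarith

/-- The truncation `(u - k)⁺` as a test function; the equation holds with the truncated gradient,
whose contribution is nonnegative. -/
lemma IsFluxSolution.posPart_eq (hs : IsFluxSolution Ω p β τ g u G) (hΩo : IsOpen Ω)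
    (hΩf : volume Ω ≠ ⊤) (hp : 1 < p) (k : ℝ) :
    (∫ x in Ω, {x | k < u x}.indicator (fun x => inner ℝ (flux p β τ (G x)) (G x)) x) +
        τ * ∫ x in Ω, signedPow p (u x) * max (u x - k) 0 =
      ∫ x in Ω, g x * max (u x - k) 0 := by
  rw [← hs.integral_eq _ _ (hs.isW1.posPart hΩo hΩf (one_le_ofReal hp) k)]
  congr 2
  ext x
  by_cases hx : x ∈ {x | k < u x}
  · simp only [indicator_of_mem hx]
  · simp only [indicator_of_notMem hx, inner_zero_right]

lemma ae_le_of_integral_posPart_eq_zero {μ : Measure Plane} {k : ℝ}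
    (hi : Integrable (fun x => max (u x - k) 0) μ) (h : ∫ x, max (u x - k) 0 ∂μ = 0) :
    ∀ᵐ x ∂μ, u x ≤ k := by
  have h1 := (integral_eq_zero_iff_of_nonneg (f := fun x => max (u x - k) 0)
    (fun x => le_max_right _ _) hi).1 h
  filter_upwards [h1] with x hx
  have : max (u x - k) 0 = 0 := hx
  linarith [le_max_left (u x - k) 0]

/-- The maximum principle, by testing with `(u - k)⁺`. -/
lemma IsFluxSolution.ae_le (hs : IsFluxSolution Ω p β τ g u G) (hΩo : IsOpen Ω)
    (hΩf : volume Ω ≠ ⊤) (hp : 1 < p) (hβ : 0 < β) (hτ : 0 < τ)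
    (hg : AEStronglyMeasurable g (volume.restrict Ω))
    (hgM : ∀ᵐ x ∂volume.restrict Ω, |g x| ≤ M) {k : ℝ} (hk : 0 ≤ k) (hMk : M < τ * k ^ (p - 1)) :
    ∀ᵐ x ∂volume.restrict Ω, u x ≤ k := by
  have h1 := hs.posPart_eq hΩo hΩf hp k
  have hW := hs.isW1.posPart hΩo hΩf (one_le_ofReal hp) k
  have i0 := hW.integrableOn hΩf (one_le_ofReal hp)
  have i1 : IntegrableOn (fun x => g x * max (u x - k) 0) Ω := i0.bdd_mul hg hgM
  have i2 := integrable_signedPow_mul hp hs.isW1.memLp hW.memLp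
  have h2 : 0 ≤ ∫ x in Ω, {x | k < u x}.indicator
      (fun x => inner ℝ (flux p β τ (G x)) (G x)) x :=
    integral_nonneg fun x => indicator_nonneg (fun x _ => inner_flux_nonneg hτ hβ _) x
  have h3 : ∫ x in Ω, (τ * k ^ (p - 1) - M) * max (u x - k) 0 ≤
      ∫ x in Ω, (τ * (signedPow p (u x) * max (u x - k) 0) - g x * max (u x - k) 0) := by
    refine integral_mono_ae (i0.const_mul _) ((i2.const_mul τ).sub i1) ?_
    filter_upwards [hgM] with x hx
    rcases le_total (u x) k with h | h
    · simp [max_eq_right (sub_nonpos.2 h)]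
    · have h4 : k ^ (p - 1) ≤ signedPow p (u x) := by
        rw [← signedPow_of_nonneg hp hk]
        exact (strictMono_signedPow hp).monotone h
      have h5 : 0 ≤ max (u x - k) 0 := le_max_right _ _
      have h6 := (abs_le.1 hx).2
      have h7 := mul_le_mul_of_nonneg_left h4 hτ.le
      have h8 : τ * k ^ (p - 1) - M ≤ τ * signedPow p (u x) - g x := by linarith
      have := mul_le_mul_of_nonneg_right h8 h5
      linarith
  rw [integral_sub (i2.const_mul τ) i1, integral_const_mul, integral_const_mul] at h3
  have h4 : ∫ x in Ω, max (u x - k) 0 = 0 := by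
    refine le_antisymm ?_ (integral_nonneg fun x => le_max_right _ _)
    by_contra! h
    have := mul_pos (sub_pos.2 hMk) h
    linarith
  exact ae_le_of_integral_posPart_eq_zero i0 h4

/-- The solutions with a right-hand side bounded by `M` are bounded by a constant that depends on
`M` only. -/
lemma exists_abs_le_of_isFluxSolution (hΩo : IsOpen Ω) (hΩf : volume Ω ≠ ⊤) (hp : 1 < p)
    (hβ : 0 < β) (hτ : 0 < τ) (hM : 0 ≤ M) :
    ∃ K, 0 ≤ K ∧ ∀ g u G, IsFluxSolution Ω p β τ g u G →
      AEStronglyMeasurable g (volume.restrict Ω) → (∀ᵐ x ∂volume.restrict Ω, |g x| ≤ M) →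
      ∀ᵐ x ∂volume.restrict Ω, |u x| ≤ K := by
  have hK : 0 ≤ ((M + 1) / τ) ^ (1 / (p - 1)) := by positivity
  have hMk : M < τ * (((M + 1) / τ) ^ (1 / (p - 1))) ^ (p - 1) := by
    rw [← Real.rpow_mul (by positivity), one_div_mul_cancel (by linarith), Real.rpow_one,
      mul_div_cancel₀ _ hτ.ne']
    linarith
  refine ⟨_, hK, fun g u G hs hg hgM => ?_⟩
  have h1 := hs.ae_le hΩo hΩf hp hβ hτ hg hgM hK hMk
  have h2 := hs.neg.ae_le hΩo hΩf hp hβ hτ hg.neg (by simpa using hgM) hK hMk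
  filter_upwards [h1, h2] with x hx hx'
  exact abs_le.2 ⟨by linarith, hx⟩

/-- Coercivity of the flux. -/
lemma regNorm_rpow_le (hp : 1 < p) (hβ : 0 < β) (hτ : 0 < τ) (hτ' : τ ≤ 1) (ξ : Plane) :
    regNorm τ ξ ^ p ≤ 2 * inner ℝ (flux p β τ ξ) ξ + 2 ^ p := by
  have hx := regNorm_pos hτ ξ
  have hsq := regNorm_sq hτ ξ
  have h0 := inner_flux_nonneg (p := p) hτ hβ ξ
  have h2p : (0 : ℝ) ≤ 2 ^ p := by positivity
  rcases le_total τ (‖ξ‖ ^ 2) with h | h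
  · have h1 : regNorm τ ξ ^ p = regNorm τ ξ ^ (p - 2) * regNorm τ ξ ^ 2 := by
      rw [← Real.rpow_natCast, ← Real.rpow_add hx]; simp
    have h2 : regNorm τ ξ ^ (p - 2) * ‖ξ‖ ^ 2 ≤ inner ℝ (flux p β τ ξ) ξ := by
      rw [flux, real_inner_smul_left, real_inner_self_eq_norm_sq, rho_eq hτ]
      have : 0 ≤ β / regNorm τ ξ := by positivity
      gcongr
      linarith
    have h3 : regNorm τ ξ ^ (p - 2) * regNorm τ ξ ^ 2 ≤
        regNorm τ ξ ^ (p - 2) * (2 * ‖ξ‖ ^ 2) := by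
      gcongr
      linarith
    linarith
  · have h1 : regNorm τ ξ ≤ 2 := by nlinarith
    have := Real.rpow_le_rpow hx.le h1 (by linarith : 0 ≤ p)
    linarith

/-- The energy estimate, obtained by testing the equation with its solution. -/
lemma exists_integral_regNorm_rpow_le (hΩo : IsOpen Ω) (hΩf : volume Ω ≠ ⊤) (hp : 1 < p)
    (hβ : 0 < β) (hτ : 0 < τ) (hτ' : τ ≤ 1) (hM : 0 ≤ M) :
    ∃ B, ∀ g u G, IsFluxSolution Ω p β τ g u G →
      AEStronglyMeasurable g (volume.restrict Ω) → (∀ᵐ x ∂volume.restrict Ω, |g x| ≤ M) →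
      ∫ x in Ω, regNorm τ (G x) ^ p ≤ B := by
  have : IsFiniteMeasure (volume.restrict Ω) := ⟨by simpa using hΩf.lt_top⟩
  obtain ⟨K, hK0, hK⟩ := exists_abs_le_of_isFluxSolution (p := p) (β := β) hΩo hΩf hp hβ hτ hM
  refine ⟨2 * (M * K * volume.real Ω) + 2 ^ p * volume.real Ω, fun g u G hs hg hgM => ?_⟩
  have hW := hs.isW1
  have h1 := hs.integral_eq u G hW
  have i1 := integrable_inner_flux hp hτ hτ' hβ hW.memLp_grad hW.memLp_grad
  have h2 : 0 ≤ ∫ x in Ω, signedPow p (u x) * u x :=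
    integral_nonneg fun x => signedPow_mul_self_nonneg _
  have h3 : ∫ x in Ω, g x * u x ≤ ∫ x in Ω, M * K := by
    refine integral_mono_ae ((hW.integrableOn hΩf (one_le_ofReal hp)).bdd_mul hg hgM)
      (integrable_const _) ?_
    filter_upwards [hgM, hK g u G hs hg hgM] with x hx hx'
    refine (le_abs_self _).trans ?_
    rw [abs_mul]
    gcongr
  have h4 : ∫ x in Ω, regNorm τ (G x) ^ p ≤
      ∫ x in Ω, (2 * inner ℝ (flux p β τ (G x)) (G x) + 2 ^ p) :=
    integral_mono (integrable_regNorm_rpow hp hτ hτ' hW.memLp_grad)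
      ((i1.const_mul 2).add (integrable_const _)) fun x => regNorm_rpow_le hp hβ hτ hτ' _
  rw [integral_add (i1.const_mul 2) (integrable_const _), integral_const_mul] at h4
  simp only [integral_const, smul_eq_mul, measureReal_restrict_apply_univ] at h3 h4
  nlinarith [mul_nonneg hτ.le h2]

lemma ae_abs_sub_le {K : ℝ} {u w : Plane → ℝ} {μ : Measure Plane} (hu : ∀ᵐ x ∂μ, |u x| ≤ K)
    (hw : ∀ᵐ x ∂μ, |w x| ≤ K) : ∀ᵐ x ∂μ, |u x - w x| ≤ 2 * K := by
  filter_upwards [hu, hw] with x hx hx'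
  have := abs_sub (u x) (w x)
  linarith

/-- Quantitative continuous dependence, in `L¹`, of the solution and of its gradient on the
right-hand side. -/
theorem exists_integral_norm_sub_le_of_isFluxSolution (hΩo : IsOpen Ω) (hΩf : volume Ω ≠ ⊤)
    (hp : 1 < p) (hβ : 0 < β) (hτ : 0 < τ) (hτ' : τ ≤ 1) (hM : 0 ≤ M) {ε : ℝ} (hε : 0 < ε) :
    ∃ C, 0 ≤ C ∧ ∀ g h u w G H, IsFluxSolution Ω p β τ g u G → IsFluxSolution Ω p β τ h w H →
      AEStronglyMeasurable g (volume.restrict Ω) → AEStronglyMeasurable h (volume.restrict Ω) →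
      (∀ᵐ x ∂volume.restrict Ω, |g x| ≤ M) → (∀ᵐ x ∂volume.restrict Ω, |h x| ≤ M) →
      ∫ x in Ω, ‖u x - w x‖ ≤ ε + C * ∫ x in Ω, ‖g x - h x‖ ∧
      ∫ x in Ω, ‖G x - H x‖ ≤ ε + C * ∫ x in Ω, ‖g x - h x‖ := by
  have : IsFiniteMeasure (volume.restrict Ω) := ⟨by simpa using hΩf.lt_top⟩
  obtain ⟨K, hK0, hK⟩ := exists_abs_le_of_isFluxSolution (p := p) (β := β) hΩo hΩf hp hβ hτ hM
  obtain ⟨B, hB⟩ := exists_integral_regNorm_rpow_le (p := p) (β := β) hΩo hΩf hp hβ hτ hτ' hM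
  obtain ⟨C₁, hC₁0, hC₁⟩ := exists_integral_norm_sub_le_gap (μ := volume.restrict Ω) hp hτ hτ' hε B
  set V := volume.real Ω
  have hV : 0 ≤ V := measureReal_nonneg
  obtain ⟨C₂, hC₂0, hC₂⟩ := exists_abs_sub_le_signedPow hp K (show 0 < ε / (V + 1) by positivity)
  set D := C₁ * (2 * K / (2 * β * τ)) + C₂ * (2 * K / τ)
  have hD1 : 0 ≤ C₁ * (2 * K / (2 * β * τ)) := by positivity
  have hD2 : 0 ≤ C₂ * (2 * K / τ) := by positivity
  refine ⟨D, add_nonneg hD1 hD2, fun g h u w G H hu hw hg hh hgM hhM => ?_⟩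
  have hp1 := one_le_ofReal hp
  have hWu := hu.isW1
  have hWw := hw.isW1
  have hd := hWu.sub hWw hΩf hp1
  have e1 := hu.integral_eq _ _ hd
  have e2 := hw.integral_eq _ _ hd
  have i1 := integrable_inner_flux hp hτ hτ' hβ hWu.memLp_grad hd.memLp_grad
  have i2 := integrable_inner_flux hp hτ hτ' hβ hWw.memLp_grad hd.memLp_grad
  have i3 := integrable_signedPow_mul hp hWu.memLp hd.memLp
  have i4 := integrable_signedPow_mul hp hWw.memLp hd.memLp
  have id := hd.integrableOn hΩf hp1
  have i5 : IntegrableOn (fun x => g x * (u x - w x)) Ω := id.bdd_mul hg hgM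
  have i6 : IntegrableOn (fun x => h x * (u x - w x)) Ω := id.bdd_mul hh hhM
  have ig := integrable_gap hτ hWu.memLp_grad.1 hWw.memLp_grad.1
  have igh : IntegrableOn (fun x => ‖g x - h x‖) Ω :=
    ((Integrable.of_bound hg M hgM).sub (Integrable.of_bound hh M hhM)).norm
  have im : IntegrableOn (fun x => (signedPow p (u x) - signedPow p (w x)) * (u x - w x)) Ω :=
    (i3.sub i4).congr (ae_of_all _ fun x => by simp only [Pi.sub_apply]; ring)
  -- the difference of the two equations, tested with `u - w`
  have key : 2 * β * τ * (∫ x in Ω, gap τ (G x) (H x)) +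
      τ * (∫ x in Ω, (signedPow p (u x) - signedPow p (w x)) * (u x - w x)) ≤
      2 * K * ∫ x in Ω, ‖g x - h x‖ := by
    have k1 : 2 * β * τ * (∫ x in Ω, gap τ (G x) (H x)) ≤
        (∫ x in Ω, inner ℝ (flux p β τ (G x)) (G x - H x)) -
          ∫ x in Ω, inner ℝ (flux p β τ (H x)) (G x - H x) := by
      rw [← integral_sub i1 i2, ← integral_const_mul]
      refine integral_mono (ig.const_mul _) (i1.sub i2) fun x => ?_
      have := le_inner_flux_sub hτ hβ hp (G x) (H x)
      rwa [inner_sub_left] at this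
    have k2 : ∫ x in Ω, (signedPow p (u x) - signedPow p (w x)) * (u x - w x) =
        (∫ x in Ω, signedPow p (u x) * (u x - w x)) -
          ∫ x in Ω, signedPow p (w x) * (u x - w x) := by
      rw [← integral_sub i3 i4]
      exact integral_congr_ae (ae_of_all _ fun x => by ring)
    have k3 : (∫ x in Ω, g x * (u x - w x)) - ∫ x in Ω, h x * (u x - w x) ≤
        2 * K * ∫ x in Ω, ‖g x - h x‖ := by
      rw [← integral_sub i5 i6, ← integral_const_mul]
      refine integral_mono_ae (i5.sub i6) (igh.const_mul _) ?_
      filter_upwards [ae_abs_sub_le (hK g u G hu hg hgM) (hK h w H hw hh hhM)] with x hx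
      rw [← sub_mul, mul_comm, Real.norm_eq_abs]
      refine (le_abs_self _).trans ?_
      rw [abs_mul]
      gcongr
    rw [k2]
    linarith
  have n1 : 0 ≤ ∫ x in Ω, gap τ (G x) (H x) := integral_nonneg fun x => gap_nonneg hτ _ _
  have n2 : 0 ≤ ∫ x in Ω, (signedPow p (u x) - signedPow p (w x)) * (u x - w x) := by
    refine integral_nonneg fun x => ?_
    rcases le_total (u x) (w x) with h | h
    · exact mul_nonneg_of_nonpos_of_nonpos
        (sub_nonpos.2 ((strictMono_signedPow hp).monotone h)) (sub_nonpos.2 h)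
    · exact mul_nonneg (sub_nonneg.2 ((strictMono_signedPow hp).monotone h)) (sub_nonneg.2 h)
  have n3 : 0 ≤ ∫ x in Ω, ‖g x - h x‖ := integral_nonneg fun x => norm_nonneg _
  have h1 : ∫ x in Ω, gap τ (G x) (H x) ≤ 2 * K / (2 * β * τ) * ∫ x in Ω, ‖g x - h x‖ := by
    rw [div_mul_eq_mul_div, le_div_iff₀' (by positivity)]
    linarith [mul_nonneg hτ.le n2]
  have h2 : ∫ x in Ω, (signedPow p (u x) - signedPow p (w x)) * (u x - w x) ≤
      2 * K / τ * ∫ x in Ω, ‖g x - h x‖ := by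
    rw [div_mul_eq_mul_div, le_div_iff₀' hτ]
    linarith [mul_nonneg (by positivity : 0 ≤ 2 * β * τ) n1]
  constructor
  · have h3 : ∫ x in Ω, ‖u x - w x‖ ≤ ∫ x in Ω, (ε / (V + 1) +
        C₂ * ((signedPow p (u x) - signedPow p (w x)) * (u x - w x))) := by
      refine integral_mono_ae id.norm ((integrable_const _).add (im.const_mul _)) ?_
      filter_upwards [hK g u G hu hg hgM, hK h w H hw hh hhM] with x hx hx'
      exact hC₂ _ _ hx hx'
    rw [integral_add (integrable_const _) (im.const_mul _), integral_const_mul] at h3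
    simp only [integral_const, smul_eq_mul, measureReal_restrict_apply_univ] at h3
    have h4 : V * (ε / (V + 1)) ≤ ε := by
      rw [mul_div_assoc', div_le_iff₀ (by positivity)]
      nlinarith
    have h5 := mul_le_mul_of_nonneg_left h2 hC₂0
    have h6 := mul_nonneg hD1 n3
    simp only [D, add_mul]
    linarith
  · have h3 := hC₁ G H hWu.memLp_grad hWw.memLp_grad (hB g u G hu hg hgM) (hB h w H hw hh hhM)
    have h5 := mul_le_mul_of_nonneg_left h1 hC₁0
    have h6 := mul_nonneg hD2 n3
    simp only [D, add_mul]
    linarith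

end FluxEquation

/-! ### The mobility matrix -/

section Mobility

variable {q τ : ℝ}

/-- The coefficient of `ξ ξᵀ` in the mobility matrix. -/
noncomputable def mobilityCoeff (q τ : ℝ) (ξ : Plane) : ℝ :=
  (1 / (1 + q * ‖ξ‖) - 1) / (‖ξ‖ ^ 2 + τ)

/-- The product of the mobility matrix `D_τ(ξ)` and a vector. -/
noncomputable def mobilityMap (q τ : ℝ) (ξ η : Plane) : Plane :=
  (1 + τ) • η + (mobilityCoeff q τ ξ * inner ℝ ξ η) • ξ

lemma toEuclideanLin_mobility (ξ η : Plane) :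
    Matrix.toEuclideanLin (mobility q τ ξ) η = mobilityMap q τ ξ η := by
  ext i
  fin_cases i
  all_goals
    simp [mobility, mobilityMap, mobilityCoeff, Matrix.toLpLin_apply, dotProduct, Fin.sum_univ_two, PiLp.inner_apply]
    ring

lemma mobilityCoeff_mul_mem (hq : 0 ≤ q) (hτ : 0 < τ) (ξ : Plane) :
    -1 ≤ mobilityCoeff q τ ξ * ‖ξ‖ ^ 2 ∧ mobilityCoeff q τ ξ ≤ 0 := by
  have h1 : 0 ≤ 1 / (1 + q * ‖ξ‖) := by positivity
  have h2 : 1 / (1 + q * ‖ξ‖) ≤ 1 := by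
    rw [div_le_one (by positivity)]
    have : 0 ≤ q * ‖ξ‖ := by positivity
    linarith
  have h3 : 0 < ‖ξ‖ ^ 2 + τ := by positivity
  refine ⟨?_, div_nonpos_of_nonpos_of_nonneg (by linarith) h3.le⟩
  rw [mobilityCoeff, div_mul_eq_mul_div, le_div_iff₀ h3]
  nlinarith [sq_nonneg ‖ξ‖]

lemma inner_mobilityMap (ξ η ζ : Plane) : inner ℝ (mobilityMap q τ ξ η) ζ =
    (1 + τ) * inner ℝ η ζ + mobilityCoeff q τ ξ * inner ℝ ξ η * inner ℝ ξ ζ := by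
  rw [mobilityMap, inner_add_left, real_inner_smul_left, real_inner_smul_left]

lemma le_inner_mobilityMap (hq : 0 ≤ q) (hτ : 0 < τ) (ξ η : Plane) :
    τ * ‖η‖ ^ 2 ≤ inner ℝ (mobilityMap q τ ξ η) η := by
  obtain ⟨h1, h2⟩ := mobilityCoeff_mul_mem hq hτ ξ
  rw [inner_mobilityMap, real_inner_self_eq_norm_sq]
  have h3 : inner ℝ ξ η ^ 2 ≤ (‖ξ‖ * ‖η‖) ^ 2 :=
    sq_le_sq.2 ((abs_real_inner_le_norm ξ η).trans (le_abs_self _))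
  have h4 := mul_le_mul_of_nonpos_left h3 h2
  have h5 := mul_le_mul_of_nonneg_right h1 (sq_nonneg ‖η‖)
  nlinarith

lemma norm_mobilityMap_le (hq : 0 ≤ q) (hτ : 0 < τ) (hτ' : τ ≤ 1) (ξ η : Plane) :
    ‖mobilityMap q τ ξ η‖ ≤ 3 * ‖η‖ := by
  obtain ⟨h1, h2⟩ := mobilityCoeff_mul_mem hq hτ ξ
  have h3 : ‖(1 + τ) • η‖ ≤ 2 * ‖η‖ := by
    rw [norm_smul, Real.norm_of_nonneg (by linarith)]
    gcongr
    linarith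
  have h4 : ‖(mobilityCoeff q τ ξ * inner ℝ ξ η) • ξ‖ ≤ ‖η‖ := by
    rw [norm_smul, norm_mul, Real.norm_eq_abs, abs_of_nonpos h2]
    have h5 : ‖inner ℝ ξ η‖ ≤ ‖ξ‖ * ‖η‖ := abs_real_inner_le_norm ξ η
    calc -mobilityCoeff q τ ξ * ‖inner ℝ ξ η‖ * ‖ξ‖
        ≤ -mobilityCoeff q τ ξ * (‖ξ‖ * ‖η‖) * ‖ξ‖ := by
          have : 0 ≤ -mobilityCoeff q τ ξ := by linarith
          gcongr
      _ = -(mobilityCoeff q τ ξ * ‖ξ‖ ^ 2) * ‖η‖ := by ring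
      _ ≤ 1 * ‖η‖ := by gcongr; linarith
      _ = ‖η‖ := one_mul _
  exact (norm_add_le _ _).trans (by linarith)

lemma mobilityMap_sub (ξ η η' : Plane) :
    mobilityMap q τ ξ (η - η') = mobilityMap q τ ξ η - mobilityMap q τ ξ η' := by
  simp only [mobilityMap, inner_sub_right, mul_sub, sub_smul, smul_sub]
  abel

lemma mobilityMap_add (ξ η η' : Plane) :
    mobilityMap q τ ξ (η + η') = mobilityMap q τ ξ η + mobilityMap q τ ξ η' := by
  simp only [mobilityMap, inner_add_right, mul_add, add_smul, smul_add]
  abel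

lemma mobilityMap_smul (c : ℝ) (ξ η : Plane) :
    mobilityMap q τ ξ (c • η) = c • mobilityMap q τ ξ η := by
  simp only [mobilityMap, real_inner_smul_right, smul_add, smul_smul]
  congr 2 <;> ring

lemma mobilityMap_neg (ξ η : Plane) : mobilityMap q τ ξ (-η) = -mobilityMap q τ ξ η := by
  simpa using mobilityMap_smul (q := q) (τ := τ) (-1) ξ η

lemma mobilityMap_neg_left (ξ η : Plane) : mobilityMap q τ (-ξ) η = mobilityMap q τ ξ η := by
  simp [mobilityMap, mobilityCoeff]

lemma continuous_mobilityMap (hq : 0 ≤ q) (hτ : 0 < τ) :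
    Continuous fun z : Plane × Plane => mobilityMap q τ z.1 z.2 := by
  have h1 : Continuous (mobilityCoeff q τ) := by
    unfold mobilityCoeff
    refine Continuous.div ((continuous_const.div (by fun_prop) fun ξ => ?_).sub continuous_const)
      (by fun_prop) fun ξ => ?_ <;> positivity
  unfold mobilityMap
  have h2 : Continuous fun z : Plane × Plane => mobilityCoeff q τ z.1 * inner ℝ z.1 z.2 :=
    (h1.comp continuous_fst).mul (continuous_fst.inner continuous_snd)
  have h3 : Continuous fun z : Plane × Plane => (1 + τ) • z.2 := continuous_snd.const_smul (1 + τ)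
  exact h3.add (h2.smul continuous_fst)

end Mobility

/-! ### The Lax–Milgram lemma and multiplication operators -/

section LaxMilgram

/-- The Lax–Milgram lemma for the compression of a coercive operator to a closed subspace. -/
lemma exists_inner_eq_of_coercive {H : Type*} [NormedAddCommGroup H] [InnerProductSpace ℝ H]
    [CompleteSpace H] (W : Submodule ℝ H) (hW : IsClosed (W : Set H)) (T : H →L[ℝ] H) {c : ℝ}
    (hc : 0 < c) (hT : ∀ x, c * ‖x‖ ^ 2 ≤ inner ℝ (T x) x) (F : H) :
    ∃ x ∈ W, ∀ y ∈ W, inner ℝ (T x) y = inner ℝ F y := by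
  have : CompleteSpace W := hW.completeSpace_coe
  set B : W →L[ℝ] W →L[ℝ] ℝ := (innerSL ℝ).bilinearComp (T.comp W.subtypeL) W.subtypeL
  have hB : ∀ x y : W, B x y = inner ℝ (T x) (y : H) := fun x y => rfl
  have hco : IsCoercive B := ⟨c, hc, fun x => by
    rw [hB, mul_assoc, ← sq]
    exact hT x⟩
  set F' : W →L[ℝ] ℝ := (innerSL ℝ F).comp W.subtypeL
  set e := hco.continuousLinearEquivOfBilin
  refine ⟨e.symm ((InnerProductSpace.toDual ℝ W).symm F'), Subtype.mem _, fun y hy => ?_⟩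
  have h1 := hco.continuousLinearEquivOfBilin_apply
    (e.symm ((InnerProductSpace.toDual ℝ W).symm F')) ⟨y, hy⟩
  rw [e.apply_symm_apply, InnerProductSpace.toDual_symm_apply] at h1
  exact h1.symm

/-- A bounded measurable field of linear operators acts on `L²`. -/
lemma exists_pointwise_operator {α E : Type*} [MeasurableSpace α] {μ : Measure α}
    [NormedAddCommGroup E] [InnerProductSpace ℝ E] {A : α → E → E} {C : ℝ}
    (hadd : ∀ z x y, A z (x + y) = A z x + A z y) (hsmul : ∀ z (c : ℝ) x, A z (c • x) = c • A z x)
    (hC : ∀ z x, ‖A z x‖ ≤ C * ‖x‖)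
    (hm : ∀ x : α → E, AEStronglyMeasurable x μ → AEStronglyMeasurable (fun z => A z (x z)) μ) :
    ∃ T : Lp E 2 μ →L[ℝ] Lp E 2 μ, ∀ x : Lp E 2 μ, T x =ᵐ[μ] fun z => A z (x z) := by
  have hL : ∀ x : Lp E 2 μ, MemLp (fun z => A z (x z)) 2 μ := fun x =>
    (Lp.memLp x).of_le_mul (hm _ (Lp.aestronglyMeasurable x)) (ae_of_all _ fun z => hC z _)
  let T₀ : Lp E 2 μ →ₗ[ℝ] Lp E 2 μ :=
    { toFun := fun x => (hL x).toLp
      map_add' := fun x y => by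
        rw [← MemLp.toLp_add]
        refine MemLp.toLp_congr _ _ ?_
        filter_upwards [Lp.coeFn_add x y] with z hz
        rw [hz, Pi.add_apply, hadd, Pi.add_apply]
      map_smul' := fun c x => by
        rw [RingHom.id_apply, ← MemLp.toLp_const_smul]
        refine MemLp.toLp_congr _ _ ?_
        filter_upwards [Lp.coeFn_smul c x] with z hz
        rw [hz, Pi.smul_apply, hsmul, Pi.smul_apply] }
  have hT₀ : ∀ x, T₀ x =ᵐ[μ] fun z => A z (x z) := fun x => (hL x).coeFn_toLp
  refine ⟨T₀.mkContinuous C fun x => ?_, hT₀⟩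
  refine Lp.norm_le_mul_norm_of_ae_le_mul ?_
  filter_upwards [hT₀ x] with z hz
  rw [hz]
  exact hC z _

end LaxMilgram

/-! ### The linear equation for `v` -/

section MobilityEquation

variable {q τ M : ℝ} {Ω : Set Plane} {F v w : Plane → ℝ} {ξ Gv Gw : Plane → Plane}

/-- `v`, with weak gradient `Gv`, is a weak solution in `W^{1,2}(Ω)` of
`-div (D_τ(ξ) ∇v) + τ v = F` with the natural boundary condition. -/
structure IsMobilitySolution (Ω : Set Plane) (q τ : ℝ) (ξ : Plane → Plane) (F v : Plane → ℝ)
    (Gv : Plane → Plane) : Prop where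
  isW1 : IsW1 Ω 2 v Gv
  integral_eq : ∀ (φ : Plane → ℝ) (Gφ : Plane → Plane), IsW1 Ω 2 φ Gφ →
    (∫ x in Ω, inner ℝ (mobilityMap q τ (ξ x) (Gv x)) (Gφ x)) + τ * ∫ x in Ω, v x * φ x =
      ∫ x in Ω, F x * φ x

lemma integrable_inner_of_memLp {α E : Type*} [MeasurableSpace α] {μ : Measure α}
    [NormedAddCommGroup E] [InnerProductSpace ℝ E] {f g : α → E} (hf : MemLp f 2 μ)
    (hg : MemLp g 2 μ) : Integrable (fun x => inner ℝ (f x) (g x)) μ :=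
  (hf.norm.integrable_mul hg.norm).mono' (hf.1.inner hg.1)
    (ae_of_all _ fun _ => norm_inner_le_norm _ _)

lemma aestronglyMeasurable_mobilityMap {μ : Measure Plane} (hq : 0 ≤ q) (hτ : 0 < τ)
    (hξ : AEStronglyMeasurable ξ μ) (hG : AEStronglyMeasurable Gv μ) :
    AEStronglyMeasurable (fun x => mobilityMap q τ (ξ x) (Gv x)) μ :=
  (continuous_mobilityMap hq hτ).comp_aestronglyMeasurable
    (g := fun z : Plane × Plane => mobilityMap q τ z.1 z.2) (f := fun x => (ξ x, Gv x))
    (hξ.prodMk hG)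

lemma memLp_mobilityMap {μ : Measure Plane} (hq : 0 ≤ q) (hτ : 0 < τ) (hτ' : τ ≤ 1)
    (hξ : AEStronglyMeasurable ξ μ) (hG : MemLp Gv 2 μ) :
    MemLp (fun x => mobilityMap q τ (ξ x) (Gv x)) 2 μ :=
  hG.of_le_mul (aestronglyMeasurable_mobilityMap hq hτ hξ hG.1)
    (ae_of_all _ fun _ => norm_mobilityMap_le hq hτ hτ' _ _)

/-- The space `W^{1,2}(Ω)`, as the subspace of the pairs `(v, ∇v)` in `L²(Ω; ℝ × ℝ²)`. -/
noncomputable def sobolevGraph (Ω : Set Plane) (hΩ : volume Ω ≠ ⊤) :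
    Submodule ℝ (Lp (WithLp 2 (ℝ × Plane)) 2 (volume.restrict Ω)) where
  carrier := {x | IsW1 Ω 2 (fun z => (x z).fst) (fun z => (x z).snd)}
  zero_mem' := by
    refine (isW1_zero 2).congr_ae ?_ ?_ <;>
    · filter_upwards [Lp.coeFn_zero (WithLp 2 (ℝ × Plane)) 2 (volume.restrict Ω)] with z hz
      rw [hz]; rfl
  add_mem' := by
    intro x y hx hy
    refine (IsW1.add hx hy hΩ one_le_two).congr_ae ?_ ?_ <;>
    · filter_upwards [Lp.coeFn_add x y] with z hz
      rw [hz]; rfl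
  smul_mem' := by
    intro c x hx
    refine (IsW1.const_mul hx c).congr_ae ?_ ?_ <;>
    · filter_upwards [Lp.coeFn_smul c x] with z hz
      rw [hz]; rfl

/-- On a finite measure space convergence in `L²` implies convergence in `L¹`. -/
lemma tendsto_integral_norm_of_sq {α E : Type*} [MeasurableSpace α] {μ : Measure α}
    [IsFiniteMeasure μ] [NormedAddCommGroup E] {f : ℕ → α → E} (hf : ∀ n, MemLp (f n) 2 μ)
    (h : Tendsto (fun n => ∫ x, ‖f n x‖ ^ 2 ∂μ) atTop (𝓝 0)) :
    Tendsto (fun n => ∫ x, ‖f n x‖ ∂μ) atTop (𝓝 0) := by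
  have key : ∀ ε > 0, ∀ n, ∫ x, ‖f n x‖ ∂μ ≤ ε * μ.real univ + (∫ x, ‖f n x‖ ^ 2 ∂μ) / (4 * ε) := by
    intro ε hε n
    have i1 : Integrable (fun x => ‖f n x‖ ^ 2 / (4 * ε)) μ :=
      ((hf n).integrable_norm_pow two_ne_zero).div_const _
    have h1 : ∫ x, ‖f n x‖ ∂μ ≤ ∫ x, (ε + ‖f n x‖ ^ 2 / (4 * ε)) ∂μ := by
      refine integral_mono ((hf n).integrable one_le_two).norm ((integrable_const _).add i1)
        fun x => ?_
      have h2 : ε + ‖f n x‖ ^ 2 / (4 * ε) = (4 * ε ^ 2 + ‖f n x‖ ^ 2) / (4 * ε) := by field_simp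
      change ‖f n x‖ ≤ ε + ‖f n x‖ ^ 2 / (4 * ε)
      rw [h2, le_div_iff₀ (by positivity)]
      nlinarith [sq_nonneg (‖f n x‖ - 2 * ε)]
    rw [integral_add (integrable_const _) i1, integral_div] at h1
    simpa [mul_comm] using h1
  refine Metric.tendsto_atTop.2 fun ε hε => ?_
  set δ := ε / (2 * (μ.real univ + 1))
  have hV : 0 ≤ μ.real univ := measureReal_nonneg
  have hδ : 0 < δ := by positivity
  obtain ⟨N, hN⟩ := (Metric.tendsto_atTop.1 h) (2 * δ * ε) (by positivity)
  refine ⟨N, fun n hn => ?_⟩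
  have h1 := hN n hn
  rw [Real.dist_0_eq_abs] at h1 ⊢
  rw [abs_of_nonneg (integral_nonneg fun x => norm_nonneg _)]
  have h2 := (le_abs_self _).trans_lt h1
  have h3 : (∫ x, ‖f n x‖ ^ 2 ∂μ) / (4 * δ) < ε / 2 := by
    rw [div_lt_iff₀ (by positivity)]
    linarith
  have h4 : δ * μ.real univ ≤ ε / 2 := by
    simp only [δ]
    rw [div_mul_eq_mul_div, div_le_div_iff₀ (by positivity) two_pos]
    nlinarith
  linarith [key δ hδ n]

lemma real_inner_eq_mul (a b : ℝ) : inner ℝ a b = a * b := by simp [mul_comm]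

lemma norm_sq_eq_integral {α E : Type*} [MeasurableSpace α] {μ : Measure α}
    [NormedAddCommGroup E] [InnerProductSpace ℝ E] (f : Lp E 2 μ) :
    ‖f‖ ^ 2 = ∫ x, ‖f x‖ ^ 2 ∂μ := by
  rw [← real_inner_self_eq_norm_sq, L2.inner_def]
  simp only [real_inner_self_eq_norm_sq]

lemma isClosed_sobolevGraph (hΩ : volume Ω ≠ ⊤) :
    IsClosed (sobolevGraph Ω hΩ : Set (Lp (WithLp 2 (ℝ × Plane)) 2 (volume.restrict Ω))) := by
  have : IsFiniteMeasure (volume.restrict Ω) := ⟨by simpa using hΩ.lt_top⟩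
  refine isClosed_of_closure_subset fun x hx => ?_
  obtain ⟨xn, hxn, hlim⟩ := mem_closure_iff_seq_limit.1 hx
  have hW : ∀ n, IsW1 Ω 2 (fun z => (xn n z).fst) (fun z => (xn n z).snd) := hxn
  have hx2 := memLp_prodLp_iff.1 (Lp.memLp x)
  have h1 : Tendsto (fun n => ∫ z in Ω, ‖(xn n - x : Lp _ 2 _) z‖ ^ 2) atTop (𝓝 0) := by
    simp_rw [← norm_sq_eq_integral]
    have := (tendsto_iff_norm_sub_tendsto_zero.1 hlim).pow 2
    rwa [zero_pow two_ne_zero] at this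
  have h2 := tendsto_integral_norm_of_sq (fun n => Lp.memLp (xn n - x)) h1
  have h3 : ∀ n, IntegrableOn (fun z => ‖(xn n - x : Lp _ 2 _) z‖) Ω := fun n =>
    ((Lp.memLp (xn n - x)).integrable one_le_two).norm
  refine ⟨hx2.1, hx2.2, HasWeakGrad.of_tendsto (fun n => (hW n).hasWeakGrad)
    (fun n => (hW n).integrableOn hΩ one_le_two) (fun n => (hW n).integrableOn_grad hΩ one_le_two)
    (hx2.1.integrable one_le_two) (hx2.2.integrable one_le_two) ?_ ?_⟩
  · refine squeeze_zero (fun n => integral_nonneg fun z => norm_nonneg _) (fun n => ?_) h2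
    refine integral_mono_of_nonneg (ae_of_all _ fun z => norm_nonneg _) (h3 n) ?_
    filter_upwards [Lp.coeFn_sub (xn n) x] with z hz
    rw [hz]
    exact WithLp.norm_fst_le (p := 2) ℝ (xn n z - x z)
  · refine squeeze_zero (fun n => integral_nonneg fun z => norm_nonneg _) (fun n => ?_) h2
    refine integral_mono_of_nonneg (ae_of_all _ fun z => norm_nonneg _) (h3 n) ?_
    filter_upwards [Lp.coeFn_sub (xn n) x] with z hz
    rw [hz]
    exact WithLp.norm_snd_le (p := 2) ℝ (xn n z - x z)

/-- Existence by the Lax–Milgram lemma, in the graph of the weak gradient. -/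
theorem exists_isMobilitySolution (hΩf : volume Ω ≠ ⊤) (hq : 0 ≤ q) (hτ : 0 < τ) (hτ' : τ ≤ 1)
    (hξ : AEStronglyMeasurable ξ (volume.restrict Ω)) (hF : MemLp F 2 (volume.restrict Ω)) :
    ∃ v Gv, IsMobilitySolution Ω q τ ξ F v Gv := by
  have : IsFiniteMeasure (volume.restrict Ω) := ⟨by simpa using hΩf.lt_top⟩
  set A : Plane → WithLp 2 (ℝ × Plane) → WithLp 2 (ℝ × Plane) := fun z x =>
    WithLp.toLp 2 (τ * x.fst, mobilityMap q τ (ξ z) x.snd)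
  have hAn : ∀ z x, ‖A z x‖ ≤ 3 * ‖x‖ := fun z x => by
    refine abs_le_of_sq_le_sq' ?_ (by positivity) |>.2
    rw [mul_pow, WithLp.prod_norm_sq_eq_of_L2, WithLp.prod_norm_sq_eq_of_L2 x]
    have h1 : ‖τ * x.fst‖ ^ 2 ≤ 9 * ‖x.fst‖ ^ 2 := by
      rw [norm_mul, mul_pow, Real.norm_of_nonneg hτ.le]
      gcongr
      nlinarith
    have h2 : ‖mobilityMap q τ (ξ z) x.snd‖ ^ 2 ≤ 9 * ‖x.snd‖ ^ 2 := by
      have := pow_le_pow_left₀ (norm_nonneg _) (norm_mobilityMap_le hq hτ hτ' (ξ z) x.snd) 2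
      rw [mul_pow] at this
      linarith
    change ‖τ * x.fst‖ ^ 2 + ‖mobilityMap q τ (ξ z) x.snd‖ ^ 2 ≤ _
    linarith
  have hAm : ∀ x : Plane → WithLp 2 (ℝ × Plane), AEStronglyMeasurable x (volume.restrict Ω) →
      AEStronglyMeasurable (fun z => A z (x z)) (volume.restrict Ω) := fun x hx => by
    have h1 : AEStronglyMeasurable (fun z => (x z).fst) (volume.restrict Ω) :=
      (WithLp.continuous_fst 2 ℝ Plane).comp_aestronglyMeasurable hx
    have h2 : AEStronglyMeasurable (fun z => (x z).snd) (volume.restrict Ω) :=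
      (WithLp.continuous_snd 2 ℝ Plane).comp_aestronglyMeasurable hx
    exact (WithLp.prod_continuous_toLp 2 ℝ Plane).comp_aestronglyMeasurable
      ((h1.const_mul τ).prodMk (aestronglyMeasurable_mobilityMap hq hτ hξ h2))
  obtain ⟨T, hT⟩ := exists_pointwise_operator (μ := volume.restrict Ω) (A := A)
    (fun z x y => by
      simp only [A, WithLp.add_fst, WithLp.add_snd, mobilityMap_add, mul_add]
      rfl)
    (fun z c x => by
      simp only [A, WithLp.smul_fst, WithLp.smul_snd, mobilityMap_smul, smul_eq_mul,
        mul_left_comm τ c]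
      rfl) hAn hAm
  have hTi : ∀ x y : Lp (WithLp 2 (ℝ × Plane)) 2 (volume.restrict Ω), inner ℝ (T x) y =
      ∫ z in Ω, (τ * ((x z).fst * (y z).fst) +
        inner ℝ (mobilityMap q τ (ξ z) (x z).snd) (y z).snd) := fun x y => by
    rw [L2.inner_def]
    refine integral_congr_ae ?_
    filter_upwards [hT x] with z hz
    rw [hz, WithLp.prod_inner_apply]
    change inner ℝ (τ * (x z).fst) (y z).fst + _ = _
    rw [real_inner_eq_mul, mul_assoc]
    rfl
  have hco : ∀ x, τ * ‖x‖ ^ 2 ≤ inner ℝ (T x) x := fun x => by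
    rw [hTi, norm_sq_eq_integral, ← integral_const_mul]
    have h2 := memLp_prodLp_iff.1 (Lp.memLp x)
    refine integral_mono (((Lp.memLp x).integrable_norm_pow two_ne_zero).const_mul τ)
      (((h2.1.integrable_mul h2.1).const_mul τ).add
        (integrable_inner_of_memLp (memLp_mobilityMap hq hτ hτ' hξ h2.2) h2.2)) fun z => ?_
    change τ * ‖x z‖ ^ 2 ≤ τ * ((x z).fst * (x z).fst) +
        inner ℝ (mobilityMap q τ (ξ z) (x z).snd) (x z).snd
    rw [WithLp.prod_norm_sq_eq_of_L2, Real.norm_eq_abs, sq_abs]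
    linarith [le_inner_mobilityMap hq hτ (ξ z) (x z).snd]
  have hF2 : MemLp (fun z => (WithLp.toLp 2 (F z, (0 : Plane)) : WithLp 2 (ℝ × Plane))) 2
      (volume.restrict Ω) := memLp_prodLp_iff.2 ⟨hF, MemLp.zero'⟩
  obtain ⟨x, hx, hsol⟩ := exists_inner_eq_of_coercive (sobolevGraph Ω hΩf)
    (isClosed_sobolevGraph hΩf) T hτ hco hF2.toLp
  have hxW : IsW1 Ω 2 (fun z => (x z).fst) (fun z => (x z).snd) := hx
  refine ⟨_, _, hxW, fun φ Gφ hφ => ?_⟩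
  have hφ2 : MemLp (fun z => (WithLp.toLp 2 (φ z, Gφ z) : WithLp 2 (ℝ × Plane))) 2
      (volume.restrict Ω) := memLp_prodLp_iff.2 ⟨hφ.memLp, hφ.memLp_grad⟩
  have hφe := hφ2.coeFn_toLp
  have hmem : hφ2.toLp ∈ sobolevGraph Ω hΩf := by
    refine hφ.congr_ae ?_ ?_ <;>
    · filter_upwards [hφe] with z hz
      rw [hz]
      rfl
  have h1 := hsol _ hmem
  have h2 : inner ℝ (T x) hφ2.toLp = ∫ z in Ω, (τ * ((x z).fst * φ z) +
        inner ℝ (mobilityMap q τ (ξ z) (x z).snd) (Gφ z)) := by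
    rw [hTi]
    refine integral_congr_ae ?_
    filter_upwards [hφe] with z hz
    rw [hz]
    rfl
  have h3 : inner ℝ hF2.toLp hφ2.toLp = ∫ z in Ω, F z * φ z := by
    rw [L2.inner_def]
    refine integral_congr_ae ?_
    filter_upwards [hφe, hF2.coeFn_toLp] with z hz hz'
    rw [hz, hz', WithLp.prod_inner_apply]
    change inner ℝ (F z) (φ z) + inner ℝ (0 : Plane) (Gφ z) = _
    rw [real_inner_eq_mul, inner_zero_left, add_zero]
  rw [h2, h3, integral_add (f := fun z => τ * ((x z).fst * φ z)) ((hxW.memLp.integrable_mul hφ.memLp).const_mul τ)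
    (integrable_inner_of_memLp (memLp_mobilityMap hq hτ hτ' hξ hxW.memLp_grad) hφ.memLp_grad),
    integral_const_mul] at h1
  linarith

lemma IsMobilitySolution.neg (hs : IsMobilitySolution Ω q τ ξ F v Gv) :
    IsMobilitySolution Ω q τ ξ (fun x => -F x) (fun x => -v x) (fun x => -Gv x) := by
  refine ⟨hs.isW1.neg, fun φ Gφ hφ => ?_⟩
  have := hs.integral_eq φ Gφ hφ
  simp only [mobilityMap_neg, inner_neg_left, neg_mul, integral_neg]
  linarith

/-- The maximum principle, by testing with `(v - k)⁺`. -/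
lemma IsMobilitySolution.ae_le (hs : IsMobilitySolution Ω q τ ξ F v Gv) (hΩo : IsOpen Ω)
    (hΩf : volume Ω ≠ ⊤) (hq : 0 ≤ q) (hτ : 0 < τ) (hF : AEStronglyMeasurable F (volume.restrict Ω))
    (hFM : ∀ᵐ x ∂volume.restrict Ω, |F x| ≤ M) {k : ℝ} (hMk : M < τ * k) :
    ∀ᵐ x ∂volume.restrict Ω, v x ≤ k := by
  have hW := hs.isW1.posPart hΩo hΩf one_le_two k
  have h1 := hs.integral_eq _ _ hW
  have i0 := hW.integrableOn hΩf one_le_two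
  have i1 : IntegrableOn (fun x => F x * max (v x - k) 0) Ω := i0.bdd_mul hF hFM
  have i2 : IntegrableOn (fun x => v x * max (v x - k) 0) Ω :=
    hs.isW1.memLp.integrable_mul hW.memLp
  have h2 : 0 ≤ ∫ x in Ω, inner ℝ (mobilityMap q τ (ξ x) (Gv x))
      ({x | k < v x}.indicator Gv x) := by
    refine integral_nonneg fun x => ?_
    by_cases hx : x ∈ {x | k < v x}
    · simp only [indicator_of_mem hx]
      exact le_trans (by positivity) (le_inner_mobilityMap hq hτ _ _)
    · simp only [indicator_of_notMem hx, inner_zero_right, Pi.zero_apply, le_refl]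
  have h3 : ∫ x in Ω, (τ * k - M) * max (v x - k) 0 ≤
      ∫ x in Ω, (τ * (v x * max (v x - k) 0) - F x * max (v x - k) 0) := by
    refine integral_mono_ae (i0.const_mul _) ((i2.const_mul τ).sub i1) ?_
    filter_upwards [hFM] with x hx
    rcases le_total (v x) k with h | h
    · simp [max_eq_right (sub_nonpos.2 h)]
    · have h6 := (abs_le.1 hx).2
      have h7 := mul_le_mul_of_nonneg_left h hτ.le
      have h8 : τ * k - M ≤ τ * v x - F x := by linarith
      have := mul_le_mul_of_nonneg_right h8 (le_max_right (v x - k) 0)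
      linarith
  rw [integral_sub (i2.const_mul τ) i1, integral_const_mul, integral_const_mul] at h3
  have h4 : ∫ x in Ω, max (v x - k) 0 = 0 := by
    refine le_antisymm ?_ (integral_nonneg fun x => le_max_right _ _)
    by_contra! h
    have := mul_pos (sub_pos.2 hMk) h
    linarith
  exact ae_le_of_integral_posPart_eq_zero i0 h4

lemma IsMobilitySolution.ae_abs_le (hs : IsMobilitySolution Ω q τ ξ F v Gv) (hΩo : IsOpen Ω)
    (hΩf : volume Ω ≠ ⊤) (hq : 0 ≤ q) (hτ : 0 < τ) (hF : AEStronglyMeasurable F (volume.restrict Ω))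
    (hFM : ∀ᵐ x ∂volume.restrict Ω, |F x| ≤ M) {k : ℝ} (hMk : M < τ * k) :
    ∀ᵐ x ∂volume.restrict Ω, |v x| ≤ k := by
  have h1 := hs.ae_le hΩo hΩf hq hτ hF hFM hMk
  have h2 := hs.neg.ae_le hΩo hΩf hq hτ hF.neg (by simpa using hFM) hMk
  filter_upwards [h1, h2] with x hx hx'
  exact abs_le.2 ⟨by linarith, hx⟩

lemma memLp_two_of_ae_abs_le {μ : Measure Plane} [IsFiniteMeasure μ]
    (hF : AEStronglyMeasurable F μ) (hFM : ∀ᵐ x ∂μ, |F x| ≤ M) : MemLp F 2 μ :=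
  MemLp.of_bound hF M hFM

/-- The energy estimate. -/
lemma IsMobilitySolution.energy_le (hs : IsMobilitySolution Ω q τ ξ F v Gv) (hΩf : volume Ω ≠ ⊤)
    (hq : 0 ≤ q) (hτ : 0 < τ) (hτ' : τ ≤ 1) (hξ : AEStronglyMeasurable ξ (volume.restrict Ω))
    (hF : AEStronglyMeasurable F (volume.restrict Ω))
    (hFM : ∀ᵐ x ∂volume.restrict Ω, |F x| ≤ M) :
    τ * (∫ x in Ω, ‖Gv x‖ ^ 2) + τ / 2 * (∫ x in Ω, ‖v x‖ ^ 2) ≤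
      M ^ 2 / (2 * τ) * volume.real Ω := by
  have : IsFiniteMeasure (volume.restrict Ω) := ⟨by simpa using hΩf.lt_top⟩
  have hW := hs.isW1
  have h1 := hs.integral_eq _ _ hW
  have i1 := integrable_inner_of_memLp (memLp_mobilityMap hq hτ hτ' hξ hW.memLp_grad) hW.memLp_grad
  have i2 : IntegrableOn (fun x => F x * v x) Ω := (hW.integrableOn hΩf one_le_two).bdd_mul hF hFM
  have i3 : IntegrableOn (fun x => v x * v x) Ω := hW.memLp.integrable_mul hW.memLp
  have i4 : IntegrableOn (fun x => ‖Gv x‖ ^ 2) Ω := hW.memLp_grad.integrable_norm_pow two_ne_zero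
  have i5 : IntegrableOn (fun x => ‖v x‖ ^ 2) Ω := hW.memLp.integrable_norm_pow two_ne_zero
  have h2 : τ * (∫ x in Ω, ‖Gv x‖ ^ 2) ≤ ∫ x in Ω, inner ℝ (mobilityMap q τ (ξ x) (Gv x)) (Gv x) := by
    rw [← integral_const_mul]
    exact integral_mono (i4.const_mul τ) i1 fun x => le_inner_mobilityMap hq hτ _ _
  have h3 : ∫ x in Ω, v x * v x = ∫ x in Ω, ‖v x‖ ^ 2 :=
    integral_congr_ae (ae_of_all _ fun x => by
      change v x * v x = ‖v x‖ ^ 2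
      rw [Real.norm_eq_abs, sq_abs, sq])
  have h4 : ∫ x in Ω, F x * v x ≤ ∫ x in Ω, (M ^ 2 / (2 * τ) + τ / 2 * ‖v x‖ ^ 2) := by
    refine integral_mono_ae i2 ((integrable_const _).add (i5.const_mul _)) ?_
    filter_upwards [hFM] with x hx
    have h5 : F x * v x ≤ M * ‖v x‖ := by
      refine (le_abs_self _).trans ?_
      rw [abs_mul]
      exact mul_le_mul_of_nonneg_right hx (abs_nonneg _)
    have h6 : M * ‖v x‖ ≤ M ^ 2 / (2 * τ) + τ / 2 * ‖v x‖ ^ 2 := by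
      have h7 : M ^ 2 / (2 * τ) + τ / 2 * ‖v x‖ ^ 2 = (M ^ 2 + τ ^ 2 * ‖v x‖ ^ 2) / (2 * τ) := by
        field_simp
      rw [h7, le_div_iff₀ (by positivity)]
      nlinarith [sq_nonneg (M - τ * ‖v x‖)]
    exact h5.trans h6
  rw [integral_add (integrable_const _) (i5.const_mul _), integral_const_mul] at h4
  simp only [integral_const, smul_eq_mul, measureReal_restrict_apply_univ] at h4
  rw [h3] at h1
  linarith

/-- The difference of two solutions with different coefficients, tested with itself. -/
lemma IsMobilitySolution.integral_sq_sub_le {ξ' : Plane → Plane} {F' : Plane → ℝ}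
    (hs : IsMobilitySolution Ω q τ ξ F v Gv) (hs' : IsMobilitySolution Ω q τ ξ' F' w Gw)
    (hΩf : volume Ω ≠ ⊤) (hq : 0 ≤ q) (hτ : 0 < τ) (hτ' : τ ≤ 1)
    (hξ : AEStronglyMeasurable ξ (volume.restrict Ω))
    (hξ' : AEStronglyMeasurable ξ' (volume.restrict Ω))
    (hF : MemLp F 2 (volume.restrict Ω)) (hF' : MemLp F' 2 (volume.restrict Ω)) :
    τ / 2 * ∫ x in Ω, ‖v x - w x‖ ^ 2 ≤ 1 / (2 * τ) * ∫ x in Ω, (‖F x - F' x‖ ^ 2 +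
      ‖mobilityMap q τ (ξ x) (Gw x) - mobilityMap q τ (ξ' x) (Gw x)‖ ^ 2) := by
  have hW := hs.isW1
  have hW' := hs'.isW1
  have hd := hW.sub hW' hΩf one_le_two
  have e1 := hs.integral_eq _ _ hd
  have e2 := hs'.integral_eq _ _ hd
  have m1 := memLp_mobilityMap hq hτ hτ' hξ hW.memLp_grad
  have m2 := memLp_mobilityMap hq hτ hτ' hξ' hW'.memLp_grad
  have m3 := memLp_mobilityMap hq hτ hτ' hξ hW'.memLp_grad
  have i1 := integrable_inner_of_memLp m1 hd.memLp_grad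
  have i2 := integrable_inner_of_memLp m2 hd.memLp_grad
  have i3 : IntegrableOn (fun x => v x * (v x - w x)) Ω := hW.memLp.integrable_mul hd.memLp
  have i4 : IntegrableOn (fun x => w x * (v x - w x)) Ω := hW'.memLp.integrable_mul hd.memLp
  have i5 : IntegrableOn (fun x => F x * (v x - w x)) Ω := hF.integrable_mul hd.memLp
  have i6 : IntegrableOn (fun x => F' x * (v x - w x)) Ω := hF'.integrable_mul hd.memLp
  have i7 : IntegrableOn (fun x => ‖v x - w x‖ ^ 2) Ω := hd.memLp.integrable_norm_pow two_ne_zero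
  have i8 : IntegrableOn (fun x => ‖F x - F' x‖ ^ 2 +
      ‖mobilityMap q τ (ξ x) (Gw x) - mobilityMap q τ (ξ' x) (Gw x)‖ ^ 2) Ω :=
    ((hF.sub hF').integrable_norm_pow two_ne_zero).add
      ((m3.sub m2).integrable_norm_pow two_ne_zero)
  have h1 : ∫ x in Ω, τ / 2 * ‖v x - w x‖ ^ 2 ≤ ∫ x in Ω, (1 / (2 * τ) * (‖F x - F' x‖ ^ 2 +
      ‖mobilityMap q τ (ξ x) (Gw x) - mobilityMap q τ (ξ' x) (Gw x)‖ ^ 2) +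
      ((inner ℝ (mobilityMap q τ (ξ x) (Gv x)) (Gv x - Gw x) -
        inner ℝ (mobilityMap q τ (ξ' x) (Gw x)) (Gv x - Gw x)) +
        τ * (v x * (v x - w x) - w x * (v x - w x)) -
        (F x * (v x - w x) - F' x * (v x - w x)))) := by
    refine integral_mono (i7.const_mul _) ((i8.const_mul _).add
      (((i1.sub i2).add ((i3.sub i4).const_mul τ)).sub (i5.sub i6))) fun x => ?_
    have k1 := le_inner_mobilityMap hq hτ (ξ x) (Gv x - Gw x)
    rw [mobilityMap_sub, inner_sub_left] at k1
    set N := mobilityMap q τ (ξ x) (Gw x) - mobilityMap q τ (ξ' x) (Gw x) with hN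
    have k2 : -(‖N‖ * ‖Gv x - Gw x‖) ≤ inner ℝ (mobilityMap q τ (ξ x) (Gw x)) (Gv x - Gw x) -
        inner ℝ (mobilityMap q τ (ξ' x) (Gw x)) (Gv x - Gw x) := by
      rw [← inner_sub_left]
      exact (abs_le.1 (abs_real_inner_le_norm N _)).1
    have young : ∀ a b : ℝ, a * b ≤ 1 / (2 * τ) * a ^ 2 + τ / 2 * b ^ 2 := fun a b => by
      have h7 : 1 / (2 * τ) * a ^ 2 + τ / 2 * b ^ 2 = (a ^ 2 + τ ^ 2 * b ^ 2) / (2 * τ) := by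
        field_simp
      rw [h7, le_div_iff₀ (by positivity)]
      nlinarith [sq_nonneg (a - τ * b)]
    have k3 := young ‖N‖ ‖Gv x - Gw x‖
    have k4 := young (F x - F' x) (v x - w x)
    have k5 : 0 ≤ τ / 2 * ‖Gv x - Gw x‖ ^ 2 := by positivity
    simp only [Real.norm_eq_abs, sq_abs] at *
    nlinarith
  have iI : IntegrableOn (fun x => inner ℝ (mobilityMap q τ (ξ x) (Gv x)) (Gv x - Gw x) -
      inner ℝ (mobilityMap q τ (ξ' x) (Gw x)) (Gv x - Gw x)) Ω := i1.sub i2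
  have iV : IntegrableOn (fun x => τ * (v x * (v x - w x) - w x * (v x - w x))) Ω :=
    (i3.sub i4).const_mul τ
  have iA : IntegrableOn (fun x => (inner ℝ (mobilityMap q τ (ξ x) (Gv x)) (Gv x - Gw x) -
      inner ℝ (mobilityMap q τ (ξ' x) (Gw x)) (Gv x - Gw x)) +
      τ * (v x * (v x - w x) - w x * (v x - w x))) Ω := iI.add iV
  have iB : IntegrableOn (fun x => F x * (v x - w x) - F' x * (v x - w x)) Ω := i5.sub i6
  have hA : ∫ x in Ω, ((inner ℝ (mobilityMap q τ (ξ x) (Gv x)) (Gv x - Gw x) -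
      inner ℝ (mobilityMap q τ (ξ' x) (Gw x)) (Gv x - Gw x)) +
      τ * (v x * (v x - w x) - w x * (v x - w x)) -
      (F x * (v x - w x) - F' x * (v x - w x))) = 0 := by
    rw [integral_sub iA iB, integral_add iI iV,
      integral_sub i1 i2, integral_const_mul, integral_sub i3 i4, integral_sub i5 i6]
    linarith
  have iAB : IntegrableOn (fun x => (inner ℝ (mobilityMap q τ (ξ x) (Gv x)) (Gv x - Gw x) -
      inner ℝ (mobilityMap q τ (ξ' x) (Gw x)) (Gv x - Gw x)) +
      τ * (v x * (v x - w x) - w x * (v x - w x)) -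
      (F x * (v x - w x) - F' x * (v x - w x))) Ω := iA.sub iB
  rw [integral_add (i8.const_mul _) iAB, integral_const_mul, integral_const_mul] at h1
  linarith

/-- Continuous dependence on the coefficient field and on the right-hand side. -/
theorem tendsto_of_isMobilitySolution {ξn : ℕ → Plane → Plane} {Fn vn : ℕ → Plane → ℝ}
    {Gn : ℕ → Plane → Plane} (hs : ∀ n, IsMobilitySolution Ω q τ (ξn n) (Fn n) (vn n) (Gn n))
    (hs' : IsMobilitySolution Ω q τ ξ F v Gv)
    (hΩf : volume Ω ≠ ⊤) (hq : 0 ≤ q) (hτ : 0 < τ) (hτ' : τ ≤ 1)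
    (hξn : ∀ n, IntegrableOn (ξn n) Ω) (hξ : IntegrableOn ξ Ω)
    (hFn : ∀ n, AEStronglyMeasurable (Fn n) (volume.restrict Ω))
    (hF : AEStronglyMeasurable F (volume.restrict Ω))
    (hFnM : ∀ n, ∀ᵐ x ∂volume.restrict Ω, |Fn n x| ≤ M)
    (hFM : ∀ᵐ x ∂volume.restrict Ω, |F x| ≤ M)
    (hξl : Tendsto (fun n => ∫ x in Ω, ‖ξn n x - ξ x‖) atTop (𝓝 0))
    (hFl : Tendsto (fun n => ∫ x in Ω, ‖Fn n x - F x‖) atTop (𝓝 0)) :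
    Tendsto (fun n => ∫ x in Ω, ‖vn n x - v x‖) atTop (𝓝 0) := by
  have : IsFiniteMeasure (volume.restrict Ω) := ⟨by simpa using hΩf.lt_top⟩
  -- along a subsequence the coefficients converge almost everywhere; dominated convergence then needs
  -- no more than `Gv ∈ L²`
  refine tendsto_of_subseq_tendsto fun ns hns => ?_
  obtain ⟨ks, hks, hks'⟩ := exists_subseq_ae_tendsto (fun n => hξn (ns n)) hξ (hξl.comp hns)
  obtain ⟨ls, hls, hls'⟩ := exists_subseq_ae_tendsto (fun n => Integrable.of_bound (hFn (ns (ks n)))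
    M (hFnM _)) (Integrable.of_bound hF M hFM) (hFl.comp (hns.comp hks.tendsto_atTop))
  refine ⟨fun n => ks (ls n), ?_⟩
  set r : ℕ → ℕ := fun n => ns (ks (ls n))
  refine tendsto_integral_norm_of_sq (f := fun n x => vn (r n) x - v x)
    (fun n => (hs (r n)).isW1.memLp.sub hs'.isW1.memLp) ?_
  set R : ℕ → Plane → ℝ := fun n x => ‖Fn (r n) x - F x‖ ^ 2 +
    ‖mobilityMap q τ (ξn (r n) x) (Gv x) - mobilityMap q τ (ξ x) (Gv x)‖ ^ 2
  have hG := hs'.isW1.memLp_grad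
  have hR : Tendsto (fun n => ∫ x in Ω, R n x) atTop (𝓝 (∫ _ in Ω, (0 : ℝ))) := by
    refine tendsto_integral_of_dominated_convergence
      (fun x => (2 * M) ^ 2 + 36 * ‖Gv x‖ ^ 2) (fun n => ?_)
      ((integrable_const _).add ((hG.integrable_norm_pow two_ne_zero).const_mul 36))
      (fun n => ?_) ?_
    · exact (((hFn _).sub hF).norm.pow 2).add
        (((aestronglyMeasurable_mobilityMap hq hτ (hξn _).1 hG.1).sub
          (aestronglyMeasurable_mobilityMap hq hτ hξ.1 hG.1)).norm.pow 2)
    · filter_upwards [ae_abs_sub_le (hFnM (r n)) hFM] with x hx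
      rw [Real.norm_of_nonneg (by positivity)]
      have h1 : ‖mobilityMap q τ (ξn (r n) x) (Gv x) - mobilityMap q τ (ξ x) (Gv x)‖ ≤
          6 * ‖Gv x‖ := (norm_sub_le _ _).trans (by
        linarith [norm_mobilityMap_le hq hτ hτ' (ξn (r n) x) (Gv x),
          norm_mobilityMap_le hq hτ hτ' (ξ x) (Gv x)])
      have h2 := pow_le_pow_left₀ (norm_nonneg _) h1 2
      have h3 := pow_le_pow_left₀ (abs_nonneg _) hx 2
      rw [mul_pow] at h2
      simp only [R]
      rw [Real.norm_eq_abs]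
      linarith
    · filter_upwards [hks', hls'] with x hx hx'
      have h1 : Tendsto (fun n => ξn (r n) x) atTop (𝓝 (ξ x)) := hx.comp hls.tendsto_atTop
      have hc : Continuous fun ζ => mobilityMap q τ ζ (Gv x) :=
        (continuous_mobilityMap hq hτ).comp (g := fun z : Plane × Plane => mobilityMap q τ z.1 z.2)
          (f := fun ζ => (ζ, Gv x)) (by fun_prop)
      have h2 : Tendsto (fun n => mobilityMap q τ (ξn (r n) x) (Gv x)) atTop
          (𝓝 (mobilityMap q τ (ξ x) (Gv x))) :=
        (hc.tendsto _).comp h1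
      have h3 := (tendsto_iff_norm_sub_tendsto_zero.1 h2).pow 2
      have h4 := (tendsto_iff_norm_sub_tendsto_zero.1 hx').pow 2
      have h5 := h4.add h3
      rw [zero_pow two_ne_zero, add_zero] at h5
      exact h5
  rw [integral_zero] at hR
  have hR' := hR.const_mul (2 / τ * (1 / (2 * τ)))
  rw [mul_zero] at hR'
  refine squeeze_zero (fun n => integral_nonneg fun x => by positivity) (fun n => ?_) hR'
  have h1 := (hs (r n)).integral_sq_sub_le hs' hΩf hq hτ hτ' (hξn _).1 hξ.1
    (memLp_two_of_ae_abs_le (hFn _) (hFnM _)) (memLp_two_of_ae_abs_le hF hFM)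
  have h2 := mul_le_mul_of_nonneg_left h1 (by positivity : 0 ≤ 2 / τ)
  rwa [← mul_assoc, show 2 / τ * (τ / 2) = 1 by field_simp, one_mul, ← mul_assoc] at h2

end MobilityEquation

/-! ### The system with a truncated coupling -/

section FixedPoint

variable {p q a β τ M L : ℝ} {Ω : Set Plane} {f g h : Plane → ℝ} {u v : Plane → ℝ}
  {G Gv : Plane → Plane}

lemma IsFluxSolution.congr_rhs (hs : IsFluxSolution Ω p β τ g u G)
    (hgh : g =ᵐ[volume.restrict Ω] h) : IsFluxSolution Ω p β τ h u G := by
  refine ⟨hs.isW1, fun φ Gφ hφ => (hs.integral_eq φ Gφ hφ).trans (integral_congr_ae ?_)⟩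
  filter_upwards [hgh] with x hx
  rw [hx]

lemma ae_abs_sub_const_mul_le {μ : Measure Plane} {K : ℝ} (ha : 0 ≤ a)
    (hfL : ∀ᵐ x ∂μ, |f x| ≤ L) (huK : ∀ᵐ x ∂μ, |u x| ≤ K) :
    ∀ᵐ x ∂μ, |f x - a * u x| ≤ L + a * K := by
  filter_upwards [hfL, huK] with x hx hx'
  refine (abs_sub _ _).trans (add_le_add hx ?_)
  rw [abs_mul, abs_of_nonneg ha]
  gcongr

/-- Continuous dependence of `v` on `g`, when `u` solves the flux equation with right-hand side `g`
and `v` solves the mobility equation determined by `u`. -/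
lemma tendsto_integral_norm_sub_of_rhs (hΩo : IsOpen Ω) (hΩf : volume Ω ≠ ⊤) (hp : 1 < p)
    (hq : 0 ≤ q) (ha : 0 ≤ a) (hβ : 0 < β) (hτ : 0 < τ) (hτ' : τ ≤ 1) (hM : 0 ≤ M)
    (hf : AEStronglyMeasurable f (volume.restrict Ω)) (hfL : ∀ᵐ x ∂volume.restrict Ω, |f x| ≤ L)
    {gn un vn : ℕ → Plane → ℝ} {Gn Gvn : ℕ → Plane → Plane}
    (hgn : ∀ n, AEStronglyMeasurable (gn n) (volume.restrict Ω))
    (hg : AEStronglyMeasurable g (volume.restrict Ω))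
    (hgnM : ∀ n, ∀ᵐ x ∂volume.restrict Ω, |gn n x| ≤ M)
    (hgM : ∀ᵐ x ∂volume.restrict Ω, |g x| ≤ M)
    (hun : ∀ n, IsFluxSolution Ω p β τ (gn n) (un n) (Gn n)) (hu : IsFluxSolution Ω p β τ g u G)
    (hvn : ∀ n, IsMobilitySolution Ω q τ (Gn n) (fun x => f x - a * un n x) (vn n) (Gvn n))
    (hv : IsMobilitySolution Ω q τ G (fun x => f x - a * u x) v Gv)
    (hl : Tendsto (fun n => ∫ x in Ω, ‖gn n x - g x‖) atTop (𝓝 0)) :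
    Tendsto (fun n => ∫ x in Ω, ‖vn n x - v x‖) atTop (𝓝 0) := by
  have hp1 := one_le_ofReal hp
  obtain ⟨K, hK0, hK⟩ := exists_abs_le_of_isFluxSolution (p := p) (β := β) hΩo hΩf hp hβ hτ hM
  have hsmall : ∀ ε > 0, ∃ N, ∀ n ≥ N, ∫ x in Ω, ‖un n x - u x‖ ≤ ε ∧
      ∫ x in Ω, ‖Gn n x - G x‖ ≤ ε := by
    intro ε hε
    obtain ⟨C, hC0, hC⟩ := exists_integral_norm_sub_le_of_isFluxSolution (p := p) (β := β) hΩo hΩf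
      hp hβ hτ hτ' hM (half_pos hε)
    obtain ⟨N, hN⟩ := Metric.tendsto_atTop.1 hl (ε / (2 * (C + 1))) (by positivity)
    refine ⟨N, fun n hn => ?_⟩
    have h1 := hN n hn
    rw [Real.dist_0_eq_abs] at h1
    have h2 := ((le_abs_self _).trans_lt h1).le
    have h3 : C * ∫ x in Ω, ‖gn n x - g x‖ ≤ ε / 2 := by
      refine (mul_le_mul_of_nonneg_left h2 hC0).trans ?_
      rw [mul_div_assoc', div_le_div_iff₀ (by positivity) two_pos]
      nlinarith
    have h4 := hC _ _ _ _ _ _ (hun n) hu (hgn n) hg (hgnM n) hgM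
    exact ⟨by linarith [h4.1], by linarith [h4.2]⟩
  have lim : ∀ {b : ℕ → ℝ}, (∀ n, 0 ≤ b n) → (∀ ε > 0, ∃ N, ∀ n ≥ N, b n ≤ ε) →
      Tendsto b atTop (𝓝 0) := by
    intro b hb0 hb
    refine Metric.tendsto_atTop.2 fun ε hε => ?_
    obtain ⟨N, hN⟩ := hb (ε / 2) (half_pos hε)
    refine ⟨N, fun n hn => ?_⟩
    rw [Real.dist_0_eq_abs, abs_of_nonneg (hb0 n)]
    linarith [hN n hn]
  have hul : Tendsto (fun n => ∫ x in Ω, ‖un n x - u x‖) atTop (𝓝 0) :=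
    lim (fun n => integral_nonneg fun x => norm_nonneg _) fun ε hε =>
      (hsmall ε hε).imp fun N hN n hn => (hN n hn).1
  have hGl : Tendsto (fun n => ∫ x in Ω, ‖Gn n x - G x‖) atTop (𝓝 0) :=
    lim (fun n => integral_nonneg fun x => norm_nonneg _) fun ε hε =>
      (hsmall ε hε).imp fun N hN n hn => (hN n hn).2
  have hFl : Tendsto (fun n => ∫ x in Ω, ‖(f x - a * un n x) - (f x - a * u x)‖) atTop (𝓝 0) := by
    have h1 : ∀ n, ∫ x in Ω, ‖(f x - a * un n x) - (f x - a * u x)‖ =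
        a * ∫ x in Ω, ‖un n x - u x‖ := fun n => by
      rw [← integral_const_mul]
      refine integral_congr_ae (ae_of_all _ fun x => ?_)
      change ‖(f x - a * un n x) - (f x - a * u x)‖ = a * ‖un n x - u x‖
      rw [show (f x - a * un n x) - (f x - a * u x) = -(a * (un n x - u x)) by ring, norm_neg,
        norm_mul, Real.norm_of_nonneg ha]
    simp_rw [h1]
    simpa using hul.const_mul a
  exact tendsto_of_isMobilitySolution hvn hv hΩf hq hτ hτ'
    (fun n => (hun n).isW1.integrableOn_grad hΩf hp1) (hu.isW1.integrableOn_grad hΩf hp1)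
    (fun n => hf.sub ((hun n).isW1.memLp.1.const_mul a)) (hf.sub (hu.isW1.memLp.1.const_mul a))
    (fun n => ae_abs_sub_const_mul_le ha hfL (hK _ _ _ (hun n) (hgn n) (hgnM n)))
    (ae_abs_sub_const_mul_le ha hfL (hK _ _ _ hu hg hgM)) hGl hFl

lemma cellValue_sub {w w' : Plane → ℝ} (hw : IntegrableOn w Ω)
    (hw' : IntegrableOn w' Ω) (m : ℕ) (i : ℤ × ℤ) :
    cellValue Ω w m i - cellValue Ω w' m i = cellValue Ω (fun x => w x - w' x) m i := by
  unfold cellValue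
  split_ifs with hc
  · rw [setAverage_eq, setAverage_eq, setAverage_eq, ← smul_sub,
      integral_sub (hw.mono_set hc) (hw'.mono_set hc)]
  · rw [sub_zero]

/-- Brouwer's theorem, applied to the finitely many cell averages of `v`. -/
theorem exists_solution_cellAverage (hΩo : IsOpen Ω) (hΩf : volume Ω ≠ ⊤) (hp : 1 < p)
    (hq : 0 ≤ q) (ha : 0 ≤ a) (hβ : 0 < β) (hτ : 0 < τ) (hτ' : τ ≤ 1) (hM : 0 ≤ M)
    (hf : AEStronglyMeasurable f (volume.restrict Ω)) (hfL : ∀ᵐ x ∂volume.restrict Ω, |f x| ≤ L)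
    (m : ℕ) : ∃ u G v Gv, IsFluxSolution Ω p β τ (fun x => clip M (cellAverage Ω m v x)) u G ∧
      IsMobilitySolution Ω q τ G (fun x => f x - a * u x) v Gv := by
  classical
  have : IsFiniteMeasure (volume.restrict Ω) := ⟨by simpa using hΩf.lt_top⟩
  have hp1 := one_le_ofReal hp
  obtain ⟨K, hK0, hK⟩ := exists_abs_le_of_isFluxSolution (p := p) (β := β) hΩo hΩf hp hβ hτ hM
  set I := {i : ℤ × ℤ // cell m i ⊆ Ω}
  have : Fintype I := (finite_setOf_cell_subset hΩf m).fintype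
  set E := EuclideanSpace ℝ I
  set g : E → Plane → ℝ := fun c x =>
    clip M (if hc : cell m (cellIndex m x) ⊆ Ω then c ⟨_, hc⟩ else 0) with hg
  have hgm : ∀ c, AEStronglyMeasurable (g c) (volume.restrict Ω) := fun c =>
    ((measurable_of_countable fun i : ℤ × ℤ =>
      clip M (if hc : cell m i ⊆ Ω then c ⟨i, hc⟩ else 0)).comp
        (measurable_cellIndex m)).aestronglyMeasurable
  have hgM : ∀ c, ∀ᵐ x ∂volume.restrict Ω, |g c x| ≤ M := fun c =>
    ae_of_all _ fun x => abs_clip_le hM _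
  choose U GU hU using fun c => exists_isFluxSolution hΩo hΩf hp hβ hτ hτ' (hgm c) hM (hgM c)
  have hFm : ∀ c, AEStronglyMeasurable (fun x => f x - a * U c x) (volume.restrict Ω) := fun c =>
    hf.sub ((hU c).isW1.memLp.1.const_mul a)
  choose V GV hV using fun c => exists_isMobilitySolution (F := fun x => f x - a * U c x) hΩf hq hτ
    hτ' (hU c).isW1.memLp_grad.1 (memLp_two_of_ae_abs_le (hFm c)
      (ae_abs_sub_const_mul_le ha hfL (hK _ _ _ (hU c) (hgm c) (hgM c))))
  have hVi : ∀ c, IntegrableOn (V c) Ω := fun c => (hV c).isW1.integrableOn hΩf one_le_two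
  set Φ : E → E := fun c => WithLp.toLp 2 fun i : I => clip M (cellValue Ω (V c) m i)
  have hΦi : ∀ c i, Φ c i = clip M (cellValue Ω (V c) m i) := fun c i => rfl
  set R : ℝ := √(Fintype.card I * M ^ 2) + 1
  have hR : 0 < R := by positivity
  have hΦR : ∀ c, ‖Φ c‖ ≤ R := fun c => by
    rw [EuclideanSpace.norm_eq]
    refine le_trans (Real.sqrt_le_sqrt ?_) (le_add_of_nonneg_right zero_le_one)
    rw [← nsmul_eq_mul, ← Finset.card_univ]
    refine Finset.sum_le_card_nsmul _ _ _ fun i _ => ?_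
    rw [hΦi, Real.norm_eq_abs]
    exact pow_le_pow_left₀ (abs_nonneg _) (abs_clip_le hM _) 2
  have hVcont : ∀ (c : E) (cn : ℕ → E), Tendsto cn atTop (𝓝 c) →
      Tendsto (fun n => ∫ x in Ω, ‖V (cn n) x - V c x‖) atTop (𝓝 0) := by
    intro c cn hcn
    refine tendsto_integral_norm_sub_of_rhs hΩo hΩf hp hq ha hβ hτ hτ' hM hf hfL
      (fun n => hgm (cn n)) (hgm c) (fun n => hgM (cn n)) (hgM c) (fun n => hU _) (hU c)
      (fun n => hV _) (hV c) ?_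
    have h1 := (tendsto_iff_norm_sub_tendsto_zero.1 hcn).mul_const (volume.real Ω)
    rw [zero_mul] at h1
    refine squeeze_zero (fun n => integral_nonneg fun x => norm_nonneg _) (fun n => ?_) h1
    have h2 : ∫ x in Ω, ‖g (cn n) x - g c x‖ ≤ ∫ _ in Ω, ‖cn n - c‖ := by
      refine integral_mono_of_nonneg (ae_of_all _ fun x => norm_nonneg _) (integrable_const _)
        (ae_of_all _ fun x => (abs_clip_sub_clip_le _ _ _).trans ?_)
      split_ifs with hc
      · exact PiLp.norm_apply_le (cn n - c) _
      · rw [sub_zero, abs_zero]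
        exact norm_nonneg _
    simpa [mul_comm] using h2
  have hΦc : Continuous Φ := by
    refine continuous_iff_seqContinuous.2 fun cn c hcn => ?_
    have hcoord : ∀ i : I, Tendsto (fun n => Φ (cn n) i) atTop (𝓝 (Φ c i)) := fun i => by
      refine (continuous_clip M).continuousAt.tendsto.comp ?_
      rw [tendsto_iff_norm_sub_tendsto_zero]
      have h1 := (hVcont c cn hcn).const_mul
        (((1 / (2 * (m + 1))) ^ 2 * volume.real (ball (0 : Plane) 1))⁻¹)
      rw [mul_zero] at h1
      refine squeeze_zero (fun n => norm_nonneg _) (fun n => ?_) h1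
      rw [cellValue_sub (hVi _) (hVi _)]
      exact abs_cellValue_le ((hVi _).sub (hVi _)) m i
    exact ((PiLp.continuous_toLp 2 fun _ : I => ℝ).tendsto _).comp (tendsto_pi_nhds.2 hcoord)
  -- `Φ` takes values in the ball of radius `R`, which is rescaled to the unit ball
  obtain ⟨x, hx⟩ := exists_fixedPoint_of_continuous (F := fun x : E => R⁻¹ • Φ (R • x))
    ((hΦc.comp (continuous_const_smul R)).const_smul R⁻¹) fun x => by
      rw [norm_smul, norm_inv, Real.norm_of_nonneg hR.le, inv_mul_le_iff₀ hR, mul_one]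
      exact hΦR _
  set c := R • x
  have hc : Φ c = c := by
    calc Φ c = R • (R⁻¹ • Φ c) := by rw [smul_smul, mul_inv_cancel₀ hR.ne', one_smul]
      _ = c := by rw [hx]
  refine ⟨U c, GU c, V c, GV c, (hU c).congr_rhs (ae_of_all _ fun x => ?_), hV c⟩
  simp only [hg, cellAverage]
  split_ifs with hi
  · have h1 : c ⟨_, hi⟩ = clip M (cellValue Ω (V c) m (cellIndex m x)) := by
      rw [← hΦi c ⟨cellIndex m x, hi⟩, hc]
    rw [h1, clip_eq_self (abs_clip_le hM _)]
  · rw [cellValue, if_neg hi]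

/-- Solvability of the system whose second equation has the truncated right-hand side. -/
theorem exists_solution_clip (hΩo : IsOpen Ω) (hΩf : volume Ω ≠ ⊤) (hp : 1 < p)
    (hq : 0 ≤ q) (ha : 0 ≤ a) (hβ : 0 < β) (hτ : 0 < τ) (hτ' : τ ≤ 1) (hM : 0 ≤ M)
    (hf : AEStronglyMeasurable f (volume.restrict Ω)) (hfL : ∀ᵐ x ∂volume.restrict Ω, |f x| ≤ L) :
    ∃ u G v Gv, IsFluxSolution Ω p β τ (fun x => clip M (v x)) u G ∧
      IsMobilitySolution Ω q τ G (fun x => f x - a * u x) v Gv := by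
  have : IsFiniteMeasure (volume.restrict Ω) := ⟨by simpa using hΩf.lt_top⟩
  have hp1 := one_le_ofReal hp
  obtain ⟨K, hK0, hK⟩ := exists_abs_le_of_isFluxSolution (p := p) (β := β) hΩo hΩf hp hβ hτ hM
  choose u G v Gv hu hv using fun m => exists_solution_cellAverage (Ω := Ω) (p := p) (q := q)
    (a := a) (β := β) (τ := τ) (M := M) (L := L) (f := f) hΩo hΩf hp hq ha hβ hτ hτ' hM hf hfL m
  have hgm : ∀ m, AEStronglyMeasurable (fun x => clip M (cellAverage Ω m (v m) x))
      (volume.restrict Ω) := fun m => (continuous_clip M).comp_aestronglyMeasurable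
        (measurable_cellAverage Ω m (v m)).aestronglyMeasurable
  have hgM : ∀ m, ∀ᵐ x ∂volume.restrict Ω, |clip M (cellAverage Ω m (v m) x)| ≤ M := fun m =>
    ae_of_all _ fun x => abs_clip_le hM _
  have hvi : ∀ m, IntegrableOn (v m) Ω := fun m => (hv m).isW1.integrableOn hΩf one_le_two
  set D := (L + a * K) ^ 2 / (2 * τ) * volume.real Ω
  have hen : ∀ m, τ * (∫ x in Ω, ‖Gv m x‖ ^ 2) + τ / 2 * (∫ x in Ω, ‖v m x‖ ^ 2) ≤ D := fun m =>
    (hv m).energy_le hΩf hq hτ hτ' (hu m).isW1.memLp_grad.1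
      (hf.sub ((hu m).isW1.memLp.1.const_mul a))
      (ae_abs_sub_const_mul_le ha hfL (hK _ _ _ (hu m) (hgm m) (hgM m)))
  have hn1 : ∀ m, 0 ≤ ∫ x in Ω, ‖Gv m x‖ ^ 2 := fun m => integral_nonneg fun x => by positivity
  have hn2 : ∀ m, 0 ≤ ∫ x in Ω, ‖v m x‖ ^ 2 := fun m => integral_nonneg fun x => by positivity
  set C := max (D / (τ / 2)) (volume.real Ω + D / τ)
  have hbv : ∀ m, ∫ x in Ω, |v m x| ^ (2 : ℝ) ≤ C := fun m => by
    simp only [Real.rpow_two]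
    refine le_trans ?_ (le_max_left _ _)
    rw [le_div_iff₀' (by positivity)]
    have := hen m
    simp only [Real.norm_eq_abs] at this
    linarith [mul_nonneg hτ.le (hn1 m)]
  have hbG : ∀ m, ∫ x in Ω, ‖Gv m x‖ ≤ C := fun m => by
    refine le_trans ?_ (le_max_right _ _)
    have i1 : IntegrableOn (fun x => ‖Gv m x‖ ^ 2) Ω :=
      (hv m).isW1.memLp_grad.integrable_norm_pow two_ne_zero
    have h1 : ∫ x in Ω, ‖Gv m x‖ ≤ ∫ x in Ω, (1 + ‖Gv m x‖ ^ 2) :=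
      integral_mono ((hv m).isW1.integrableOn_grad hΩf one_le_two).norm
        ((integrable_const _).add i1) fun x => by
          have := sq_nonneg (‖Gv m x‖ - 1)
          change ‖Gv m x‖ ≤ 1 + ‖Gv m x‖ ^ 2
          nlinarith [norm_nonneg (Gv m x)]
    rw [integral_add (integrable_const _) i1] at h1
    simp only [integral_const, smul_eq_mul, measureReal_restrict_apply_univ, mul_one] at h1
    have h2 : ∫ x in Ω, ‖Gv m x‖ ^ 2 ≤ D / τ := by
      rw [le_div_iff₀' hτ]
      linarith [hen m, mul_nonneg (half_pos hτ).le (hn2 m)]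
    linarith
  have hW : ∀ m, IsW1 Ω (ENNReal.ofReal 2) (v m) (Gv m) := fun m => by
    simpa using (hv m).isW1
  obtain ⟨ns, w, hns, hwi, hw⟩ := exists_subseq_tendsto_of_bounded hΩo hΩf one_lt_two hW hbv hbG
  -- the truncated averages have the same limit as `v`, truncated
  have hgl : Tendsto (fun n => ∫ x in Ω, ‖clip M (cellAverage Ω (ns n) (v (ns n)) x) -
      clip M (w x)‖) atTop (𝓝 0) := by
    refine Metric.tendsto_atTop.2 fun ε hε => ?_
    obtain ⟨m₀, hm₀⟩ := exists_integral_sub_cellAverage_le hΩo hΩf one_lt_two C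
      (show 0 < ε / 3 by positivity)
    obtain ⟨N, hN⟩ := Metric.tendsto_atTop.1 hw (ε / 3) (by positivity)
    refine ⟨max m₀ N, fun n hn => ?_⟩
    have h1 := hm₀ (ns n) (((le_max_left _ _).trans hn).trans (hns.le_apply)) _ _ (hW (ns n))
      (hbv _) (hbG _)
    have h2 := hN n ((le_max_right _ _).trans hn)
    rw [Real.dist_0_eq_abs] at h2 ⊢
    have h3 := (le_abs_self _).trans_lt h2
    rw [abs_of_nonneg (integral_nonneg fun x => norm_nonneg _)]
    have ica := integrableOn_cellAverage hΩf (hvi (ns n)) (ns n)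
    have h4 := integral_norm_sub_le ica (hvi (ns n)) hwi
    have h5 : ∫ x in Ω, ‖clip M (cellAverage Ω (ns n) (v (ns n)) x) - clip M (w x)‖ ≤
        ∫ x in Ω, ‖cellAverage Ω (ns n) (v (ns n)) x - w x‖ :=
      integral_mono_of_nonneg (ae_of_all _ fun x => norm_nonneg _) (ica.sub hwi).norm
        (ae_of_all _ fun x => abs_clip_sub_clip_le _ _ _)
    have h6 : ∫ x in Ω, ‖cellAverage Ω (ns n) (v (ns n)) x - v (ns n) x‖ =
        ∫ x in Ω, ‖v (ns n) x - cellAverage Ω (ns n) (v (ns n)) x‖ := by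
      simp only [norm_sub_rev]
    linarith
  have hwm : AEStronglyMeasurable (fun x => clip M (w x)) (volume.restrict Ω) :=
    (continuous_clip M).comp_aestronglyMeasurable hwi.1
  have hwM : ∀ᵐ x ∂volume.restrict Ω, |clip M (w x)| ≤ M := ae_of_all _ fun x => abs_clip_le hM _
  obtain ⟨u', G', hu'⟩ := exists_isFluxSolution hΩo hΩf hp hβ hτ hτ' hwm hM hwM
  obtain ⟨v', Gv', hv'⟩ := exists_isMobilitySolution (F := fun x => f x - a * u' x) hΩf hq hτ
    hτ' hu'.isW1.memLp_grad.1 (memLp_two_of_ae_abs_le (hf.sub (hu'.isW1.memLp.1.const_mul a))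
      (ae_abs_sub_const_mul_le ha hfL (hK _ _ _ hu' hwm hwM)))
  have hvl := tendsto_integral_norm_sub_of_rhs hΩo hΩf hp hq ha hβ hτ hτ' hM hf hfL
    (fun n => hgm (ns n)) hwm (fun n => hgM (ns n)) hwM (fun n => hu (ns n)) hu'
    (fun n => hv (ns n)) hv' hgl
  have hv'i := hv'.isW1.integrableOn hΩf one_le_two
  have hz : ∫ x in Ω, ‖w x - v' x‖ = 0 := by
    refine le_antisymm ?_ (integral_nonneg fun x => norm_nonneg _)
    have h1 := hw.add hvl
    rw [add_zero] at h1
    refine ge_of_tendsto' h1 fun n => ?_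
    have h2 := integral_norm_sub_le hwi (hvi (ns n)) hv'i
    have h3 : ∫ x in Ω, ‖w x - v (ns n) x‖ = ∫ x in Ω, ‖v (ns n) x - w x‖ := by
      simp only [norm_sub_rev]
    linarith
  have hae : w =ᵐ[volume.restrict Ω] v' := by
    have h1 := (integral_eq_zero_iff_of_nonneg (fun x => norm_nonneg _) (hwi.sub hv'i).norm).1 hz
    filter_upwards [h1] with x hx
    exact sub_eq_zero.1 (norm_eq_zero.1 hx)
  refine ⟨u', G', v', Gv', hu'.congr_rhs ?_, hv'⟩
  filter_upwards [hae] with x hx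
  rw [hx]

end FixedPoint

/-! ### Bounds that do not depend on the truncation level -/

section APriori

variable {p q a β τ M L : ℝ} {Ω : Set Plane} {f g h : Plane → ℝ} {u v : Plane → ℝ}
  {G Gv : Plane → Plane}

lemma IsBoundedLipschitzDomain.exists_integral_sq_le (hΩ : IsBoundedLipschitzDomain Ω) :
    ∃ C : ℝ, 0 ≤ C ∧ ∀ u G, IsW1 Ω 1 u G → MemLp u 2 (volume.restrict Ω) ∧
      ∫ x in Ω, ‖u x‖ ^ 2 ≤ (C * ((∫ x in Ω, ‖u x‖) + ∫ x in Ω, ‖G x‖)) ^ 2 := by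
  obtain ⟨C, hC⟩ := hΩ.exists_sobolev
  refine ⟨√C, Real.sqrt_nonneg _, fun u G h => ?_⟩
  have iu := h.integrableOn hΩ.volume_ne_top le_rfl
  have iG := h.integrableOn_grad hΩ.volume_ne_top le_rfl
  have n1 : 0 ≤ ∫ x in Ω, ‖u x‖ := integral_nonneg fun x => norm_nonneg _
  have n2 : 0 ≤ ∫ x in Ω, ‖G x‖ := integral_nonneg fun x => norm_nonneg _
  have h1 := hC u G h
  rw [← ofReal_integral_norm_eq_lintegral_enorm iu, ← ofReal_integral_norm_eq_lintegral_enorm iG,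
    ← ENNReal.ofReal_add n1 n2, ← ENNReal.ofReal_pow (add_nonneg n1 n2),
    ← ENNReal.ofReal_coe_nnreal, ← ENNReal.ofReal_mul C.coe_nonneg] at h1
  have h2 : ∫⁻ x in Ω, ‖u x‖ₑ ^ 2 = ∫⁻ x in Ω, ENNReal.ofReal (‖u x‖ ^ 2) := by
    refine lintegral_congr fun x => ?_
    rw [ENNReal.ofReal_pow (norm_nonneg _), ofReal_norm]
  have i2 : IntegrableOn (fun x => ‖u x‖ ^ 2) Ω := by
    refine ⟨iu.1.norm.pow 2, ?_⟩
    rw [hasFiniteIntegral_iff_ofReal (ae_of_all _ fun x => by positivity), ← h2]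
    exact h1.trans_lt ENNReal.ofReal_lt_top
  refine ⟨(memLp_two_iff_integrable_sq_norm iu.1).2 i2, ?_⟩
  rw [h2, ← ofReal_integral_eq_lintegral_ofReal i2 (ae_of_all _ fun x => by positivity),
    ENNReal.ofReal_le_ofReal_iff (by positivity)] at h1
  rwa [mul_pow, Real.sq_sqrt C.coe_nonneg]

lemma integral_mul_le_of_integral_sq_le {α : Type*} [MeasurableSpace α] {μ : Measure α}
    {f g : α → ℝ} {A B : ℝ} (hA : 0 ≤ A) (hB : 0 ≤ B) (hf0 : ∀ x, 0 ≤ f x) (hg0 : ∀ x, 0 ≤ g x)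
    (hf : MemLp f 2 μ) (hg : MemLp g 2 μ) (hfA : ∫ x, ‖f x‖ ^ 2 ∂μ ≤ A ^ 2)
    (hgB : ∫ x, ‖g x‖ ^ 2 ∂μ ≤ B ^ 2) : ∫ x, f x * g x ∂μ ≤ A * B := by
  have e2 : ENNReal.ofReal 2 = 2 := by simp
  have h1 := integral_mul_le_Lp_mul_Lq_of_nonneg Real.HolderConjugate.two_two (ae_of_all μ hf0)
    (ae_of_all μ hg0) (by rwa [e2]) (by rwa [e2])
  have h2 : ∀ {k : α → ℝ} {D : ℝ}, 0 ≤ D → ∫ x, ‖k x‖ ^ 2 ∂μ ≤ D ^ 2 →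
      (∫ x, k x ^ (2 : ℝ) ∂μ) ^ (1 / 2 : ℝ) ≤ D := by
    intro k D hD hk
    simp only [Real.rpow_two]
    simp only [Real.norm_eq_abs, sq_abs] at hk
    rw [← Real.sqrt_eq_rpow]
    exact Real.sqrt_le_iff.2 ⟨hD, hk⟩
  refine h1.trans (mul_le_mul (h2 hA hfA) (h2 hB hgB) (Real.rpow_nonneg
    (integral_nonneg fun x => Real.rpow_nonneg (hg0 x) _) _) hA)

lemma clip_neg (hM : 0 ≤ M) (t : ℝ) : clip M (-t) = -clip M t := by
  unfold clip
  rcases le_total t M with h1 | h1 <;> rcases le_total (-t) M with h2 | h2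
  · rw [min_eq_left h1, min_eq_left h2, max_eq_left (by linarith), max_eq_left (by linarith)]
  · rw [min_eq_left h1, min_eq_right h2, max_eq_left (by linarith), max_eq_right (by linarith),
      neg_neg]
  · rw [min_eq_right h1, min_eq_left h2, max_eq_right (by linarith), max_eq_left (by linarith)]
  · rw [min_eq_right h1, min_eq_right h2, max_eq_left (by linarith)]
    linarith

/-- The energy estimate for the truncation of `v`. The coupling terms of the two equations combine
to the integral of `u * clip M v`, which has a sign, so the bound does not depend on `M`. -/
lemma energy_clip_le (hΩo : IsOpen Ω) (hΩf : volume Ω ≠ ⊤) (hp : 1 < p)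
    (hq : 0 ≤ q) (ha : 0 ≤ a) (hβ : 0 < β) (hτ : 0 < τ) (hτ' : τ ≤ 1) (hM : 0 ≤ M)
    (hf : AEStronglyMeasurable f (volume.restrict Ω)) (hfL : ∀ᵐ x ∂volume.restrict Ω, |f x| ≤ L)
    (hu : IsFluxSolution Ω p β τ (fun x => clip M (v x)) u G)
    (hv : IsMobilitySolution Ω q τ G (fun x => f x - a * u x) v Gv) :
    τ * (∫ x in Ω, ‖{x | |v x| ≤ M}.indicator Gv x‖ ^ 2) + τ / 2 * (∫ x in Ω, ‖clip M (v x)‖ ^ 2) ≤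
      L ^ 2 / (2 * τ) * volume.real Ω := by
  have : IsFiniteMeasure (volume.restrict Ω) := ⟨by simpa using hΩf.lt_top⟩
  have hW := hv.isW1
  have hc := hW.clip hΩo hΩf one_le_two hM
  have e1 := hv.integral_eq _ _ hc
  have e2 := hu.integral_eq _ _ hu.isW1
  have hcm : AEStronglyMeasurable (fun x => clip M (v x)) (volume.restrict Ω) := hc.memLp.1
  have hcM : ∀ᵐ x ∂volume.restrict Ω, |clip M (v x)| ≤ M := ae_of_all _ fun x => abs_clip_le hM _
  have iu := hu.isW1.integrableOn hΩf (one_le_ofReal hp)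
  have i1 := integrable_inner_of_memLp
    (memLp_mobilityMap hq hτ hτ' hu.isW1.memLp_grad.1 hW.memLp_grad) hc.memLp_grad
  have i2 : IntegrableOn (fun x => f x * clip M (v x)) Ω :=
    (hc.integrableOn hΩf one_le_two).bdd_mul hf hfL
  have i3 : IntegrableOn (fun x => clip M (v x) * u x) Ω := iu.bdd_mul hcm hcM
  have i4 : IntegrableOn (fun x => ‖{x | |v x| ≤ M}.indicator Gv x‖ ^ 2) Ω :=
    hc.memLp_grad.integrable_norm_pow two_ne_zero
  have i5 : IntegrableOn (fun x => ‖clip M (v x)‖ ^ 2) Ω :=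
    hc.memLp.integrable_norm_pow two_ne_zero
  have i6 : IntegrableOn (fun x => v x * clip M (v x)) Ω := hW.memLp.integrable_mul hc.memLp
  have h1 : τ * (∫ x in Ω, ‖{x | |v x| ≤ M}.indicator Gv x‖ ^ 2) ≤
      ∫ x in Ω, inner ℝ (mobilityMap q τ (G x) (Gv x)) ({x | |v x| ≤ M}.indicator Gv x) := by
    rw [← integral_const_mul]
    refine integral_mono (i4.const_mul τ) i1 fun x => ?_
    by_cases hx : x ∈ {x | |v x| ≤ M}
    · simp only [indicator_of_mem hx]
      exact le_inner_mobilityMap hq hτ _ _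
    · simp only [indicator_of_notMem hx, inner_zero_right, norm_zero]
      simp
  have h2 : ∫ x in Ω, ‖clip M (v x)‖ ^ 2 ≤ ∫ x in Ω, v x * clip M (v x) :=
    integral_mono i5 i6 fun x => by
      change ‖clip M (v x)‖ ^ 2 ≤ v x * clip M (v x)
      rw [Real.norm_eq_abs, sq_abs]
      exact clip_mul_self_nonneg hM _
  have h3 : ∫ x in Ω, (f x - a * u x) * clip M (v x) =
      (∫ x in Ω, f x * clip M (v x)) - a * ∫ x in Ω, clip M (v x) * u x := by
    rw [← integral_const_mul, ← integral_sub i2 (i3.const_mul a)]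
    exact integral_congr_ae (ae_of_all _ fun x => by ring)
  have h4 : 0 ≤ ∫ x in Ω, clip M (v x) * u x := by
    rw [← e2]
    exact add_nonneg (integral_nonneg fun x => inner_flux_nonneg hτ hβ _)
      (mul_nonneg hτ.le (integral_nonneg fun x => signedPow_mul_self_nonneg _))
  have h5 : ∫ x in Ω, f x * clip M (v x) ≤
      ∫ x in Ω, (L ^ 2 / (2 * τ) + τ / 2 * ‖clip M (v x)‖ ^ 2) := by
    refine integral_mono_ae i2 ((integrable_const _).add (i5.const_mul _)) ?_
    filter_upwards [hfL] with x hx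
    have h5 : f x * clip M (v x) ≤ L * ‖clip M (v x)‖ := by
      refine (le_abs_self _).trans ?_
      rw [abs_mul]
      exact mul_le_mul_of_nonneg_right hx (abs_nonneg _)
    have h7 : L ^ 2 / (2 * τ) + τ / 2 * ‖clip M (v x)‖ ^ 2 =
        (L ^ 2 + τ ^ 2 * ‖clip M (v x)‖ ^ 2) / (2 * τ) := by field_simp
    refine h5.trans ?_
    rw [h7, le_div_iff₀ (by positivity)]
    nlinarith [sq_nonneg (L - τ * ‖clip M (v x)‖)]
  rw [integral_add (integrable_const _) (i5.const_mul _), integral_const_mul] at h5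
  simp only [integral_const, smul_eq_mul, measureReal_restrict_apply_univ] at h5
  have h6 := mul_le_mul_of_nonneg_left h2 hτ.le
  have h7 := mul_nonneg ha h4
  linarith

/-- By the Sobolev inequality, the superlevel sets of a function in `W^{1,2}(Ω)` carry little of its
`L²` norm: the truncation at height `m` has norm at most `C / m`. -/
lemma exists_integral_posPart_sq_le (hΩ : IsBoundedLipschitzDomain Ω) (D : ℝ) :
    ∃ C : ℝ, 0 ≤ C ∧ ∀ (h : Plane → ℝ) (Gh : Plane → Plane), IsW1 Ω 2 h Gh →
      ∫ x in Ω, ‖h x‖ ^ 2 ≤ D → ∫ x in Ω, ‖Gh x‖ ^ 2 ≤ D → ∀ m, 0 < m →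
      ∫ x in Ω, ‖max (h x - m) 0‖ ^ 2 ≤ (C / m) ^ 2 := by
  obtain ⟨C, hC0, hC⟩ := hΩ.exists_integral_sq_le
  have hΩf := hΩ.volume_ne_top
  refine ⟨C * (3 * |D|), by positivity, fun h Gh hW hD hD' m hm => ?_⟩
  have hP := hW.posPart hΩ.isOpen hΩf one_le_two m
  have h1 := (hC _ _ (hP.mono hΩf one_le_two)).2
  have i1 : IntegrableOn (fun x => ‖h x‖ ^ 2) Ω := hW.memLp.integrable_norm_pow two_ne_zero
  have i2 : IntegrableOn (fun x => ‖Gh x‖ ^ 2) Ω := hW.memLp_grad.integrable_norm_pow two_ne_zero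
  have h2 : ∫ x in Ω, ‖max (h x - m) 0‖ ≤ |D| / m := by
    have h3 : ∫ x in Ω, ‖max (h x - m) 0‖ ≤ ∫ x in Ω, ‖h x‖ ^ 2 / m := by
      refine integral_mono (hP.integrableOn hΩf one_le_two).norm (i1.div_const m) fun x => ?_
      change ‖max (h x - m) 0‖ ≤ ‖h x‖ ^ 2 / m
      rw [le_div_iff₀ hm, Real.norm_of_nonneg (le_max_right _ _), Real.norm_eq_abs, sq_abs]
      rcases le_total (h x) m with hx | hx
      · rw [max_eq_right (by linarith), zero_mul]
        positivity
      · rw [max_eq_left (by linarith)]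
        nlinarith
    rw [integral_div] at h3
    refine h3.trans (div_le_div_of_nonneg_right (hD.trans (le_abs_self D)) hm.le)
  have h4 : ∫ x in Ω, ‖{x | m < h x}.indicator Gh x‖ ≤ 2 * |D| / m := by
    have h3 : ∫ x in Ω, ‖{x | m < h x}.indicator Gh x‖ ≤
        ∫ x in Ω, (‖h x‖ ^ 2 + ‖Gh x‖ ^ 2) / m := by
      refine integral_mono (hP.integrableOn_grad hΩf one_le_two).norm ((i1.add i2).div_const m)
        fun x => ?_
      change ‖{x | m < h x}.indicator Gh x‖ ≤ (‖h x‖ ^ 2 + ‖Gh x‖ ^ 2) / m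
      rw [le_div_iff₀ hm]
      by_cases hx : x ∈ {x | m < h x}
      · rw [indicator_of_mem hx]
        have h5 : m < ‖h x‖ := lt_of_lt_of_le hx (le_abs_self _)
        have h6 := mul_le_mul_of_nonneg_left h5.le (norm_nonneg (Gh x))
        nlinarith [sq_nonneg (‖h x‖ - ‖Gh x‖), sq_nonneg ‖h x‖, sq_nonneg ‖Gh x‖]
      · rw [indicator_of_notMem hx, norm_zero, zero_mul]
        positivity
    rw [integral_div, integral_add i1 i2] at h3
    refine h3.trans (div_le_div_of_nonneg_right ?_ hm.le)
    linarith [le_abs_self D]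
  refine h1.trans (pow_le_pow_left₀ (mul_nonneg hC0 (add_nonneg
    (integral_nonneg fun x => norm_nonneg _) (integral_nonneg fun x => norm_nonneg _))) ?_ 2)
  calc _ ≤ C * (|D| / m + 2 * |D| / m) := mul_le_mul_of_nonneg_left (add_le_add h2 h4) hC0
    _ = C * (3 * |D|) / m := by ring

/-- Stampacchia's lemma in the quadratic case: a nonincreasing function whose values satisfy a
superlinear recursive estimate vanishes at a height that is determined by the constants. -/
lemma eq_zero_of_sq_mul_le {A : ℝ → ℝ} {C V k₀ d : ℝ} (hA0 : ∀ k, 0 ≤ A k) (hAV : ∀ k, A k ≤ V)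
    (hanti : Antitone A) (hd : 0 < d) (hdC : 16 * C ^ 2 * V ≤ d ^ 2)
    (h : ∀ k l, k₀ ≤ k → k < l → (l - k) ^ 2 * A l ≤ (C * A k) ^ 2) : A (k₀ + d) = 0 := by
  have hV : 0 ≤ V := (hA0 0).trans (hAV 0)
  -- along the heights `k₀ + d (1 - 2⁻ʲ)` the values decay like `4⁻ʲ`
  have key : ∀ j : ℕ, A (k₀ + d * (1 - (1 / 2) ^ j)) ≤ V * (1 / 4) ^ j := by
    intro j
    induction j with
    | zero => simpa using hAV _
    | succ j ih =>
      have hpos : (0 : ℝ) < (1 / 2) ^ j := by positivity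
      have hle : (1 / 2 : ℝ) ^ j ≤ 1 := pow_le_one₀ (by norm_num) (by norm_num)
      have h1 := h (k₀ + d * (1 - (1 / 2) ^ j)) (k₀ + d * (1 - (1 / 2) ^ (j + 1)))
        (by nlinarith) (by rw [pow_succ]; nlinarith)
      have e1 : k₀ + d * (1 - (1 / 2) ^ (j + 1)) - (k₀ + d * (1 - (1 / 2) ^ j)) =
          d * ((1 / 2) ^ j / 2) := by rw [pow_succ]; ring
      rw [e1] at h1
      set s : ℝ := (1 / 2) ^ j
      have e4 : (1 / 4 : ℝ) ^ j = s ^ 2 := by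
        simp only [s]; rw [← pow_mul, mul_comm, pow_mul]; norm_num
      have e5 : (1 / 4 : ℝ) ^ (j + 1) = s ^ 2 / 4 := by rw [pow_succ, e4]; ring
      rw [e4] at ih
      rw [e5]
      set x := A (k₀ + d * (1 - (1 / 2) ^ (j + 1)))
      set y := A (k₀ + d * (1 - s))
      have hy0 : 0 ≤ y := hA0 _
      have h2 : (C * y) ^ 2 ≤ C ^ 2 * (V * s ^ 2) ^ 2 := by
        rw [mul_pow]; gcongr
      have h3 : C ^ 2 * (V * s ^ 2) ^ 2 ≤ d ^ 2 / 16 * (V * s ^ 4) := by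
        have h4 : C ^ 2 * V ≤ d ^ 2 / 16 := by linarith
        have h5 : 0 ≤ V * s ^ 4 := by positivity
        have := mul_le_mul_of_nonneg_right h4 h5
        nlinarith
      have h6 : d ^ 2 * s ^ 2 / 4 * x ≤ d ^ 2 * s ^ 2 / 4 * (V * (s ^ 2 / 4)) := by
        have e6 : (d * (s / 2)) ^ 2 * x = d ^ 2 * s ^ 2 / 4 * x := by ring
        have e7 : d ^ 2 / 16 * (V * s ^ 4) = d ^ 2 * s ^ 2 / 4 * (V * (s ^ 2 / 4)) := by ring
        linarith
      exact le_of_mul_le_mul_left h6 (by positivity)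
  have hlim : Tendsto (fun j : ℕ => V * (1 / 4 : ℝ) ^ j) atTop (𝓝 0) := by
    simpa using (tendsto_pow_atTop_nhds_zero_of_lt_one (by norm_num : (0 : ℝ) ≤ 1 / 4)
      (by norm_num)).const_mul V
  refine le_antisymm (ge_of_tendsto' hlim fun j => ?_) (hA0 _)
  refine (hanti ?_).trans (key j)
  have hpos : (0 : ℝ) < (1 / 2) ^ j := by positivity
  nlinarith

/-- The bound on `u` that does not depend on the truncation level `M`, by Stampacchia's method. At a
large height `k` the absorption term `τ k ^ (p - 1)` leaves only the top of the right-hand side,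
which has a small norm in `L²`; the linear growth of the flux and the Sobolev inequality bound the
norm of `(u - k)⁺` in `L²` by the measure of `{k < u}`. -/
theorem exists_ae_le_of_solution_clip (hΩ : IsBoundedLipschitzDomain Ω) (hp : 1 < p)
    (hq : 0 ≤ q) (ha : 0 ≤ a) (hβ : 0 < β) (hτ : 0 < τ) (hτ' : τ ≤ 1) (L : ℝ) :
    ∃ K, ∀ (M : ℝ) (f u v : Plane → ℝ) (G Gv : Plane → Plane), 0 ≤ M →
      AEStronglyMeasurable f (volume.restrict Ω) → (∀ᵐ x ∂volume.restrict Ω, |f x| ≤ L) →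
      IsFluxSolution Ω p β τ (fun x => clip M (v x)) u G →
      IsMobilitySolution Ω q τ G (fun x => f x - a * u x) v Gv →
      ∀ᵐ x ∂volume.restrict Ω, u x ≤ K := by
  have hΩo := hΩ.isOpen
  have hΩf := hΩ.volume_ne_top
  have : IsFiniteMeasure (volume.restrict Ω) := ⟨by simpa using hΩf.lt_top⟩
  have hp1 := one_le_ofReal hp
  set V := volume.real Ω
  set D₀ := L ^ 2 / (2 * τ) * V
  obtain ⟨C₁, hC₁0, hC₁⟩ := exists_integral_posPart_sq_le hΩ (D₀ / (τ / 2))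
  obtain ⟨S, hS0, hS⟩ := hΩ.exists_integral_sq_le
  set b := min β 1
  have hb : 0 < b := lt_min hβ one_pos
  -- `m` is the height above which the right-hand side is so small in `L²` that its contribution is
  -- absorbed; `k₀` is the height at which the absorption term exceeds `m` by one
  set m := 2 * (C₁ * S) / b + 1 with hm_def
  have hm : 0 < m := by positivity
  have hmb : C₁ / m * S ≤ b / 2 := by
    rw [div_mul_eq_mul_div, div_le_div_iff₀ hm two_pos, hm_def, mul_add, mul_div_cancel₀ _ hb.ne']
    linarith
  set k₀ := ((m + 1) / τ) ^ (1 / (p - 1))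
  have hk₀0 : 0 ≤ k₀ := by positivity
  have hk₀ : τ * k₀ ^ (p - 1) = m + 1 := by
    rw [← Real.rpow_mul (by positivity), one_div_mul_cancel (by linarith), Real.rpow_one,
      mul_div_cancel₀ _ hτ.ne']
  -- the constants of the recursion for the measure of the superlevel sets
  set C := S * (2 * β * √τ / b)
  set d := √(16 * C ^ 2 * V) + 1
  have hV : 0 ≤ V := measureReal_nonneg
  have hd : 0 < d := by positivity
  have hdC : 16 * C ^ 2 * V ≤ d ^ 2 := by
    have h1 := Real.sq_sqrt (by positivity : 0 ≤ 16 * C ^ 2 * V)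
    have h2 := Real.sqrt_nonneg (16 * C ^ 2 * V)
    nlinarith
  refine ⟨k₀ + d, fun M f u v G Gv hM hf hfL hu hv => ?_⟩
  set h : Plane → ℝ := fun x => clip M (v x)
  have hh := hv.isW1.clip hΩo hΩf one_le_two hM
  have hen := energy_clip_le hΩo hΩf hp hq ha hβ hτ hτ' hM hf hfL hu hv
  have n1 : 0 ≤ ∫ x in Ω, ‖{x | |v x| ≤ M}.indicator Gv x‖ ^ 2 :=
    integral_nonneg fun x => by positivity
  have n2 : 0 ≤ ∫ x in Ω, ‖clip M (v x)‖ ^ 2 := integral_nonneg fun x => by positivity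
  have hhm : ∫ x in Ω, ‖max (h x - m) 0‖ ^ 2 ≤ (C₁ / m) ^ 2 := by
    refine hC₁ _ _ hh ?_ ?_ m hm
    · rw [le_div_iff₀' (by positivity)]
      linarith [mul_nonneg hτ.le n1]
    · rw [le_div_iff₀' (by positivity)]
      linarith [mul_nonneg hτ.le n1, mul_nonneg hτ.le n2]
  have hhm2 : MemLp (fun x => max (h x - m) 0) 2 (volume.restrict Ω) :=
    (hh.posPart hΩo hΩf one_le_two m).memLp
  have hnull : ∀ k, NullMeasurableSet {x | k < u x} (volume.restrict Ω) := fun k =>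
    nullMeasurableSet_lt_const hu.isW1.memLp.1 k
  set A : ℝ → ℝ := fun k => (volume.restrict Ω).real {x | k < u x}
  have est : ∀ k, k₀ ≤ k → MemLp (fun x => max (u x - k) 0) 2 (volume.restrict Ω) ∧
      ∫ x in Ω, ‖max (u x - k) 0‖ ^ 2 ≤ (C * A k) ^ 2 := by
    intro k hk
    have hk0 : 0 ≤ k := hk₀0.trans hk
    have hw := hu.isW1.posPart hΩo hΩf hp1 k
    obtain ⟨hw2, hwS⟩ := hS _ _ (hw.mono hΩf hp1)
    refine ⟨hw2, ?_⟩
    have iw := hw.integrableOn hΩf hp1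
    have iG := hw.integrableOn_grad hΩf hp1
    set I₁ := ∫ x in Ω, ‖max (u x - k) 0‖
    set I₂ := ∫ x in Ω, ‖{x | k < u x}.indicator G x‖
    have hI₁ : 0 ≤ I₁ := integral_nonneg fun x => norm_nonneg _
    have hI₂ : 0 ≤ I₂ := integral_nonneg fun x => norm_nonneg _
    have e := hu.posPart_eq hΩo hΩf hp k
    have i1 := integrable_signedPow_mul hp hu.isW1.memLp hw.memLp
    have i2 : IntegrableOn (fun x => h x * max (u x - k) 0) Ω :=
      iw.bdd_mul hh.memLp.1 (ae_of_all _ fun x => abs_clip_le hM _)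
    have i3 : IntegrableOn (fun x => max (h x - m) 0 * max (u x - k) 0) Ω :=
      hhm2.integrable_mul hw2
    have i4 := (integrable_inner_flux (β := β) hp hτ hτ' hβ hu.isW1.memLp_grad
      hu.isW1.memLp_grad).indicator₀ (hnull k)
    have iA : IntegrableOn ({x | k < u x}.indicator fun _ => (1 : ℝ)) Ω :=
      (integrable_const 1).indicator₀ (hnull k)
    have hAk : ∫ x in Ω, {x | k < u x}.indicator (fun _ => (1 : ℝ)) x = A k := by
      rw [integral_indicator₀ (hnull k)]
      simp [A, Measure.real]
    have h1 : β * I₂ - β * √τ * A k ≤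
        ∫ x in Ω, {x | k < u x}.indicator (fun x => inner ℝ (flux p β τ (G x)) (G x)) x := by
      rw [← hAk, ← integral_const_mul, ← integral_const_mul,
        ← integral_sub (iG.norm.const_mul β) (iA.const_mul (β * √τ))]
      refine integral_mono ((iG.norm.const_mul β).sub (iA.const_mul (β * √τ))) i4 fun x => ?_
      by_cases hx : x ∈ {x | k < u x}
      · simp only [indicator_of_mem hx]
        linarith [le_inner_flux (p := p) hτ hβ (G x)]
      · simp only [indicator_of_notMem hx, norm_zero]
        simp
    have h2 : I₁ ≤ ∫ x in Ω, (τ * (signedPow p (u x) * max (u x - k) 0) -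
        h x * max (u x - k) 0 + max (h x - m) 0 * max (u x - k) 0) := by
      refine integral_mono iw.norm (((i1.const_mul τ).sub i2).add i3) fun x => ?_
      change ‖max (u x - k) 0‖ ≤ τ * (signedPow p (u x) * max (u x - k) 0) -
        h x * max (u x - k) 0 + max (h x - m) 0 * max (u x - k) 0
      rw [Real.norm_of_nonneg (le_max_right _ _)]
      rcases le_total (u x) k with hx | hx
      · rw [max_eq_right (sub_nonpos.2 hx)]; simp
      · have h3 : m + 1 ≤ τ * signedPow p (u x) := by
          rw [← hk₀]
          refine mul_le_mul_of_nonneg_left ?_ hτ.le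
          rw [← signedPow_of_nonneg hp hk₀0]
          exact (strictMono_signedPow hp).monotone (hk.trans hx)
        have h4 := le_max_left (h x - m) 0
        have h5 : 1 ≤ τ * signedPow p (u x) - h x + max (h x - m) 0 := by linarith
        have := mul_le_mul_of_nonneg_right h5 (le_max_right (u x - k) 0)
        linarith
    have i12 : IntegrableOn (fun x => τ * (signedPow p (u x) * max (u x - k) 0) -
        h x * max (u x - k) 0) Ω := (i1.const_mul τ).sub i2
    rw [integral_add i12 i3, integral_sub (i1.const_mul τ) i2, integral_const_mul] at h2
    have h3 : ∫ x in Ω, max (h x - m) 0 * max (u x - k) 0 ≤ C₁ / m * (S * (I₁ + I₂)) :=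
      integral_mul_le_of_integral_sq_le (by positivity) (by positivity)
        (fun x => le_max_right _ _) (fun x => le_max_right _ _) hhm2 hw2 hhm hwS
    have h4 : b * (I₁ + I₂) ≤ β * √τ * A k + b / 2 * (I₁ + I₂) := by
      have h5 : b * I₁ ≤ I₁ := mul_le_of_le_one_left hI₁ (min_le_right _ _)
      have h6 : b * I₂ ≤ β * I₂ := mul_le_mul_of_nonneg_right (min_le_left _ _) hI₂
      have h7 := mul_le_mul_of_nonneg_right hmb (add_nonneg hI₁ hI₂)
      linarith
    have h5 : I₁ + I₂ ≤ 2 * β * √τ / b * A k := by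
      rw [div_mul_eq_mul_div, le_div_iff₀ hb]
      linarith
    refine hwS.trans (pow_le_pow_left₀ (by positivity) ?_ 2)
    calc S * (I₁ + I₂) ≤ S * (2 * β * √τ / b * A k) := mul_le_mul_of_nonneg_left h5 hS0
      _ = C * A k := by ring
  have hzero : A (k₀ + d) = 0 := by
    refine eq_zero_of_sq_mul_le (C := C) (V := V) (fun k => measureReal_nonneg) (fun k => ?_)
      (fun k l hkl => ?_) hd hdC fun k l hk hkl => ?_
    · have : A k ≤ (volume.restrict Ω).real univ := measureReal_mono (subset_univ _)
      rwa [measureReal_restrict_apply_univ] at this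
    · exact measureReal_mono fun x hx => lt_of_le_of_lt hkl hx
    · obtain ⟨hw2, hle⟩ := est k hk
      refine le_trans ?_ hle
      have h1 : (l - k) ^ 2 * A l =
          ∫ x in Ω, {x | l < u x}.indicator (fun _ => (l - k) ^ 2) x := by
        rw [integral_indicator₀ (hnull l)]
        simp [A, Measure.real, mul_comm]
      rw [h1]
      refine integral_mono ((integrable_const _).indicator₀ (hnull l))
        (hw2.integrable_norm_pow two_ne_zero) fun x => ?_
      by_cases hx : x ∈ {x | l < u x}
      · simp only [indicator_of_mem hx]
        have hx' : l < u x := hx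
        rw [Real.norm_of_nonneg (le_max_right _ _)]
        refine pow_le_pow_left₀ (by linarith) ?_ 2
        exact le_trans (by linarith) (le_max_left _ _)
      · simp only [indicator_of_notMem hx]
        positivity
  have h0 : (volume.restrict Ω) {x | k₀ + d < u x} = 0 :=
    (measureReal_eq_zero_iff).1 hzero
  rw [ae_iff]
  simpa only [not_le] using h0

/-- The lower bound follows from the upper bound, since the system is invariant under a change of sign
of `f`, `u` and `v`. -/
lemma exists_ae_abs_le_of_solution_clip (hΩ : IsBoundedLipschitzDomain Ω) (hp : 1 < p)
    (hq : 0 ≤ q) (ha : 0 ≤ a) (hβ : 0 < β) (hτ : 0 < τ) (hτ' : τ ≤ 1) (L : ℝ) :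
    ∃ K, 0 ≤ K ∧ ∀ (M : ℝ) (f u v : Plane → ℝ) (G Gv : Plane → Plane), 0 ≤ M →
      AEStronglyMeasurable f (volume.restrict Ω) → (∀ᵐ x ∂volume.restrict Ω, |f x| ≤ L) →
      IsFluxSolution Ω p β τ (fun x => clip M (v x)) u G →
      IsMobilitySolution Ω q τ G (fun x => f x - a * u x) v Gv →
      ∀ᵐ x ∂volume.restrict Ω, |u x| ≤ K := by
  obtain ⟨K, hK⟩ := exists_ae_le_of_solution_clip hΩ hp hq ha hβ hτ hτ' L
  refine ⟨|K|, abs_nonneg K, fun M f u v G Gv hM hf hfL hu hv => ?_⟩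
  have h1 := hK M f u v G Gv hM hf hfL hu hv
  have hu' : IsFluxSolution Ω p β τ (fun x => clip M (-v x)) (fun x => -u x) (fun x => -G x) :=
    hu.neg.congr_rhs (ae_of_all _ fun x => (clip_neg hM (v x)).symm)
  have hv' : IsMobilitySolution Ω q τ (fun x => -G x) (fun x => -f x - a * -u x)
      (fun x => -v x) (fun x => -Gv x) := by
    refine ⟨hv.isW1.neg, fun φ Gφ hφ => ?_⟩
    have e := hv.neg.integral_eq φ Gφ hφ
    simp only [mobilityMap_neg_left]
    rw [e]
    exact integral_congr_ae (ae_of_all _ fun x => by ring)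
  have h2 := hK M _ _ _ _ _ hM hf.neg (by simpa using hfL) hu' hv'
  filter_upwards [h1, h2] with x hx hx'
  have := le_abs_self K
  exact abs_le.2 ⟨by linarith, by linarith⟩

end APriori

end CrystalSurface

theorem theorem3p1 (Ω : Set CrystalSurface.Plane)
    (hΩ : CrystalSurface.IsBoundedLipschitzDomain Ω)
    (p q a β τ : ℝ) (hp : 1 < p) (hq : 0 ≤ q) (ha : 0 < a) (hβ : 0 < β)
    (hτ : 0 < τ) (hτ' : τ ≤ 1)
    (f : CrystalSurface.Plane → ℝ) (hf : MemLp f ∞ (volume.restrict Ω)) :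
    ∃ v u : CrystalSurface.Plane → ℝ,
      CrystalSurface.IsWeakSolution Ω p q a β τ f v u ∧
      (∃ Gv, CrystalSurface.IsW1 Ω 2 v Gv) ∧ MemLp v ∞ (volume.restrict Ω) ∧
      (∃ Gu, CrystalSurface.IsW1 Ω (ENNReal.ofReal p) u Gu) ∧
      MemLp u ∞ (volume.restrict Ω) := by
  have hΩf := hΩ.volume_ne_top
  obtain ⟨L, hfL⟩ : ∃ L : ℝ, ∀ᵐ x ∂volume.restrict Ω, |f x| ≤ L := by
    refine ⟨(eLpNorm f ∞ (volume.restrict Ω)).toReal, ?_⟩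
    rw [eLpNorm_exponent_top]
    filter_upwards [ae_le_eLpNormEssSup (f := f) (μ := volume.restrict Ω)] with x hx
    have h1 : eLpNormEssSup f (volume.restrict Ω) ≠ ⊤ := by
      rw [← eLpNorm_exponent_top]; exact hf.2.ne
    rw [← Real.norm_eq_abs, ← toReal_enorm]
    exact ENNReal.toReal_mono h1 hx
  obtain ⟨K, hK0, hK⟩ :=
    CrystalSurface.exists_ae_abs_le_of_solution_clip hΩ hp hq ha.le hβ hτ hτ' |L|
  have hfL' : ∀ᵐ x ∂volume.restrict Ω, |f x| ≤ |L| := by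
    filter_upwards [hfL] with x hx
    exact hx.trans (le_abs_self L)
  -- the truncation level lies above the bound that the maximum principle gives for `v`
  set M := (|L| + a * K + 1) / τ with hM_def
  have hM : 0 ≤ M := by positivity
  have hMτ : |L| + a * K < τ * M := by
    rw [hM_def, mul_div_cancel₀ _ hτ.ne']
    linarith
  obtain ⟨u, G, v, Gv, hu, hv⟩ := CrystalSurface.exists_solution_clip hΩ.isOpen hΩf hp hq ha.le hβ
    hτ hτ' hM hf.1 hfL'
  have huK := hK M f u v G Gv hM hf.1 hfL' hu hv
  have hvM := hv.ae_abs_le hΩ.isOpen hΩf hq hτ (hf.1.sub (hu.isW1.memLp.1.const_mul a))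
    (CrystalSurface.ae_abs_sub_const_mul_le ha.le hfL' huK) hMτ
  have hu' : CrystalSurface.IsFluxSolution Ω p β τ v u G := by
    refine hu.congr_rhs ?_
    filter_upwards [hvM] with x hx
    exact CrystalSurface.clip_eq_self hx
  refine ⟨v, u, ⟨Gv, G, hv.isW1, hu'.isW1, fun φ Gφ hφ => ?_, hu'.integral_eq⟩, ⟨Gv, hv.isW1⟩,
    memLp_top_of_bound hv.isW1.memLp.1 M hvM, ⟨G, hu.isW1⟩,
    memLp_top_of_bound hu.isW1.memLp.1 K huK⟩
  simp only [CrystalSurface.toEuclideanLin_mobility]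
  exact hv.integral_eq φ Gφ hφ
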